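/- Let $\Gamma$ be the infinite chain of rings of circumference $2\pi$ indexed by $j\in\mathbb Z$, where ring $j$ consists of an upper and a lower semicircle, both parametrized from left to right by $x\in[0,\pi]$, and the right end of ring $j-1$ touches the left end of ring $j$. Given $\alpha\in\mathbb R$ and a real sequence $(A_j)_{j\in\mathbb Z}$, let $H$ be the operator in $L^2(\Gamma)$ which acts on the component $\psi_j$ on the $j$-th upper semicircle as $-\mathscr D^2\psi_j$ with $\mathscr D=\frac{d}{dx}+iA_j$, and on the component $\varphi_j$ on the $j$-th lower semicircle as $-\mathscr D^2\varphi_j$ with $\mathscr D=\frac{d}{dx}-iA_j$. Its domain consists of all $(\psi,\varphi)\in L^2(\Gamma)$ that are $H^2$ on every semicircle, are mapped by this expression into $L^2(\Gamma)$, and satisfy for every $j\in\mathbb Z$ the $\delta$-coupling $$\psi_j(0)=\varphi_j(0)=\psi_{j-1}(\pi)=\varphi_{j-1}(\pi),\qquad \mathscr D\psi_j(0)+\mathscr D\varphi_j(0)-\mathscr D\psi_{j-1}(\pi)-\mathscr D\varphi_{j-1}(\pi)=\alpha\,\psi_j(0).$$ Let $\alpha,A,A_1,A_2\in\mathbb R$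 with $A-\frac12\notin\mathbb Z$. Write $-\Delta_{\alpha,A}$ for this operator when $A_j=A$ for all $j$, and $-\Delta_{A_1,A_2}$ for the operator with the values $A_1$ and $A_2$ on the rings $1$ and $2$ and the value $A$ on all other rings. Consider the condition $$\frac{(\cos A_1\pi)^2+(\cos A_2\pi)^2}{2(\cos A\pi)^2}>1.\qquad(*)$$ Theorem. If $(*)$ does not hold, then $\sigma(-\Delta_{A_1,A_2})=\sigma(-\Delta_{\alpha,A})$. If $(*)$ holds, then the essential spectrum of $-\Delta_{A_1,A_2}$ equals $\sigma(-\Delta_{\alpha,A})$, and $-\Delta_{A_1,A_2}$ has in every gap of its essential spectrum (every connected component, bounded or not, of the complement of the essential spectrum in $\mathbb R$) exactly one eigenvalue, and this eigenvalue is simple. -/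

import Mathlib

open MeasureTheory Set Filter Topology

noncomputable section

namespace MagneticChain

/-! ### The chain graph and its Hilbert space

The chain consists of rings indexed by `j : ℤ`, each of circumference `2 * π`, touching at vertices.
Ring `j` joins vertex `j` (its left end) to vertex `j + 1` (its right end) by two semicircles, the
upper one `(j, true)` and the lower one `(j, false)`. Both are identified with `[0, π]`, oriented
from left to right. -/

/-- The semicircles of the chain: `(j, true)` is the upper and `(j, false)` the lower half of the
`j`-th ring. -/
abbrev Edge : Type := ℤ × Bool

/-- Lebesgue measure on a semicircle, identified with the interval `(0, π)`. -/
abbrev edgeMeasure : Measure ℝ := volume.restrict (Ioo 0 Real.pi)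

/-- The Hilbert space `L²(Γ)` of the chain graph: the Hilbert sum over all semicircles of
`L²(0, π)`. -/
abbrev L2Chain : Type := lp (fun _ : Edge => Lp ℂ 2 edgeMeasure) 2

/-! ### The magnetic Laplacian with delta coupling -/

/-- `g` belongs to the Sobolev space `H²(0, π)`, with (continuous) derivative `g'` and second
derivative `g''`: the functions `g` and `g'` are absolutely continuous on `[0, π]`, being the
primitives of `g'` and `g''`, and `g''` is square integrable. -/
structure IsSobolev2 (g g' g'' : ℝ → ℂ) : Prop where
  memLp : MemLp g'' 2 edgeMeasure
  eq_integral' : ∀ x ∈ Icc 0 Real.pi, g' x = g' 0 + ∫ t in (0 : ℝ)..x, g'' t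
  eq_integral : ∀ x ∈ Icc 0 Real.pi, g x = g 0 + ∫ t in (0 : ℝ)..x, g' t

/-- The tangential component of the vector potential: the constant `-A j` on the upper and `A j` on
the lower half of the `j`-th ring. The flux through that ring is `2 * π * A j`. -/
def potential (A : ℤ → ℝ) (e : Edge) : ℝ := if e.2 then -A e.1 else A e.1

/-- The quasiderivative `𝒟 g = g' - i a g` for the potential value `a`. -/
def quasiDeriv (a : ℝ) (g g' : ℝ → ℂ) (x : ℝ) : ℂ := g' x - Complex.I * a * g x

/-- The differential expression `(-i d/dx - a)² g = -𝒟² g = -g'' + 2 i a g' + a² g`. -/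
def magneticExpr (a : ℝ) (g g' g'' : ℝ → ℂ) (x : ℝ) : ℂ :=
  -g'' x + 2 * Complex.I * a * g' x + (a : ℂ) ^ 2 * g x

/-- The delta coupling of strength `α` at the `j`-th vertex, where the right end `x = π` of ring
`j - 1` touches the left end `x = 0` of ring `j`: the function is continuous there, and the sum of
its outgoing quasiderivatives equals `α` times its value. -/
structure DeltaCoupling (α : ℝ) (A : ℤ → ℝ) (g g' : Edge → ℝ → ℂ) (j : ℤ) : Prop where
  lower_eq : g (j, false) 0 = g (j, true) 0
  prev_upper_eq : g (j - 1, true) Real.pi = g (j, true) 0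
  prev_lower_eq : g (j - 1, false) Real.pi = g (j, true) 0
  kirchhoff :
    quasiDeriv (potential A (j, true)) (g (j, true)) (g' (j, true)) 0
      + quasiDeriv (potential A (j, false)) (g (j, false)) (g' (j, false)) 0
      - quasiDeriv (potential A (j - 1, true)) (g (j - 1, true)) (g' (j - 1, true)) Real.pi
      - quasiDeriv (potential A (j - 1, false)) (g (j - 1, false)) (g' (j - 1, false)) Real.pi
      = α * g (j, true) 0

/-- `f = H u` for the magnetic chain Hamiltonian `H` with coupling constant `α` at every vertex and
vector potential of strength `A j` on the `j`-th ring: `u` has a representative which is `H²` on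
every semicircle and satisfies the delta coupling at every vertex, and `f` is given by the
differential expression. Both `u` and `f` are in `L²(Γ)`. -/
def IsImage (α : ℝ) (A : ℤ → ℝ) (u f : L2Chain) : Prop :=
  ∃ g g' g'' : Edge → ℝ → ℂ,
    (∀ e, IsSobolev2 (g e) (g' e) (g'' e)) ∧
    (∀ j, DeltaCoupling α A g g' j) ∧
    (∀ e, u e =ᵐ[edgeMeasure] g e) ∧
    (∀ e, f e =ᵐ[edgeMeasure] magneticExpr (potential A e) (g e) (g' e) (g'' e))

lemma IsSobolev2.intervalIntegrable {g g' g'' : ℝ → ℂ} (h : IsSobolev2 g g' g'') :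
    IntervalIntegrable g'' volume 0 Real.pi := by
  rw [intervalIntegrable_iff_integrableOn_Ioo_of_le Real.pi_pos.le]
  exact h.memLp.integrable (by norm_num)

lemma continuousOn_of_eq_integral {g k : ℝ → ℂ} (hk : IntervalIntegrable k volume 0 Real.pi)
    (h : ∀ x ∈ Icc 0 Real.pi, g x = g 0 + ∫ t in (0 : ℝ)..x, k t) :
    ContinuousOn g (Icc 0 Real.pi) := by
  have h1 := intervalIntegral.continuousOn_primitive_interval' hk left_mem_uIcc
  rw [uIcc_of_le Real.pi_pos.le] at h1
  exact (continuousOn_const.add h1).congr h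

lemma IsSobolev2.continuousOn' {g g' g'' : ℝ → ℂ} (h : IsSobolev2 g g' g'') :
    ContinuousOn g' (Icc 0 Real.pi) :=
  continuousOn_of_eq_integral h.intervalIntegrable h.eq_integral'

lemma IsSobolev2.intervalIntegrable' {g g' g'' : ℝ → ℂ} (h : IsSobolev2 g g' g'') :
    IntervalIntegrable g' volume 0 Real.pi := by
  refine ContinuousOn.intervalIntegrable ?_
  rw [uIcc_of_le Real.pi_pos.le]
  exact h.continuousOn'

lemma IsSobolev2.continuousOn {g g' g'' : ℝ → ℂ} (h : IsSobolev2 g g' g'') :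
    ContinuousOn g (Icc 0 Real.pi) :=
  continuousOn_of_eq_integral h.intervalIntegrable' h.eq_integral

lemma IsSobolev2.add {g g' g'' k k' k'' : ℝ → ℂ} (hg : IsSobolev2 g g' g'')
    (hk : IsSobolev2 k k' k'') : IsSobolev2 (g + k) (g' + k') (g'' + k'') := by
  have sub : ∀ x ∈ Icc 0 Real.pi, uIcc 0 x ⊆ uIcc 0 Real.pi := fun x hx => by
    rw [uIcc_of_le hx.1, uIcc_of_le Real.pi_pos.le]
    exact Icc_subset_Icc_right hx.2
  refine ⟨hg.memLp.add hk.memLp, fun x hx => ?_, fun x hx => ?_⟩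
  · simp only [Pi.add_apply]
    rw [intervalIntegral.integral_add (hg.intervalIntegrable.mono_set (sub x hx))
      (hk.intervalIntegrable.mono_set (sub x hx)), hg.eq_integral' x hx, hk.eq_integral' x hx]
    ring
  · simp only [Pi.add_apply]
    rw [intervalIntegral.integral_add (hg.intervalIntegrable'.mono_set (sub x hx))
      (hk.intervalIntegrable'.mono_set (sub x hx)), hg.eq_integral x hx, hk.eq_integral x hx]
    ring

lemma IsSobolev2.smul {g g' g'' : ℝ → ℂ} (c : ℂ) (hg : IsSobolev2 g g' g'') :
    IsSobolev2 (c • g) (c • g') (c • g'') := by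
  refine ⟨hg.memLp.const_smul c, fun x hx => ?_, fun x hx => ?_⟩
  · simp only [Pi.smul_apply, intervalIntegral.integral_smul]
    rw [hg.eq_integral' x hx, smul_add]
  · simp only [Pi.smul_apply, intervalIntegral.integral_smul]
    rw [hg.eq_integral x hx, smul_add]

lemma isSobolev2_zero : IsSobolev2 0 0 0 :=
  ⟨MemLp.zero, by simp, by simp⟩

/-- The graph of the magnetic chain Hamiltonian, as a subspace of `L²(Γ) × L²(Γ)`. -/
def hamiltonianGraph (α : ℝ) (A : ℤ → ℝ) : Submodule ℂ (L2Chain × L2Chain) where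
  carrier := {p | IsImage α A p.1 p.2}
  add_mem' := by
    rintro ⟨u, f⟩ ⟨v, k⟩ ⟨g, g', g'', hg, hd, hu, hf⟩ ⟨l, l', l'', hl, he, hv, hk⟩
    refine ⟨fun e => g e + l e, fun e => g' e + l' e, fun e => g'' e + l'' e,
      fun e => (hg e).add (hl e), fun j => ?_, fun e => ?_, fun e => ?_⟩
    · obtain ⟨a1, a2, a3, a4⟩ := hd j
      obtain ⟨b1, b2, b3, b4⟩ := he j
      refine ⟨?_, ?_, ?_, ?_⟩
      · simp only [Pi.add_apply, a1, b1]
      · simp only [Pi.add_apply, a2, b2]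
      · simp only [Pi.add_apply, a3, b3]
      · simp only [quasiDeriv, Pi.add_apply] at a4 b4 ⊢
        linear_combination a4 + b4
    · have h := Lp.coeFn_add (u e) (v e)
      filter_upwards [h, hu e, hv e] with x h1 h2 h3
      simpa [h2, h3] using h1
    · have h := Lp.coeFn_add (f e) (k e)
      filter_upwards [h, hf e, hk e] with x h1 h2 h3
      have h4 : ((f + k : L2Chain) e : ℝ → ℂ) x = _ := h1
      refine h4.trans ?_
      simp only [Pi.add_apply, h2, h3, magneticExpr]
      ring
  zero_mem' := by
    refine ⟨0, 0, 0, fun _ => isSobolev2_zero, fun j => ?_, fun e => ?_, fun e => ?_⟩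
    · exact ⟨by simp, by simp, by simp, by simp [quasiDeriv]⟩
    · exact Lp.coeFn_zero ℂ 2 edgeMeasure
    · filter_upwards [Lp.coeFn_zero ℂ 2 edgeMeasure] with x hx
      refine hx.trans ?_
      simp [magneticExpr]
  smul_mem' := by
    rintro c ⟨u, f⟩ ⟨g, g', g'', hg, hd, hu, hf⟩
    refine ⟨fun e => c • g e, fun e => c • g' e, fun e => c • g'' e,
      fun e => (hg e).smul c, fun j => ?_, fun e => ?_, fun e => ?_⟩
    · obtain ⟨a1, a2, a3, a4⟩ := hd j
      refine ⟨?_, ?_, ?_, ?_⟩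
      · simp only [Pi.smul_apply, a1]
      · simp only [Pi.smul_apply, a2]
      · simp only [Pi.smul_apply, a3]
      · simp only [quasiDeriv, Pi.smul_apply, smul_eq_mul] at a4 ⊢
        linear_combination c * a4
    · have h := Lp.coeFn_smul c (u e)
      filter_upwards [h, hu e] with x h1 h2
      have h4 : ((c • u : L2Chain) e : ℝ → ℂ) x = _ := h1
      refine h4.trans ?_
      simp only [Pi.smul_apply, h2]
    · have h := Lp.coeFn_smul c (f e)
      filter_upwards [h, hf e] with x h1 h2
      have h4 : ((c • f : L2Chain) e : ℝ → ℂ) x = _ := h1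
      refine h4.trans ?_
      simp only [Pi.smul_apply, h2, magneticExpr, smul_eq_mul]
      ring

lemma eqOn_zero_of_ae_eq_zero {k : ℝ → ℂ} (hk : ContinuousOn k (Icc 0 Real.pi))
    (h : k =ᵐ[edgeMeasure] 0) : ∀ x ∈ Icc 0 Real.pi, k x = 0 := by
  have h1 : k =ᵐ[volume.restrict (Icc 0 Real.pi)] fun _ => (0 : ℂ) := by
    rw [← Measure.restrict_congr_set (Ioo_ae_eq_Icc (a := (0 : ℝ)) (b := Real.pi))]
    exact h
  exact Measure.eqOn_Icc_of_ae_eq volume Real.pi_pos.ne h1 hk continuousOn_const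

lemma ae_eq_zero_of_primitive_eq_zero {k : ℝ → ℂ} (hk : IntervalIntegrable k volume 0 Real.pi)
    (h : ∀ x ∈ Icc 0 Real.pi, ∫ t in (0 : ℝ)..x, k t = 0) : k =ᵐ[edgeMeasure] 0 := by
  have h1 := hk.ae_hasDerivAt_integral
  refine (ae_restrict_iff' measurableSet_Ioo).2 ?_
  filter_upwards [h1] with x hx hxI
  have hx' : x ∈ uIcc 0 Real.pi := by
    rw [uIcc_of_le Real.pi_pos.le]
    exact Ioo_subset_Icc_self hxI
  have h2 := hx hx' 0 left_mem_uIcc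
  have h3 : (fun y => ∫ t in (0 : ℝ)..y, k t) =ᶠ[𝓝 x] fun _ => 0 := by
    filter_upwards [Ioo_mem_nhds hxI.1 hxI.2] with y hy
    exact h y (Ioo_subset_Icc_self hy)
  exact h2.unique ((hasDerivAt_const x (0 : ℂ)).congr_of_eventuallyEq h3)

/-- The graph is that of an operator: `H u` is determined by `u`. -/
lemma hamiltonianGraph_single_valued (α : ℝ) (A : ℤ → ℝ) :
    ∀ p ∈ hamiltonianGraph α A, p.1 = 0 → p.2 = 0 := by
  rintro ⟨u, f⟩ ⟨g, g', g'', hg, -, hu, hf⟩ (rfl : u = 0)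
  ext1
  funext e
  apply Lp.ext
  have h0 : g e =ᵐ[edgeMeasure] 0 := (hu e).symm.trans (Lp.coeFn_zero ℂ 2 edgeMeasure)
  have h1 := eqOn_zero_of_ae_eq_zero (hg e).continuousOn h0
  have z : (0 : ℝ) ∈ Icc 0 Real.pi := left_mem_Icc.2 Real.pi_pos.le
  have h2 : g' e =ᵐ[edgeMeasure] 0 := by
    refine ae_eq_zero_of_primitive_eq_zero (hg e).intervalIntegrable' fun x hx => ?_
    have := (hg e).eq_integral x hx
    rw [h1 x hx, h1 0 z, zero_add] at this
    exact this.symm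
  have h3 := eqOn_zero_of_ae_eq_zero (hg e).continuousOn' h2
  have h4 : g'' e =ᵐ[edgeMeasure] 0 := by
    refine ae_eq_zero_of_primitive_eq_zero (hg e).intervalIntegrable fun x hx => ?_
    have := (hg e).eq_integral' x hx
    rw [h3 x hx, h3 0 z, zero_add] at this
    exact this.symm
  refine (hf e).trans ?_
  refine EventuallyEq.trans ?_ (Lp.coeFn_zero ℂ 2 edgeMeasure).symm
  filter_upwards [h0, h2, h4] with x a b c
  simp [magneticExpr, a, b, c]

/-- The magnetic chain Hamiltonian, an unbounded operator in `L²(Γ)`: coupling constant `α` at every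
vertex, vector potential of strength `A j` on the `j`-th ring. -/
def hamiltonian (α : ℝ) (A : ℤ → ℝ) : L2Chain →ₗ.[ℂ] L2Chain :=
  (hamiltonianGraph α A).toLinearPMap

/-- The operator acts as described by `IsImage`. -/
lemma mem_graph_hamiltonian_iff (α : ℝ) (A : ℤ → ℝ) (u f : L2Chain) :
    (u, f) ∈ (hamiltonian α A).graph ↔ IsImage α A u f := by
  rw [hamiltonian, Submodule.toLinearPMap_graph_eq _ (hamiltonianGraph_single_valued α A)]
  rfl

/-- The sequence of potential strengths equal to `A₁` on ring `1`, to `A₂` on ring `2`, and to `A`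
on all other rings. -/
def perturbedField (A A₁ A₂ : ℝ) (j : ℤ) : ℝ := if j = 1 then A₁ else if j = 2 then A₂ else A

/-- The periodic Hamiltonian `-Δ_{α,A}`. -/
def periodicHamiltonian (α A : ℝ) : L2Chain →ₗ.[ℂ] L2Chain := hamiltonian α fun _ => A

/-- The perturbed Hamiltonian `-Δ_{A₁,A₂}`. -/
def perturbedHamiltonian (α A A₁ A₂ : ℝ) : L2Chain →ₗ.[ℂ] L2Chain :=
  hamiltonian α (perturbedField A A₁ A₂)

/-! ### Spectral notions for unbounded operators -/

section Spectral

variable {E : Type*} [NormedAddCommGroup E] [NormedSpace ℂ E]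

/-- The resolvent set of `T`: all `z` for which `T - z`, from the domain of `T` to the whole space,
has a bounded two-sided inverse `R`. -/
def resolventSet (T : E →ₗ.[ℂ] E) : Set ℂ :=
  {z | ∃ R : E →L[ℂ] E,
    (∀ f : E, ∃ h : R f ∈ T.domain, T ⟨R f, h⟩ - z • R f = f) ∧
    ∀ u : T.domain, R (T u - z • (u : E)) = u}

/-- The spectrum of `T`. -/
def spectrum (T : E →ₗ.[ℂ] E) : Set ℂ := (resolventSet T)ᶜ

/-- The eigenspace of `T` for `z`, the kernel of `T - z`. -/
def eigenspace (T : E →ₗ.[ℂ] E) (z : ℂ) : Submodule ℂ T.domain :=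
  LinearMap.ker (T.toFun - z • T.domain.subtype)

/-- `z` is an eigenvalue of `T`. -/
def IsEigenvalue (T : E →ₗ.[ℂ] E) (z : ℂ) : Prop := eigenspace T z ≠ ⊥

/-- `z` is a simple eigenvalue of `T`: its eigenspace is one-dimensional. -/
def IsSimpleEigenvalue (T : E →ₗ.[ℂ] E) (z : ℂ) : Prop := Module.finrank ℂ (eigenspace T z) = 1

/-- The discrete spectrum of a self-adjoint operator: the eigenvalues of finite multiplicity that are
isolated points of the spectrum. -/
def discreteSpectrum (T : E →ₗ.[ℂ] E) : Set ℂ :=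
  {z | IsEigenvalue T z ∧ FiniteDimensional ℂ (eigenspace T z) ∧ ∀ᶠ w in 𝓝[≠] z, w ∉ spectrum T}

/-- The essential spectrum of a self-adjoint operator: the complement of the discrete spectrum in the
spectrum. -/
def essentialSpectrum (T : E →ₗ.[ℂ] E) : Set ℂ := spectrum T \ discreteSpectrum T

end Spectral

/-- `G` is a (bounded or unbounded) gap of `S`, a set of real spectral values: a connected component
of the complement of `S` in the real line. -/
def IsGap (S : Set ℂ) (G : Set ℝ) : Prop :=
  ∃ x : ℝ, (x : ℂ) ∉ S ∧ G = connectedComponentIn {y : ℝ | (y : ℂ) ∉ S} x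

/-- The condition `((cos A₁π)² + (cos A₂π)²) / (2 (cos Aπ)²) > 1`. -/
def FluxCondition (A A₁ A₂ : ℝ) : Prop :=
  (Real.cos (A₁ * Real.pi) ^ 2 + Real.cos (A₂ * Real.pi) ^ 2) /
    (2 * Real.cos (A * Real.pi) ^ 2) > 1

end MagneticChain

end

noncomputable section

namespace MagneticChain

/-! ### Primitives on `[0, π]` -/

/-! On a semicircle the factor `gauge` removes the potential, so `(H - z) u = f` becomes `-h'' - z h
= F`. Unless `sinPi z = 0`, that is, unless `z` is a Dirichlet eigenvalue of the semicircle, a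
solution is fixed by its two end values, and Lagrange's identity gives the quasiderivatives at the
ends. Inserted into the delta coupling they leave a Jacobi equation for the vertex values, `a j * v
(j + 1) + a (j - 1) * v (j - 1) - discr α z * v j = load j`, with `a j = cos (A j π)`
(`IsSolution.recursion`, with converse `exists_isSolution`). Square integrability on the chain makes
`v` decay.

Write `discr α z = c (μ + μ⁻¹)` with `c = cos (A π)` and `|μ| ≤ 1`. If `|μ| = 1`, a decaying
solution vanishes wherever the coefficients are unperturbed; hence some load is unsolvable and `z`
is in the spectrum (`mem_spectrum_of_unimodular`). If `|μ| < 1`, the free Jacobi matrix minus `discr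
α z` is invertible and the perturbation has finite rank. By the Fredholm alternative `z` is then in
the resolvent set unless there is a decaying null vector. Such a vector is geometric on both sides
of vertex 2, the vertex between the two perturbed rings, and the equation there demands `μ² (s - c²)
= c²` with `s = cos² (A₁ π) + cos² (A₂ π)` (`kernel_determinant`, `exists_kernel`). With `|μ| < 1`
and `s ≥ 0` this is possible only for `s > 2 c²`, which is the flux condition. The null vector is
determined by its value at vertex 2, so the eigenvalue is simple. At Dirichlet eigenvalues there are
infinitely many independent loop states vanishing at all vertices (`exists_loop_state`).

The determinant equation fixes `discr² = m²` with `m² = s² / (s - c²)`, and under the flux condition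
`2 |c| < m < 2`. Gaps are the components of `{S ≠ 0, |discr| > 2 |c|}`, where `S` is `realSinPi`.
Between consecutive Dirichlet eigenvalues the real discriminant takes each value in `(-2, 2)`
(`exists_realDiscr_eq`) and takes no value in `[-2, 2]` twice (`realDiscr_injective`). So each gap
contains exactly one point with `discr² = m²` (`existsUnique_mem_gap`). Resolvents are constructed
explicitly and self-adjointness is never invoked. -/

/-- `F` is, on `[0, π]`, a primitive of the integrable function `k`. -/
structure IsPrimitive (F k : ℝ → ℂ) : Prop where
  intervalIntegrable : IntervalIntegrable k volume 0 Real.pi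
  eq_integral : ∀ x ∈ Icc 0 Real.pi, F x = F 0 + ∫ t in (0 : ℝ)..x, k t

lemma uIcc_zero_subset {x : ℝ} (hx : x ∈ Icc 0 Real.pi) : uIcc 0 x ⊆ uIcc 0 Real.pi := by
  rw [uIcc_of_le hx.1, uIcc_of_le Real.pi_pos.le]
  exact Icc_subset_Icc_right hx.2

namespace IsPrimitive

variable {F G k l φ φ' : ℝ → ℂ}

lemma intervalIntegrable_of_mem (h : IsPrimitive F k) {x : ℝ} (hx : x ∈ Icc 0 Real.pi) :
    IntervalIntegrable k volume 0 x :=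
  h.intervalIntegrable.mono_set (uIcc_zero_subset hx)

lemma continuousOn (h : IsPrimitive F k) : ContinuousOn F (Icc 0 Real.pi) :=
  continuousOn_of_eq_integral h.intervalIntegrable h.eq_integral

lemma of_hasDerivAt (h : ∀ x, HasDerivAt φ (φ' x) x) (hc : Continuous φ') :
    IsPrimitive φ φ' := by
  refine ⟨hc.intervalIntegrable _ _, fun x _ => ?_⟩
  rw [intervalIntegral.integral_eq_sub_of_hasDerivAt (fun y _ => h y) (hc.intervalIntegrable _ _)]
  ring

lemma add (h : IsPrimitive F k) (h' : IsPrimitive G l) :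
    IsPrimitive (fun x => F x + G x) (fun x => k x + l x) := by
  refine ⟨h.intervalIntegrable.add h'.intervalIntegrable, fun x hx => ?_⟩
  rw [intervalIntegral.integral_add (h.intervalIntegrable_of_mem hx)
    (h'.intervalIntegrable_of_mem hx), h.eq_integral x hx, h'.eq_integral x hx]
  ring

lemma congr_ae (h : IsPrimitive F k) (hl : k =ᵐ[edgeMeasure] l) : IsPrimitive F l := by
  have key : ∀ᵐ x, x ∈ Ioo 0 Real.pi → k x = l x := (ae_restrict_iff' measurableSet_Ioo).1 hl
  have key' : ∀ᵐ x, x ∈ Ioc 0 Real.pi → k x = l x := by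
    have h0 : ∀ᵐ x : ℝ, x ≠ Real.pi := by simp [ae_iff, measure_singleton]
    filter_upwards [key, h0] with x hx hx0 hx1
    exact hx ⟨hx1.1, lt_of_le_of_ne hx1.2 hx0⟩
  refine ⟨h.intervalIntegrable.congr_ae ?_, fun x hx => ?_⟩
  · rw [uIoc_of_le Real.pi_pos.le]
    exact (ae_restrict_iff' measurableSet_Ioc).2 key'
  · rw [h.eq_integral x hx]
    congr 1
    refine intervalIntegral.integral_congr_ae ?_
    filter_upwards [key'] with t ht ht1
    rw [uIoc_of_le hx.1] at ht1
    exact ht ⟨ht1.1, ht1.2.trans hx.2⟩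

/-- Splitting `k` into real and imaginary parts reduces this to real integrands. It opens the way to
the product rule: an absolutely continuous function with derivative zero almost everywhere is
constant. -/
lemma absolutelyContinuousOnInterval (h : IsPrimitive F k) :
    AbsolutelyContinuousOnInterval F 0 Real.pi := by
  have c : ∀ w : ℂ, AbsolutelyContinuousOnInterval (fun _ : ℝ => w) 0 Real.pi := fun w =>
    (contDiff_const.contDiffOn (n := 1)).absolutelyContinuousOnInterval
  have hre : IntervalIntegrable (fun x => (k x).re) volume 0 Real.pi :=
    ⟨h.intervalIntegrable.1.re, h.intervalIntegrable.2.re⟩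
  have him : IntervalIntegrable (fun x => (k x).im) volume 0 Real.pi :=
    ⟨h.intervalIntegrable.1.im, h.intervalIntegrable.2.im⟩
  have h1 := (hre.absolutelyContinuousOnInterval_intervalIntegral left_mem_uIcc).smul (c 1)
  have h2 := (him.absolutelyContinuousOnInterval_intervalIntegral left_mem_uIcc).smul (c Complex.I)
  have h3 := (c (F 0)).add (h1.add h2)
  have e : ∀ x ∈ uIcc 0 Real.pi, F x = ((fun _ : ℝ => F 0) +
      ((fun x => ∫ v in (0 : ℝ)..x, (k v).re) • (fun _ : ℝ => (1 : ℂ)) +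
      (fun x => ∫ v in (0 : ℝ)..x, (k v).im) • (fun _ : ℝ => Complex.I))) x := by
    intro x hx
    have hx' := hx
    rw [uIcc_of_le Real.pi_pos.le] at hx'
    rw [h.eq_integral x hx']
    simp only [Pi.add_apply, Pi.smul_apply', Complex.real_smul, mul_one]
    congr 1
    have i := h.intervalIntegrable_of_mem hx'
    rw [← intervalIntegral.integral_ofReal, ← intervalIntegral.integral_ofReal,
      ← intervalIntegral.integral_mul_const, ← intervalIntegral.integral_add]
    · simp only [Complex.re_add_im]
    · exact ⟨(hre.mono_set (uIcc_zero_subset hx')).1.ofReal,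
        (hre.mono_set (uIcc_zero_subset hx')).2.ofReal⟩
    · exact IntervalIntegrable.mul_const ⟨(him.mono_set (uIcc_zero_subset hx')).1.ofReal,
        (him.mono_set (uIcc_zero_subset hx')).2.ofReal⟩ _
  rw [absolutelyContinuousOnInterval_iff] at h3 ⊢
  intro ε hε
  obtain ⟨δ, hδ, H⟩ := h3 ε hε
  refine ⟨δ, hδ, fun E hE hl => ?_⟩
  refine lt_of_le_of_lt (le_of_eq ?_) (H E hE hl)
  refine Finset.sum_congr rfl fun i hi => ?_
  rw [← e _ (hE.1 i hi).1, ← e _ (hE.1 i hi).2]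

lemma ae_hasDerivAt (h : IsPrimitive F k) : ∀ᵐ x, x ∈ Ioo 0 Real.pi → HasDerivAt F (k x) x := by
  filter_upwards [h.intervalIntegrable.ae_hasDerivAt_integral] with x hx hxI
  have hx' : x ∈ uIcc 0 Real.pi := by
    rw [uIcc_of_le Real.pi_pos.le]
    exact Ioo_subset_Icc_self hxI
  have h2 := (hx hx' 0 left_mem_uIcc).const_add (F 0)
  refine h2.congr_of_eventuallyEq ?_
  filter_upwards [Ioo_mem_nhds hxI.1 hxI.2] with y hy
  exact h.eq_integral y (Ioo_subset_Icc_self hy)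

/-- The product of a `C¹` function and a primitive is a primitive. -/
lemma mul_left (h : IsPrimitive F k) (hφ : ∀ x, HasDerivAt φ (φ' x) x) (hc : Continuous φ') :
    IsPrimitive (fun x => φ x * F x) (fun x => φ' x * F x + φ x * k x) := by
  have hφc : Continuous φ := continuous_iff_continuousAt.2 fun x => (hφ x).continuousAt
  have hFc : ContinuousOn F (uIcc 0 Real.pi) := by
    rw [uIcc_of_le Real.pi_pos.le]; exact h.continuousOn
  have hi : IntervalIntegrable (fun x => φ' x * F x + φ x * k x) volume 0 Real.pi :=
    (hc.continuousOn.mul hFc).intervalIntegrable.add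
      (h.intervalIntegrable.continuousOn_mul hφc.continuousOn)
  have hG : IsPrimitive (fun x => ∫ t in (0 : ℝ)..x, (φ' t * F t + φ t * k t)) _ :=
    ⟨hi, fun x _ => by simp⟩
  have hφac := (of_hasDerivAt hφ hc).absolutelyContinuousOnInterval
  have hac := (hφac.smul h.absolutelyContinuousOnInterval).sub hG.absolutelyContinuousOnInterval
  -- The product minus the integral of its formal derivative is absolutely continuous with
  -- derivative zero almost everywhere.
  obtain ⟨K, hK⟩ := hac.const_of_ae_hasDerivAt_zero (by
    have h0 : ∀ᵐ x : ℝ, x ≠ 0 := by simp [ae_iff, measure_singleton]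
    have h1 : ∀ᵐ x : ℝ, x ≠ Real.pi := by simp [ae_iff, measure_singleton]
    filter_upwards [h.ae_hasDerivAt, hG.ae_hasDerivAt, h0, h1] with x hx hx' hx0 hx1 hxI
    rw [uIcc_of_le Real.pi_pos.le] at hxI
    have hxI' : x ∈ Ioo 0 Real.pi :=
      ⟨lt_of_le_of_ne hxI.1 (Ne.symm hx0), lt_of_le_of_ne hxI.2 hx1⟩
    have := ((hφ x).smul (hx hxI')).sub (hx' hxI')
    refine this.congr_deriv ?_
    simp only [smul_eq_mul]
    ring)
  refine ⟨hi, fun x hx => ?_⟩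
  have a0 := hK 0 left_mem_uIcc
  have ax := hK x (by rwa [uIcc_of_le Real.pi_pos.le])
  simp only [Pi.sub_apply, Pi.mul_apply, smul_eq_mul, intervalIntegral.integral_same] at a0 ax
  linear_combination ax - a0

lemma const_mul (h : IsPrimitive F k) (w : ℂ) :
    IsPrimitive (fun x => w * F x) (fun x => w * k x) := by
  refine ⟨h.intervalIntegrable.const_mul w, fun x hx => ?_⟩
  rw [intervalIntegral.integral_const_mul, h.eq_integral x hx]
  ring

end IsPrimitive

lemma IsSobolev2.isPrimitive' {g g' g'' : ℝ → ℂ} (h : IsSobolev2 g g' g'') : IsPrimitive g' g'' :=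
  ⟨h.intervalIntegrable, h.eq_integral'⟩

lemma IsSobolev2.isPrimitive {g g' g'' : ℝ → ℂ} (h : IsSobolev2 g g' g'') : IsPrimitive g g' :=
  ⟨h.intervalIntegrable', h.eq_integral⟩

/-! ### Lagrange's identity -/

/-- The gauge factor `exp (-i a t)`. -/
def gauge (a : ℝ) (t : ℝ) : ℂ := Complex.exp (-(Complex.I * a * t))

lemma hasDerivAt_gauge (a t : ℝ) : HasDerivAt (gauge a) (-(Complex.I * a) * gauge a t) t := by
  have h1 : HasDerivAt (fun t : ℝ => -(Complex.I * a * t)) (-(Complex.I * a)) t := by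
    have := ((Complex.ofRealCLM.hasDerivAt (x := t)).const_mul (Complex.I * a)).neg
    simpa [Function.comp_def, Pi.neg_def] using this
  have := h1.cexp
  refine this.congr_deriv ?_
  rw [gauge]; ring

lemma continuous_gauge (a : ℝ) : Continuous (gauge a) :=
  continuous_iff_continuousAt.2 fun x => (hasDerivAt_gauge a x).continuousAt

@[simp] lemma gauge_zero_right (a : ℝ) : gauge a 0 = 1 := by simp [gauge]

lemma norm_gauge (a t : ℝ) : ‖gauge a t‖ = 1 := by
  rw [gauge, show -(Complex.I * a * t) = ((-(a * t) : ℝ) : ℂ) * Complex.I by push_cast; ring,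
    Complex.norm_exp_ofReal_mul_I]

lemma gauge_ne_zero (a t : ℝ) : gauge a t ≠ 0 := Complex.exp_ne_zero _

lemma gauge_mul_gauge_neg (a t : ℝ) : gauge a t * gauge (-a) t = 1 := by
  rw [gauge, gauge, ← Complex.exp_add]
  simp

/-- Lagrange's identity for the magnetic expression and a `C²` test function. -/
lemma IsSobolev2.isPrimitive_wronskian {g g' g'' φ φ' φ'' : ℝ → ℂ} (h : IsSobolev2 g g' g'')
    (a : ℝ) (hφ : ∀ x, HasDerivAt φ (φ' x) x) (hφ' : ∀ x, HasDerivAt φ' (φ'' x) x)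
    (hc : Continuous φ'') :
    IsPrimitive (fun x => gauge a x * (g x * φ' x - quasiDeriv a g g' x * φ x))
      (fun x => magneticExpr a g g' g'' x * (gauge a x * φ x) + g x * (gauge a x * φ'' x)) := by
  have cφ : Continuous φ := continuous_iff_continuousAt.2 fun x => (hφ x).continuousAt
  have cφ' : Continuous φ' := continuous_iff_continuousAt.2 fun x => (hφ' x).continuousAt
  have cg := continuous_gauge a
  -- The Wronskian is regrouped by powers of `g`: a smooth factor times `g'` plus a smooth factor
  -- times `g`, so only the product rule with one smooth factor is needed.
  have h1 := h.isPrimitive'.mul_left (φ := fun x => -(gauge a x * φ x))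
    (fun x => ((hasDerivAt_gauge a x).mul (hφ x)).neg) (by fun_prop)
  have h2 := h.isPrimitive.mul_left
    (φ := fun x => gauge a x * (φ' x + Complex.I * a * φ x))
    (fun x => (hasDerivAt_gauge a x).mul ((hφ' x).add ((hφ x).const_mul _))) (by fun_prop)
  convert h1.add h2 using 2 with x x
  · simp only [quasiDeriv]; ring
  · simp only [magneticExpr]
    linear_combination ((a : ℂ) ^ 2 * gauge a x * φ x * g x) * Complex.I_sq

/-! ### The fundamental solutions of `-φ'' = z φ` -/

/-- The entire function `sin k / k`. -/
def csinc : ℂ → ℂ := dslope Complex.sin 0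

@[simp] lemma csinc_zero : csinc 0 = 1 := by simp [csinc, dslope_same]

lemma mul_csinc (k : ℂ) : k * csinc k = Complex.sin k := by
  have := sub_smul_dslope Complex.sin 0 k
  simpa [csinc] using this

lemma csinc_of_ne {k : ℂ} (hk : k ≠ 0) : csinc k = Complex.sin k / k := by
  rw [eq_div_iff hk, mul_comm, mul_csinc]

lemma csinc_neg (k : ℂ) : csinc (-k) = csinc k := by
  rcases eq_or_ne k 0 with rfl | hk
  · simp
  · rw [csinc_of_ne hk, csinc_of_ne (neg_ne_zero.2 hk), Complex.sin_neg, neg_div_neg_eq]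

lemma differentiable_csinc : Differentiable ℂ csinc := by
  rw [← differentiableOn_univ]
  exact (Complex.differentiableOn_dslope univ_mem).2 Complex.differentiable_sin.differentiableOn

/-- A square root of `z`. -/
def csqrt (z : ℂ) : ℂ := z ^ ((2 : ℂ)⁻¹)

lemma csqrt_sq (z : ℂ) : csqrt z ^ 2 = z := by
  have := Complex.cpow_nat_inv_pow z (n := 2) two_ne_zero
  exact_mod_cast this

/-- An even function does not see the choice of the square root, so the principal branch may be
exchanged for whichever root is convenient. -/
lemma eval_csqrt_of_sq {E : ℂ → ℂ} (he : ∀ k, E (-k) = E k) {k z : ℂ} (h : k ^ 2 = z) :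
    E (csqrt z) = E k := by
  have h1 : csqrt z ^ 2 = k ^ 2 := by rw [csqrt_sq, h]
  rcases sq_eq_sq_iff_eq_or_eq_neg.1 h1 with h2 | h2
  · rw [h2]
  · rw [h2, he]

/-- An even entire function of the square root is entire. -/
lemma differentiable_comp_csqrt {E : ℂ → ℂ} (hE : Differentiable ℂ E) (he : ∀ k, E (-k) = E k) :
    Differentiable ℂ fun z => E (csqrt z) := by
  -- The origin is a removable singularity: differentiability off it and continuity at it suffice.
  rw [← differentiableOn_univ,
    ← Complex.differentiableOn_compl_singleton_and_continuousAt_iff (c := 0) univ_mem]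
  constructor
  · rintro z ⟨-, hz⟩
    have hz : z ≠ 0 := hz
    refine DifferentiableAt.differentiableWithinAt ?_
    by_cases hs : z ∈ Complex.slitPlane
    · exact (hE _).comp z (DifferentiableAt.cpow_const differentiableAt_id hs)
    · have hs' : -z ∈ Complex.slitPlane := by
        rw [Complex.mem_slitPlane_iff] at hs ⊢
        push Not at hs
        left
        have : z.re ≠ 0 := fun h => hz (Complex.ext h hs.2)
        simpa using lt_of_le_of_ne hs.1 this
      -- On the branch cut, `I * csqrt (-z)` is a square root of `z` which is analytic there.
      have e : (fun z => E (csqrt z)) = fun z => E (Complex.I * csqrt (-z)) := by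
        funext w
        refine eval_csqrt_of_sq he ?_
        rw [mul_pow, csqrt_sq, Complex.I_sq]; ring
      rw [e]
      have h1 : DifferentiableAt ℂ (fun z => csqrt (-z)) z :=
        DifferentiableAt.cpow_const differentiableAt_id.neg hs'
      exact (hE _).comp z (h1.const_mul Complex.I)
  · have h0 : csqrt 0 = 0 := by simp [csqrt]
    refine ContinuousAt.comp (g := E) hE.continuous.continuousAt ?_
    rw [ContinuousAt, h0, tendsto_zero_iff_norm_tendsto_zero]
    have e : (fun z => ‖csqrt z‖) = fun z => Real.sqrt ‖z‖ := by
      funext z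
      rw [eq_comm, Real.sqrt_eq_iff_mul_self_eq (norm_nonneg _) (norm_nonneg _), ← norm_mul, ← sq,
        csqrt_sq]
    rw [e]
    have := (Real.continuous_sqrt.comp (continuous_norm (E := ℂ))).tendsto 0
    simpa [Function.comp_def] using this

/-- The solution of `-φ'' = z φ` with `φ 0 = 1` and `φ' 0 = 0`. -/
def cosSol (z : ℂ) (x : ℝ) : ℂ := Complex.cos (csqrt z * x)

/-- The solution of `-φ'' = z φ` with `φ 0 = 0` and `φ' 0 = 1`. -/
def sinSol (z : ℂ) (x : ℝ) : ℂ := x * csinc (csqrt z * x)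

lemma csqrt_mul_sinSol (z : ℂ) (x : ℝ) : csqrt z * sinSol z x = Complex.sin (csqrt z * x) := by
  rw [← mul_csinc, sinSol]; ring

@[simp] lemma cosSol_zero_right (z : ℂ) : cosSol z 0 = 1 := by simp [cosSol]

@[simp] lemma sinSol_zero_right (z : ℂ) : sinSol z 0 = 0 := by simp [sinSol]

lemma hasDerivAt_const_mul_ofReal (k : ℂ) (x : ℝ) : HasDerivAt (fun t : ℝ => k * (t : ℂ)) k x := by
  simpa using (Complex.ofRealCLM.hasDerivAt (x := x)).const_mul k

lemma hasDerivAt_cosSol (z : ℂ) (x : ℝ) : HasDerivAt (cosSol z) (-z * sinSol z x) x := by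
  have := (Complex.hasDerivAt_cos _).comp x (hasDerivAt_const_mul_ofReal (csqrt z) x)
  refine this.congr_deriv ?_
  rw [← csqrt_mul_sinSol]
  linear_combination -sinSol z x * csqrt_sq z

lemma hasDerivAt_sinSol (z : ℂ) (x : ℝ) : HasDerivAt (sinSol z) (cosSol z x) x := by
  rcases eq_or_ne (csqrt z) 0 with h | h
  · have e : sinSol z = fun t : ℝ => 1 * (t : ℂ) := by
      funext t; simp [sinSol, h]
    rw [e, cosSol, h]
    simpa using hasDerivAt_const_mul_ofReal 1 x
  · have e : sinSol z = fun t : ℝ => Complex.sin (csqrt z * t) / csqrt z := by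
      funext t; rw [eq_div_iff h, mul_comm, csqrt_mul_sinSol]
    rw [e]
    have := ((Complex.hasDerivAt_sin _).comp x (hasDerivAt_const_mul_ofReal (csqrt z) x)).div_const
      (csqrt z)
    refine this.congr_deriv ?_
    rw [cosSol]; field_simp

lemma cosSol_sq_add (z : ℂ) (x : ℝ) : cosSol z x ^ 2 + z * sinSol z x ^ 2 = 1 := by
  have := Complex.sin_sq_add_cos_sq (csqrt z * x)
  rw [← csqrt_mul_sinSol] at this
  rw [cosSol]
  linear_combination this - sinSol z x ^ 2 * csqrt_sq z

lemma continuous_cosSol (z : ℂ) : Continuous (cosSol z) :=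
  continuous_iff_continuousAt.2 fun x => (hasDerivAt_cosSol z x).continuousAt

lemma continuous_sinSol (z : ℂ) : Continuous (sinSol z) :=
  continuous_iff_continuousAt.2 fun x => (hasDerivAt_sinSol z x).continuousAt

/-- The value `cos (π √z)` at `π` of the first solution. -/
def cosPi (z : ℂ) : ℂ := cosSol z Real.pi

/-- The value `sin (π √z) / √z` at `π` of the second solution. Its zeros are the Dirichlet
eigenvalues of a semicircle. -/
def sinPi (z : ℂ) : ℂ := sinSol z Real.pi

/-- The discriminant `2 cos (π √z) + α sin (π √z) / (2 √z)`. -/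
def discr (α : ℝ) (z : ℂ) : ℂ := 2 * cosPi z + α / 2 * sinPi z

lemma cosPi_sq_add (z : ℂ) : cosPi z ^ 2 + z * sinPi z ^ 2 = 1 := cosSol_sq_add z _

lemma differentiable_cosPi : Differentiable ℂ cosPi :=
  differentiable_comp_csqrt (E := fun k => Complex.cos (k * Real.pi)) (by fun_prop)
    fun k => by simp [Complex.cos_neg]

lemma differentiable_sinPi : Differentiable ℂ sinPi :=
  differentiable_comp_csqrt (E := fun k => Real.pi * csinc (k * Real.pi))
    ((differentiable_csinc.comp (by fun_prop : Differentiable ℂ fun k : ℂ => k * Real.pi)).const_mul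
      _) fun k => by simp [csinc_neg]

lemma differentiable_discr (α : ℝ) : Differentiable ℂ (discr α) :=
  (differentiable_cosPi.const_mul 2).add (differentiable_sinPi.const_mul _)

lemma cosPi_sq (k : ℂ) : cosPi (k ^ 2) = Complex.cos (k * Real.pi) :=
  eval_csqrt_of_sq (E := fun k => Complex.cos (k * Real.pi)) (fun k => by simp [Complex.cos_neg])
    rfl

lemma mul_sinPi_sq (k : ℂ) : k * sinPi (k ^ 2) = Complex.sin (k * Real.pi) := by
  have : sinPi (k ^ 2) = Real.pi * csinc (k * Real.pi) :=
    eval_csqrt_of_sq (E := fun k => Real.pi * csinc (k * Real.pi))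
      (fun k => by simp [csinc_neg]) rfl
  rw [this, ← mul_csinc]; ring

lemma sinPi_zero : sinPi 0 = Real.pi := by
  have : csqrt 0 = 0 := by simp [csqrt]
  simp [sinPi, sinSol, this]

/-! ### Integrals over a semicircle -/

instance : IsFiniteMeasure edgeMeasure := ⟨by simp [Real.volume_Ioo]⟩

lemma integral_norm_le (F : Lp ℂ 2 edgeMeasure) :
    ∫ t in Ioo 0 Real.pi, ‖F t‖ ≤ Real.sqrt Real.pi * ‖F‖ := by
  have h1 := eLpNorm_le_eLpNorm_mul_rpow_measure_univ (μ := edgeMeasure) (p := 1) (q := 2)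
    (by norm_num) (Lp.aestronglyMeasurable F)
  have hF := Lp.memLp F
  have hF1 : MemLp F 1 edgeMeasure := hF.mono_exponent (by norm_num)
  rw [integral_norm_eq_lintegral_enorm (Lp.aestronglyMeasurable F),
    ← eLpNorm_one_eq_lintegral_enorm,
    Lp.norm_def, mul_comm, Real.sqrt_eq_rpow]
  have h2 := ENNReal.toReal_mono (ENNReal.mul_ne_top hF.2.ne (by
    refine ENNReal.rpow_ne_top_of_nonneg ?_ (measure_ne_top _ _)
    norm_num)) h1
  rw [ENNReal.toReal_mul, ← ENNReal.toReal_rpow] at h2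
  convert h2 using 3
  · simp [Real.pi_pos.le]
  · norm_num

lemma intervalIntegrable_lp (F : Lp ℂ 2 edgeMeasure) : IntervalIntegrable F volume 0 Real.pi := by
  rw [intervalIntegrable_iff_integrableOn_Ioo_of_le Real.pi_pos.le]
  exact (Lp.memLp F).integrable (by norm_num)

lemma norm_integral_mul_le (F : Lp ℂ 2 edgeMeasure) {ψ : ℝ → ℂ} {M : ℝ}
    (hM : ∀ t ∈ Icc 0 Real.pi, ‖ψ t‖ ≤ M) {x : ℝ} (hx : x ∈ Icc 0 Real.pi) :
    ‖∫ t in (0 : ℝ)..x, F t * ψ t‖ ≤ M * Real.sqrt Real.pi * ‖F‖ := by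
  have hM0 : 0 ≤ M := (norm_nonneg _).trans (hM 0 (left_mem_Icc.2 Real.pi_pos.le))
  have hi : IntegrableOn (fun t => ‖F t‖ * M) (Ioc 0 Real.pi) :=
    ((intervalIntegrable_iff_integrableOn_Ioc_of_le Real.pi_pos.le).1
      (intervalIntegrable_lp F)).norm.mul_const M
  have hs : Ioc 0 x ⊆ Ioc 0 Real.pi := Ioc_subset_Ioc_right hx.2
  rw [intervalIntegral.integral_of_le hx.1]
  calc ‖∫ t in Ioc 0 x, F t * ψ t‖ ≤ ∫ t in Ioc 0 x, ‖F t‖ * M := by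
        refine norm_integral_le_of_norm_le (hi.mono_set hs) ?_
        refine (ae_restrict_iff' measurableSet_Ioc).2 (Eventually.of_forall fun t ht => ?_)
        rw [norm_mul]
        exact mul_le_mul_of_nonneg_left (hM t ⟨ht.1.le, ht.2.trans hx.2⟩) (norm_nonneg _)
    _ ≤ ∫ t in Ioc 0 Real.pi, ‖F t‖ * M :=
        setIntegral_mono_set hi (Eventually.of_forall fun t => by positivity) hs.eventuallyLE
    _ = (∫ t in Ioo 0 Real.pi, ‖F t‖) * M := by
        rw [integral_Ioc_eq_integral_Ioo, integral_mul_const]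
    _ ≤ (Real.sqrt Real.pi * ‖F‖) * M := mul_le_mul_of_nonneg_right (integral_norm_le F) hM0
    _ = M * Real.sqrt Real.pi * ‖F‖ := by ring

lemma exists_bound_Icc {ψ : ℝ → ℂ} (h : Continuous ψ) :
    ∃ M : ℝ, 0 ≤ M ∧ ∀ t ∈ Icc 0 Real.pi, ‖ψ t‖ ≤ M := by
  obtain ⟨M, hM⟩ := isCompact_Icc.exists_bound_of_continuousOn (h.continuousOn (s := Icc 0 Real.pi))
  exact ⟨M, (norm_nonneg _).trans (hM 0 (left_mem_Icc.2 Real.pi_pos.le)), hM⟩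

/-! ### Solutions of `(H - z) u = f` -/

/-- The family `g`, with derivatives `g'` and `g''`, is in the domain of the chain Hamiltonian up to
integrability, and `(H - z) g = f` on every semicircle. -/
structure IsSolution (α : ℝ) (A : ℤ → ℝ) (z : ℂ) (f : L2Chain) (g g' g'' : Edge → ℝ → ℂ) :
    Prop where
  sobolev : ∀ e, IsSobolev2 (g e) (g' e) (g'' e)
  coupling : ∀ j, DeltaCoupling α A g g' j
  eq : ∀ e, f e =ᵐ[edgeMeasure]
    fun x => magneticExpr (potential A e) (g e) (g' e) (g'' e) x - z * g e x

lemma isImage_add_smul_iff {α : ℝ} {A : ℤ → ℝ} {z : ℂ} {u f : L2Chain} :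
    IsImage α A u (f + z • u) ↔
      ∃ g g' g'', IsSolution α A z f g g' g'' ∧ ∀ e, u e =ᵐ[edgeMeasure] g e := by
  have hcoe : ∀ e, ((f + z • u : L2Chain) e : ℝ → ℂ) =ᵐ[edgeMeasure]
      fun x => f e x + z * u e x := by
    intro e
    have h1 := Lp.coeFn_add (f e) (z • u e)
    filter_upwards [h1, Lp.coeFn_smul z (u e)] with x hx hx'
    refine Eq.trans hx ?_
    simp only [Pi.add_apply, hx', Pi.smul_apply, smul_eq_mul]
  constructor
  · rintro ⟨g, g', g'', hs, hd, hu, hf⟩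
    refine ⟨g, g', g'', ⟨hs, hd, fun e => ?_⟩, hu⟩
    filter_upwards [hcoe e, hu e, hf e] with x h1 h2 h3
    rw [← h3, h1, h2]; ring
  · rintro ⟨g, g', g'', ⟨hs, hd, he⟩, hu⟩
    refine ⟨g, g', g'', hs, hd, hu, fun e => ?_⟩
    filter_upwards [hcoe e, hu e, he e] with x h1 h2 h3
    rw [h1, h2, h3]; ring

/-- The pairing of `F` with the solution of the adjoint equation vanishing at the right end. -/
def startLoad (a : ℝ) (z : ℂ) (F : ℝ → ℂ) : ℂ :=
  ∫ t in (0 : ℝ)..Real.pi, F t * (gauge a t * sinSol z (Real.pi - t))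

/-- The pairing of `F` with the solution of the adjoint equation vanishing at the left end. -/
def endLoad (a : ℝ) (z : ℂ) (F : ℝ → ℂ) : ℂ :=
  ∫ t in (0 : ℝ)..Real.pi, F t * (gauge a t * sinSol z t)

/-! ### Boundary data of solutions on one semicircle -/

section Edge

variable {g g' g'' F φ φ' : ℝ → ℂ} {a : ℝ} {z : ℂ}

/-- In Lagrange's identity the terms with `z` cancel because `φ` solves `-φ'' = z φ`; only boundary
terms remain. -/
lemma IsSobolev2.integral_mul_solution (h : IsSobolev2 g g' g'')
    (hF : F =ᵐ[edgeMeasure] fun x => magneticExpr a g g' g'' x - z * g x)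
    (hφ : ∀ x, HasDerivAt φ (φ' x) x) (hφ' : ∀ x, HasDerivAt φ' (-z * φ x) x) {x : ℝ}
    (hx : x ∈ Icc 0 Real.pi) :
    ∫ t in (0 : ℝ)..x, F t * (gauge a t * φ t) =
      gauge a x * (g x * φ' x - quasiDeriv a g g' x * φ x) -
        (g 0 * φ' 0 - quasiDeriv a g g' 0 * φ 0) := by
  have cφ : Continuous φ := continuous_iff_continuousAt.2 fun x => (hφ x).continuousAt
  have h1 := h.isPrimitive_wronskian a hφ hφ' (by fun_prop)
  have h2 : (fun x => magneticExpr a g g' g'' x * (gauge a x * φ x) +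
      g x * (gauge a x * (-z * φ x))) =ᵐ[edgeMeasure] fun t => F t * (gauge a t * φ t) := by
    filter_upwards [hF] with t ht
    rw [ht]; ring
  have h3 := (h1.congr_ae h2).eq_integral x hx
  simp only [gauge_zero_right, one_mul] at h3
  rw [h3]; ring

lemma IsSobolev2.eq_representation (h : IsSobolev2 g g' g'')
    (hF : F =ᵐ[edgeMeasure] fun x => magneticExpr a g g' g'' x - z * g x) {x : ℝ}
    (hx : x ∈ Icc 0 Real.pi) :
    gauge a x * g x = g 0 * cosSol z x + quasiDeriv a g g' 0 * sinSol z x -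
      ∫ t in (0 : ℝ)..x, F t * (gauge a t * sinSol z (x - t)) := by
  -- Variation of constants: this test function vanishes at `t = x` with slope `-1`, so the boundary
  -- term at `x` is just `-gauge a x * g x`.
  have h1 : ∀ t, HasDerivAt (fun t => sinSol z (x - t)) (-cosSol z (x - t)) t := fun t => by
    simpa using! (hasDerivAt_sinSol z (x - t)).comp_const_sub x t
  have h2 : ∀ t, HasDerivAt (fun t => -cosSol z (x - t)) (-z * sinSol z (x - t)) t := fun t => by
    simpa using! ((hasDerivAt_cosSol z (x - t)).comp_const_sub x t).neg
  have := h.integral_mul_solution hF h1 h2 hx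
  rw [this]
  simp
  ring

/-- This is the representation at `x = π`, read as an equation for the initial slope. The factor
`sinPi z` is not divided out, so the identity holds at Dirichlet eigenvalues as well. -/
lemma IsSobolev2.quasiDeriv_start (h : IsSobolev2 g g' g'')
    (hF : F =ᵐ[edgeMeasure] fun x => magneticExpr a g g' g'' x - z * g x) :
    quasiDeriv a g g' 0 * sinPi z =
      gauge a Real.pi * g Real.pi - cosPi z * g 0 + startLoad a z F := by
  have := h.eq_representation hF (right_mem_Icc.2 Real.pi_pos.le)
  rw [startLoad, sinPi, cosPi]
  linear_combination -this

/-- The test function `sinSol z` vanishes at `0`, which eliminates the quasiderivative at the left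
end. -/
lemma IsSobolev2.quasiDeriv_end (h : IsSobolev2 g g' g'')
    (hF : F =ᵐ[edgeMeasure] fun x => magneticExpr a g g' g'' x - z * g x) :
    quasiDeriv a g g' Real.pi * sinPi z =
      cosPi z * g Real.pi - gauge (-a) Real.pi * (g 0 + endLoad a z F) := by
  have := h.integral_mul_solution hF (hasDerivAt_sinSol z) (hasDerivAt_cosSol z)
    (right_mem_Icc.2 Real.pi_pos.le)
  rw [endLoad, this, sinPi, cosPi]
  simp
  linear_combination (cosSol z Real.pi * g Real.pi - quasiDeriv a g g' Real.pi * sinSol z Real.pi) *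
    (gauge_mul_gauge_neg a Real.pi)

end Edge

/-- The inhomogeneity which `f` contributes to the equation at vertex `j`. -/
def vertexLoad (A : ℤ → ℝ) (z : ℂ) (f : L2Chain) (j : ℤ) : ℂ :=
  -(startLoad (potential A (j, true)) z (f (j, true)) +
    startLoad (potential A (j, false)) z (f (j, false)) +
    gauge (-potential A (j - 1, true)) Real.pi *
      endLoad (potential A (j - 1, true)) z (f (j - 1, true)) +
    gauge (-potential A (j - 1, false)) Real.pi *
      endLoad (potential A (j - 1, false)) z (f (j - 1, false))) / 2

/-- The coefficient `cos (A j π)` of the Jacobi matrix. -/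
def coeff (A : ℤ → ℝ) (j : ℤ) : ℂ := (Real.cos (A j * Real.pi) : ℝ)

/-- The halves of a ring carry opposite potentials, so their phases add up to a cosine. This is the
only way in which the flux enters the Jacobi equation. -/
lemma gauge_add_gauge_neg (a : ℝ) : gauge a Real.pi + gauge (-a) Real.pi =
    2 * (Real.cos (a * Real.pi) : ℝ) := by
  rw [gauge, gauge, Complex.ofReal_cos, Complex.cos]
  push_cast
  rw [show -(Complex.I * -(a : ℂ) * Real.pi) = a * Real.pi * Complex.I by ring,
    show -(Complex.I * (a : ℂ) * Real.pi) = -(a * Real.pi) * Complex.I by ring]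
  ring

lemma gauge_upper_add_lower (A : ℤ → ℝ) (j : ℤ) : gauge (potential A (j, true)) Real.pi +
    gauge (potential A (j, false)) Real.pi = 2 * coeff A j := by
  have := gauge_add_gauge_neg (A j)
  simp only [potential, coeff] at *
  simp only [if_true, Bool.false_eq_true, if_false]
  linear_combination this

lemma gauge_neg_upper_add_lower (A : ℤ → ℝ) (j : ℤ) : gauge (-potential A (j, true)) Real.pi +
    gauge (-potential A (j, false)) Real.pi = 2 * coeff A j := by
  have := gauge_add_gauge_neg (A j)
  simp only [potential, coeff] at *
  simp only [if_true, Bool.false_eq_true, if_false, neg_neg]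
  linear_combination this

section Solution

variable {α : ℝ} {A : ℤ → ℝ} {z : ℂ} {f : L2Chain} {g g' g'' : Edge → ℝ → ℂ}

lemma IsSolution.start_eq (h : IsSolution α A z f g g' g'') (j : ℤ) (b : Bool) :
    g (j, b) 0 = g (j, true) 0 := by
  cases b
  · exact (h.coupling j).lower_eq
  · rfl

lemma IsSolution.end_eq (h : IsSolution α A z f g g' g'') (j : ℤ) (b : Bool) :
    g (j, b) Real.pi = g (j + 1, true) 0 := by
  have := h.coupling (j + 1)
  cases b
  · simpa using this.prev_lower_eq
  · simpa using this.prev_upper_eq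

/-- The vertex values of a solution solve the Jacobi equation. -/
lemma IsSolution.recursion (h : IsSolution α A z f g g' g'') (j : ℤ) :
    coeff A j * g (j + 1, true) 0 + coeff A (j - 1) * g (j - 1, true) 0 -
      discr α z * g (j, true) 0 = vertexLoad A z f j := by
  have k := (h.coupling j).kirchhoff
  have s1 := (h.sobolev (j, true)).quasiDeriv_start (h.eq _)
  have s2 := (h.sobolev (j, false)).quasiDeriv_start (h.eq _)
  have s3 := (h.sobolev (j - 1, true)).quasiDeriv_end (h.eq _)
  have s4 := (h.sobolev (j - 1, false)).quasiDeriv_end (h.eq _)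
  rw [h.end_eq] at s1 s2 s3 s4
  rw [h.start_eq j false] at s2
  rw [h.start_eq (j - 1) false] at s4
  rw [sub_add_cancel] at s3 s4
  have g1 := gauge_upper_add_lower A j
  have g2 := gauge_neg_upper_add_lower A (j - 1)
  rw [vertexLoad, discr]
  -- Kirchhoff's condition times `sinPi z`, with all four quasiderivatives eliminated. The factor `1
  -- / 2` accounts for the two semicircles of each ring.
  linear_combination (1 / 2) * (sinPi z * k - s1 - s2 + s3 + s4 - g (j + 1, true) 0 * g1 -
    g (j - 1, true) 0 * g2)

end Solution

/-! ### Decay of the vertex values -/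

/-- A trace estimate: Lagrange's identity is applied to a test function whose boundary terms isolate
`g 0`. The constant does not depend on `a` because the gauge factor has modulus one, so it serves
all rings at once. -/
lemma exists_norm_start_le : ∃ K : ℝ, 0 ≤ K ∧ ∀ (a : ℝ) (g g' g'' : ℝ → ℂ)
    (u k : Lp ℂ 2 edgeMeasure), IsSobolev2 g g' g'' → u =ᵐ[edgeMeasure] g →
    k =ᵐ[edgeMeasure] magneticExpr a g g' g'' → ‖g 0‖ ≤ K * (‖u‖ + ‖k‖) := by
  have hp := Real.pi_pos.ne'
  -- The cubic with `φ 0 = φ π = φ' π = 0` and `φ' 0 = 1`.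
  set φ : ℝ → ℂ := fun x => ((x * (Real.pi - x) ^ 2 / Real.pi ^ 2 : ℝ) : ℂ) with hφd
  set φ' : ℝ → ℂ := fun x =>
    (((Real.pi - x) * (Real.pi - 3 * x) / Real.pi ^ 2 : ℝ) : ℂ) with hφd'
  set φ'' : ℝ → ℂ := fun x => (((6 * x - 4 * Real.pi) / Real.pi ^ 2 : ℝ) : ℂ) with hφd''
  have hφ : ∀ x, HasDerivAt φ (φ' x) x := fun x => by
    refine HasDerivAt.ofReal_comp ?_
    have := (((hasDerivAt_id x).mul (((hasDerivAt_id x).const_sub Real.pi).pow 2)).div_const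
      (Real.pi ^ 2))
    refine this.congr_deriv ?_
    simp
    ring
  have hφ' : ∀ x, HasDerivAt φ' (φ'' x) x := fun x => by
    refine HasDerivAt.ofReal_comp ?_
    have := ((((hasDerivAt_id x).const_sub Real.pi).mul
      (((hasDerivAt_id x).const_mul 3).const_sub Real.pi)).div_const (Real.pi ^ 2))
    refine this.congr_deriv ?_
    simp
    ring
  have cφ : Continuous φ := by fun_prop
  have cφ'' : Continuous φ'' := by fun_prop
  obtain ⟨M, hM0, hM⟩ := exists_bound_Icc cφ
  obtain ⟨M', hM0', hM'⟩ := exists_bound_Icc cφ''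
  refine ⟨(M + M') * Real.sqrt Real.pi, by positivity, fun a g g' g'' u k h hu hk => ?_⟩
  have hpi : Real.pi ∈ Icc 0 Real.pi := right_mem_Icc.2 Real.pi_pos.le
  have h1 := (h.isPrimitive_wronskian a hφ hφ' cφ'').congr_ae
    (l := fun x => k x * (gauge a x * φ x) + u x * (gauge a x * φ'' x)) (by
      filter_upwards [hu, hk] with x h1 h2
      rw [h1, h2])
  have h2 := h1.eq_integral Real.pi hpi
  have c1 : Continuous fun x => gauge a x * φ x := (continuous_gauge a).mul cφ
  have c2 : Continuous fun x => gauge a x * φ'' x := (continuous_gauge a).mul cφ''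
  rw [intervalIntegral.integral_add ((intervalIntegrable_lp k).mul_continuousOn c1.continuousOn)
    ((intervalIntegrable_lp u).mul_continuousOn c2.continuousOn)] at h2
  have e : g 0 = -((∫ t in (0 : ℝ)..Real.pi, k t * (gauge a t * φ t)) +
      ∫ t in (0 : ℝ)..Real.pi, u t * (gauge a t * φ'' t)) := by
    have e1 : φ Real.pi = 0 := by simp [hφd]
    have e2 : φ' Real.pi = 0 := by simp [hφd']
    have e3 : φ 0 = 0 := by simp [hφd]
    have e4 : φ' 0 = 1 := by
      simp only [hφd']; norm_cast; field_simp; ring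
    rw [e1, e2, e3, e4] at h2
    simp only [gauge_zero_right] at h2
    linear_combination -h2
  have b1 := norm_integral_mul_le k (ψ := fun t => gauge a t * φ t) (M := M)
    (fun t ht => by rw [norm_mul, norm_gauge, one_mul]; exact hM t ht) hpi
  have b2 := norm_integral_mul_le u (ψ := fun t => gauge a t * φ'' t) (M := M')
    (fun t ht => by rw [norm_mul, norm_gauge, one_mul]; exact hM' t ht) hpi
  rw [e, norm_neg]
  refine (norm_add_le _ _).trans ((add_le_add b1 b2).trans ?_)
  have := mul_nonneg (mul_nonneg hM0 (Real.sqrt_nonneg Real.pi)) (norm_nonneg u)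
  have := mul_nonneg (mul_nonneg hM0' (Real.sqrt_nonneg Real.pi)) (norm_nonneg k)
  nlinarith

lemma tendsto_norm_cofinite (u : L2Chain) : Tendsto (fun e => ‖u e‖) cofinite (𝓝 0) := by
  have h := (lp.memℓp u).summable (by norm_num)
  have h1 := h.tendsto_cofinite_zero
  have h2 := (Real.continuous_sqrt.tendsto 0).comp h1
  simpa [Function.comp_def, Real.sqrt_sq] using h2

/-- Vertex values of elements of the domain tend to zero along the chain. -/
lemma IsSolution.tendsto_start {α : ℝ} {A : ℤ → ℝ} {z : ℂ} {u f : L2Chain}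
    {g g' g'' : Edge → ℝ → ℂ} (h : IsSolution α A z f g g' g'')
    (hu : ∀ e, u e =ᵐ[edgeMeasure] g e) :
    Tendsto (fun j : ℤ => g (j, true) 0) cofinite (𝓝 0) := by
  obtain ⟨K, hK0, hK⟩ := exists_norm_start_le
  have hcoe : ∀ e, ((f + z • u : L2Chain) e : ℝ → ℂ) =ᵐ[edgeMeasure]
      magneticExpr (potential A e) (g e) (g' e) (g'' e) := by
    intro e
    have h1 := Lp.coeFn_add (f e) (z • u e)
    filter_upwards [h1, Lp.coeFn_smul z (u e), hu e, h.eq e] with x hx hx' h2 h3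
    refine Eq.trans hx ?_
    simp only [Pi.add_apply, hx', Pi.smul_apply, smul_eq_mul, h2, h3]
    ring
  have h1 : ∀ j : ℤ, ‖g (j, true) 0‖ ≤ K * (‖u (j, true)‖ + ‖(f + z • u : L2Chain) (j, true)‖) :=
    fun j => hK _ _ _ _ _ _ (h.sobolev _) (hu _) (hcoe _)
  have inj : Function.Injective fun j : ℤ => ((j, true) : Edge) := fun i j hij => by simpa using hij
  have t := ((tendsto_norm_cofinite u).comp inj.tendsto_cofinite).add
    ((tendsto_norm_cofinite (f + z • u)).comp inj.tendsto_cofinite)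
  have t2 := t.const_mul K
  simp only [add_zero, mul_zero] at t2
  exact squeeze_zero_norm h1 t2

/-! ### Square summable families -/

section SquareSummable

variable {ι : Type*} {E : ι → Type*} [∀ i, NormedAddCommGroup (E i)]

lemma exists_lp_of_norm_le (W : lp (fun _ : ι => ℝ) 2) (U : ∀ i, E i) (h : ∀ i, ‖U i‖ ≤ W i) :
    ∃ u : lp E 2, (∀ i, u i = U i) ∧ ‖u‖ ≤ ‖W‖ := by
  refine ⟨⟨U, (lp.memℓp W).mono h⟩, fun i => rfl, lp.norm_mono (by norm_num) fun i => ?_⟩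
  exact (h i).trans (Real.le_norm_self _)

lemma norm_sq_eq_tsum (u : lp E 2) : ‖u‖ ^ 2 = ∑' i, ‖u i‖ ^ 2 := by
  have := lp.norm_rpow_eq_tsum (p := 2) (by norm_num) u
  simpa using this

lemma summable_norm_sq (u : lp E 2) : Summable fun i => ‖u i‖ ^ 2 := by
  have := (lp.memℓp u).summable (by norm_num)
  simpa using this

lemma memℓp_two_of_summable {U : ∀ i, E i} (h : Summable fun i => ‖U i‖ ^ 2) : Memℓp U 2 :=
  memℓp_gen (by simpa using h)

lemma exists_lp_comp_injective {κ : Type*} (u : lp E 2) {i : κ → ι} (hi : Function.Injective i) :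
    ∃ W : lp (fun _ : κ => ℝ) 2, (∀ j, W j = ‖u (i j)‖) ∧ ‖W‖ ≤ ‖u‖ := by
  have hs := summable_norm_sq u
  have hs' : Summable fun j => ‖u (i j)‖ ^ 2 := hs.comp_injective hi
  refine ⟨⟨fun j => ‖u (i j)‖, memℓp_two_of_summable (by simpa using hs')⟩, fun j => rfl, ?_⟩
  refine le_of_sq_le_sq ?_ (norm_nonneg _)
  rw [norm_sq_eq_tsum, norm_sq_eq_tsum]
  simpa [Function.comp_def] using tsum_comp_le_tsum_of_inj hs (fun i => sq_nonneg _) hi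

end SquareSummable

/-- The Hilbert space `ℓ²(ℤ)` of vertex values. -/
abbrev VertexSpace : Type := lp (fun _ : ℤ => ℂ) 2

/-- Each vertex value is counted once on either half of a ring; the sharp factor would be `√2`. -/
lemma exists_lp_edge (V : VertexSpace) (n : ℤ) :
    ∃ W : lp (fun _ : Edge => ℝ) 2, (∀ e, W e = ‖V (e.1 + n)‖) ∧ ‖W‖ ≤ 2 * ‖V‖ := by
  have hs : Summable fun j => ‖V (j + n)‖ ^ 2 :=
    (summable_norm_sq V).comp_injective (add_left_injective n)
  have h1 : Summable fun _ : Bool => (1 : ℝ) := Summable.of_finite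
  have hp : Summable fun e : Edge => ‖V (e.1 + n)‖ ^ 2 := by
    simpa using hs.mul_of_nonneg h1 (fun _ => sq_nonneg _) (fun _ => zero_le_one)
  refine ⟨⟨fun e => ‖V (e.1 + n)‖, memℓp_two_of_summable (by simpa using hp)⟩, fun e => rfl, ?_⟩
  refine le_of_sq_le_sq ?_ (by positivity)
  rw [mul_pow, norm_sq_eq_tsum, norm_sq_eq_tsum]
  have e1 := tsum_mul_tsum_of_summable_norm (f := fun j => ‖V (j + n)‖ ^ 2)
    (g := fun _ : Bool => (1 : ℝ)) (by simpa using hs) (by simpa using h1)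
  have e2 : ∑' j, ‖V (j + n)‖ ^ 2 = ∑' j, ‖V j‖ ^ 2 :=
    (Equiv.addRight n).tsum_eq fun j => ‖V j‖ ^ 2
  rw [e2] at e1
  simp only [mul_one, tsum_fintype, Finset.sum_const, Finset.card_univ, Fintype.card_bool,
    nsmul_eq_mul] at e1
  simp only [norm_norm]
  rw [← e1]
  have : 0 ≤ ∑' j, ‖V j‖ ^ 2 := tsum_nonneg fun _ => sq_nonneg _
  push_cast
  linarith

/-! ### Solving the equation on a semicircle -/

lemma memLp_of_continuousOn {k : ℝ → ℂ} (h : ContinuousOn k (Icc 0 Real.pi)) :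
    MemLp k 2 edgeMeasure := by
  obtain ⟨M, hM⟩ := isCompact_Icc.exists_bound_of_continuousOn h
  refine MemLp.of_bound ((h.mono Ioo_subset_Icc_self).aestronglyMeasurable measurableSet_Ioo) M ?_
  exact (ae_restrict_iff' measurableSet_Ioo).2
    (Eventually.of_forall fun t ht => hM t (Ioo_subset_Icc_self ht))

lemma isPrimitive_const (w : ℂ) : IsPrimitive (fun _ => w) fun _ => 0 :=
  ⟨intervalIntegrable_const, fun x _ => by simp⟩

lemma isPrimitive_integral {k : ℝ → ℂ} (h : IntervalIntegrable k volume 0 Real.pi) :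
    IsPrimitive (fun x => ∫ t in (0 : ℝ)..x, k t) k :=
  ⟨h, fun x _ => by simp⟩

/-- Variation of constants: with `P' = -F' cosSol` and `Q' = F' sinSol`, the function `h = sinSol P
+ cosSol Q` satisfies `-h'' = z h + F'`, since the cross terms cancel in `h'` and `cosSol² + z
sinSol² = 1`. The potential is then restored by `g = gauge (-a) h`. -/
lemma exists_initial_value_solution (a : ℝ) (z : ℂ) (F : Lp ℂ 2 edgeMeasure) (v p : ℂ) :
    ∃ g g' g'' : ℝ → ℂ, IsSobolev2 g g' g'' ∧
      F =ᵐ[edgeMeasure] (fun x => magneticExpr a g g' g'' x - z * g x) ∧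
      g 0 = v ∧ quasiDeriv a g g' 0 = p := by
  set F' : ℝ → ℂ := fun t => F t * gauge a t with hF'
  have iF : IntervalIntegrable F' volume 0 Real.pi :=
    (intervalIntegrable_lp F).mul_continuousOn (continuous_gauge a).continuousOn
  have iP : IntervalIntegrable (fun t => -(F' t * cosSol z t)) volume 0 Real.pi :=
    (iF.mul_continuousOn (continuous_cosSol z).continuousOn).neg
  have iQ : IntervalIntegrable (fun t => F' t * sinSol z t) volume 0 Real.pi :=
    iF.mul_continuousOn (continuous_sinSol z).continuousOn
  have hP := (isPrimitive_const p).add (isPrimitive_integral iP)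
  have hQ := (isPrimitive_const v).add (isPrimitive_integral iQ)
  set P := fun x => p + ∫ t in (0 : ℝ)..x, -(F' t * cosSol z t) with hPd
  set Q := fun x => v + ∫ t in (0 : ℝ)..x, F' t * sinSol z t with hQd
  have cs := continuous_sinSol z
  have cc := continuous_cosSol z
  set h : ℝ → ℂ := fun x => sinSol z x * P x + cosSol z x * Q x with hh
  set h' : ℝ → ℂ := fun x => cosSol z x * P x + -z * sinSol z x * Q x with hh'
  have p1 : IsPrimitive h h' := by
    have := (hP.mul_left (hasDerivAt_sinSol z) cc).add
      (hQ.mul_left (hasDerivAt_cosSol z) (by fun_prop))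
    convert this using 2 with x
    simp only [hh']
    ring
  have p2 : IsPrimitive h' fun x => -z * h x - F' x := by
    have := (hP.mul_left (hasDerivAt_cosSol z) (by fun_prop)).add
      (hQ.mul_left (φ := fun x => -z * sinSol z x) (φ' := fun x => -z * cosSol z x)
        (fun x => (hasDerivAt_sinSol z x).const_mul (-z)) (by fun_prop))
    convert this using 2 with x
    simp only [hh]
    linear_combination F' x * cosSol_sq_add z x
  have cg := continuous_gauge (-a)
  set g : ℝ → ℂ := fun x => gauge (-a) x * h x with hg
  set g' : ℝ → ℂ := fun x => gauge (-a) x * (h' x + Complex.I * a * h x) with hg'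
  set g'' : ℝ → ℂ := fun x => gauge (-a) x *
    (-z * h x - F' x + 2 * Complex.I * a * h' x - a ^ 2 * h x) with hg''
  have hgd : ∀ x, HasDerivAt (gauge (-a)) (Complex.I * a * gauge (-a) x) x := fun x => by
    refine (hasDerivAt_gauge (-a) x).congr_deriv ?_
    push_cast; ring
  have q1 : IsPrimitive g g' := by
    convert p1.mul_left hgd (by fun_prop) using 2 with x
    simp only [hg']; ring
  have q2 : IsPrimitive g' g'' := by
    convert (p2.add (p1.const_mul (Complex.I * a))).mul_left hgd (by fun_prop) using 2 with x
    simp only [hg'']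
    linear_combination (-(a : ℂ) ^ 2 * gauge (-a) x * h x) * Complex.I_sq
  -- The two gauge factors on `F` cancel, so `g''` is a continuous function minus `F`.
  have mem : MemLp g'' 2 edgeMeasure := by
    have m1 : MemLp (fun x => gauge (-a) x *
        (-z * h x + 2 * Complex.I * a * h' x - a ^ 2 * h x)) 2 edgeMeasure := by
      refine memLp_of_continuousOn ?_
      have := p1.continuousOn
      have := p2.continuousOn
      fun_prop
    convert m1.sub (Lp.memLp F) using 1
    funext x
    simp only [hg'', hF', Pi.sub_apply]
    linear_combination -F x * gauge_mul_gauge_neg a x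
  refine ⟨g, g', g'', ⟨mem, q2.eq_integral, q1.eq_integral⟩, ?_, ?_, ?_⟩
  · refine Eventually.of_forall fun x => ?_
    simp only [magneticExpr, hg, hg', hg'', hF']
    linear_combination -F x * gauge_mul_gauge_neg a x -
      (2 * (a : ℂ) ^ 2 * gauge (-a) x * h x) * Complex.I_sq
  · simp [hg, hh, hQd]
  · simp [quasiDeriv, hg, hg', hh', hPd, hQd, hh]

/-- Off the Dirichlet spectrum the initial slope can be tuned to hit the prescribed right end value.
The bound is uniform in the potential, which is what allows the pieces to be assembled into an
element of `L²(Γ)`. -/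
lemma exists_boundary_value_solution {z : ℂ} (hz : sinPi z ≠ 0) :
    ∃ K : ℝ, 0 ≤ K ∧ ∀ (a : ℝ) (F : Lp ℂ 2 edgeMeasure) (v w : ℂ),
    ∃ (g g' g'' : ℝ → ℂ) (u : Lp ℂ 2 edgeMeasure), IsSobolev2 g g' g'' ∧
      F =ᵐ[edgeMeasure] (fun x => magneticExpr a g g' g'' x - z * g x) ∧
      g 0 = v ∧ g Real.pi = w ∧ u =ᵐ[edgeMeasure] g ∧ ‖u‖ ≤ K * (‖v‖ + ‖w‖ + ‖F‖) := by
  obtain ⟨Mc, hc0, hc⟩ := exists_bound_Icc (continuous_cosSol z)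
  obtain ⟨Ms, hs0, hs⟩ := exists_bound_Icc (continuous_sinSol z)
  have hpi : Real.pi ∈ Icc 0 Real.pi := right_mem_Icc.2 Real.pi_pos.le
  set σ := Real.sqrt Real.pi with hσ
  have hσ0 : 0 ≤ σ := Real.sqrt_nonneg _
  set L := (1 + Mc + Ms * σ) / ‖sinPi z‖ with hL
  have hL0 : 0 ≤ L := by positivity
  refine ⟨measureUnivNNReal edgeMeasure ^ (2 : ENNReal).toReal⁻¹ * (Mc + L * Ms + Ms * σ),
    by positivity, fun a F v w => ?_⟩
  -- The slope dictated by `IsSobolev2.quasiDeriv_start` for the end values `v` and `w`.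
  set p := (gauge a Real.pi * w - cosPi z * v + startLoad a z F) / sinPi z with hp
  obtain ⟨g, g', g'', hg, hF, h0, hp0⟩ := exists_initial_value_solution a z F v p
  have hN0 : 0 ≤ ‖v‖ + ‖w‖ + ‖F‖ := by positivity
  have bp : ‖p‖ ≤ L * (‖v‖ + ‖w‖ + ‖F‖) := by
    have b1 : ‖startLoad a z F‖ ≤ Ms * σ * ‖F‖ := by
      refine norm_integral_mul_le F (fun t ht => ?_) hpi
      rw [norm_mul, norm_gauge, one_mul]
      exact hs _ ⟨sub_nonneg.2 ht.2, sub_le_self _ ht.1⟩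
    have b2 : ‖cosPi z * v‖ ≤ Mc * ‖v‖ := by
      rw [norm_mul]; exact mul_le_mul_of_nonneg_right (hc _ hpi) (norm_nonneg _)
    have b3 : ‖gauge a Real.pi * w‖ = ‖w‖ := by rw [norm_mul, norm_gauge, one_mul]
    rw [hp, hL, norm_div, div_mul_eq_mul_div]
    refine div_le_div_of_nonneg_right ?_ (norm_nonneg _)
    refine (norm_add_le _ _).trans ((add_le_add_left (norm_sub_le _ _) _).trans ?_)
    have := norm_nonneg v
    have := norm_nonneg w
    have := norm_nonneg F
    have := mul_nonneg hs0 hσ0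
    nlinarith [mul_nonneg hc0 (norm_nonneg w), mul_nonneg hc0 (norm_nonneg F),
      mul_nonneg this (norm_nonneg v), mul_nonneg this (norm_nonneg w)]
  have hgπ : g Real.pi = w := by
    have e := hg.quasiDeriv_start hF
    rw [hp0, h0, hp, div_mul_cancel₀ _ hz] at e
    exact mul_left_cancel₀ (gauge_ne_zero a Real.pi) (by linear_combination -e)
  have bg : ∀ x ∈ Icc 0 Real.pi,
      ‖g x‖ ≤ (Mc + L * Ms + Ms * σ) * (‖v‖ + ‖w‖ + ‖F‖) := by
    intro x hx
    have e := hg.eq_representation hF hx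
    have b1 : ‖∫ t in (0 : ℝ)..x, F t * (gauge a t * sinSol z (x - t))‖ ≤ Ms * σ * ‖F‖ := by
      have hx' : x ∈ Icc 0 Real.pi := hx
      -- The weight must be bounded on all of `[0, π]` although only `t ≤ x` matters; the maximum
      -- with `0` keeps the argument of `sinSol` in that interval.
      have b := norm_integral_mul_le F (M := Ms)
        (ψ := fun t => gauge a t * sinSol z (max 0 (x - t))) (fun t ht => by
          rw [norm_mul, norm_gauge, one_mul]
          exact hs _ ⟨le_max_left _ _, max_le Real.pi_pos.le (by linarith [ht.1, hx.2])⟩) hx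
      convert b using 2
      refine intervalIntegral.integral_congr fun t ht => ?_
      rw [uIcc_of_le hx.1] at ht
      simp only [max_eq_right (sub_nonneg.2 ht.2)]
    have b2 : ‖g x‖ = ‖gauge a x * g x‖ := by rw [norm_mul, norm_gauge, one_mul]
    rw [b2, e, h0, hp0]
    refine (norm_sub_le _ _).trans ((add_le_add (norm_add_le _ _) b1).trans ?_)
    rw [norm_mul, norm_mul]
    have c1 := mul_le_mul_of_nonneg_left (hc x hx) (norm_nonneg v)
    have c2 := mul_le_mul bp (hs x hx) (norm_nonneg _) (mul_nonneg hL0 hN0)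
    have := norm_nonneg v
    have := norm_nonneg w
    have := norm_nonneg F
    have := mul_nonneg hs0 hσ0
    nlinarith [mul_nonneg hc0 (norm_nonneg w), mul_nonneg hc0 (norm_nonneg F),
      mul_nonneg this (norm_nonneg v), mul_nonneg this (norm_nonneg w)]
  have hm : MemLp g 2 edgeMeasure := memLp_of_continuousOn hg.continuousOn
  refine ⟨g, g', g'', hm.toLp g, hg, hF, h0, hgπ, hm.coeFn_toLp, ?_⟩
  refine (Lp.norm_le_of_ae_bound (f := hm.toLp g)
    (C := (Mc + L * Ms + Ms * σ) * (‖v‖ + ‖w‖ + ‖F‖)) (by positivity) ?_).trans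
    (le_of_eq (mul_assoc _ _ _).symm)
  filter_upwards [hm.coeFn_toLp, ae_restrict_mem measurableSet_Ioo] with x h1 h2
  rw [h1]
  exact bg x (Ioo_subset_Icc_self h2)

/-! ### Solving the equation on the chain -/

/-- A square summable solution of the Jacobi equation extends to a solution on the chain. -/
lemma exists_isSolution {α : ℝ} {A : ℤ → ℝ} {z : ℂ} (hz : sinPi z ≠ 0) :
    ∃ K : ℝ, 0 ≤ K ∧ ∀ (f : L2Chain) (V : VertexSpace),
    (∀ j, coeff A j * V (j + 1) + coeff A (j - 1) * V (j - 1) - discr α z * V j =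
      vertexLoad A z f j) →
    ∃ (g g' g'' : Edge → ℝ → ℂ) (u : L2Chain), IsSolution α A z f g g' g'' ∧
      (∀ e, u e =ᵐ[edgeMeasure] g e) ∧ (∀ j, g (j, true) 0 = V j) ∧
      ‖u‖ ≤ K * (‖V‖ + ‖f‖) := by
  obtain ⟨K, hK0, hK⟩ := exists_boundary_value_solution hz
  refine ⟨4 * K, by positivity, fun f V hV => ?_⟩
  choose g g' g'' U hg hF h0 hπ hU hn using fun e : Edge =>
    hK (potential A e) (f e) (V e.1) (V (e.1 + 1))
  obtain ⟨W0, hW0, nW0⟩ := exists_lp_edge V 0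
  obtain ⟨W1, hW1, nW1⟩ := exists_lp_edge V 1
  obtain ⟨Wf, hWf, nWf⟩ := exists_lp_comp_injective f (Function.injective_id (α := Edge))
  obtain ⟨u, hu, nu⟩ := exists_lp_of_norm_le (K • (W0 + W1 + Wf)) U fun e => by
    have := hn e
    simp only [lp.coeFn_smul, lp.coeFn_add, Pi.smul_apply, Pi.add_apply, smul_eq_mul, hW0, hW1,
      hWf, add_zero, id_eq]
    exact this
  refine ⟨g, g', g'', u, ⟨hg, fun j => ⟨?_, ?_, ?_, ?_⟩, hF⟩, fun e => ?_, fun j => h0 _, ?_⟩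
  · rw [h0, h0]
  · rw [h0, hπ, sub_add_cancel]
  · rw [h0, hπ, sub_add_cancel]
  · have s1 := (hg (j, true)).quasiDeriv_start (hF _)
    have s2 := (hg (j, false)).quasiDeriv_start (hF _)
    have s3 := (hg (j - 1, true)).quasiDeriv_end (hF _)
    have s4 := (hg (j - 1, false)).quasiDeriv_end (hF _)
    rw [h0, hπ] at s1 s2 s3 s4
    simp only [sub_add_cancel] at s3 s4
    have g1 := gauge_upper_add_lower A j
    have g2 := gauge_neg_upper_add_lower A (j - 1)
    have e := hV j
    rw [vertexLoad, discr] at e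
    rw [h0]
    refine mul_right_cancel₀ hz ?_
    linear_combination s1 + s2 - s3 - s4 + 2 * e + V (j + 1) * g1 + V (j - 1) * g2
  · rw [hu]; exact hU e
  · refine nu.trans ?_
    rw [norm_smul, Real.norm_of_nonneg hK0]
    have h1 : ‖W0 + W1 + Wf‖ ≤ 4 * (‖V‖ + ‖f‖) := by
      refine (norm_add₃_le).trans ?_
      linarith [norm_nonneg f]
    calc K * ‖W0 + W1 + Wf‖ ≤ K * (4 * (‖V‖ + ‖f‖)) := mul_le_mul_of_nonneg_left h1 hK0
      _ = _ := by ring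

/-- The vertex loads of an element of `L²(Γ)` are square summable. -/
lemma exists_vertexLoad (A : ℤ → ℝ) (z : ℂ) : ∃ K : ℝ, 0 ≤ K ∧ ∀ f : L2Chain,
    ∃ W : VertexSpace, (∀ j, W j = vertexLoad A z f j) ∧ ‖W‖ ≤ K * ‖f‖ := by
  obtain ⟨M, hM0, hM⟩ := exists_bound_Icc (continuous_sinSol z)
  have hpi : Real.pi ∈ Icc 0 Real.pi := right_mem_Icc.2 Real.pi_pos.le
  set σ := M * Real.sqrt Real.pi with hσ
  have hσ0 : 0 ≤ σ := by positivity
  have b1 : ∀ (a : ℝ) (F : Lp ℂ 2 edgeMeasure), ‖startLoad a z F‖ ≤ σ * ‖F‖ := fun a F => by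
    refine norm_integral_mul_le F (fun t ht => ?_) hpi
    rw [norm_mul, norm_gauge, one_mul]
    exact hM _ ⟨sub_nonneg.2 ht.2, sub_le_self _ ht.1⟩
  have b2 : ∀ (a : ℝ) (F : Lp ℂ 2 edgeMeasure), ‖endLoad a z F‖ ≤ σ * ‖F‖ := fun a F => by
    refine norm_integral_mul_le F (fun t ht => ?_) hpi
    rw [norm_mul, norm_gauge, one_mul]
    exact hM _ ht
  refine ⟨σ * 4, by positivity, fun f => ?_⟩
  have inj : ∀ (n : ℤ) (b : Bool), Function.Injective fun j : ℤ => ((j + n, b) : Edge) :=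
    fun n b i j h => by simpa using h
  obtain ⟨W1, h1, n1⟩ := exists_lp_comp_injective f (inj 0 true)
  obtain ⟨W2, h2, n2⟩ := exists_lp_comp_injective f (inj 0 false)
  obtain ⟨W3, h3, n3⟩ := exists_lp_comp_injective f (inj (-1) true)
  obtain ⟨W4, h4, n4⟩ := exists_lp_comp_injective f (inj (-1) false)
  obtain ⟨W, hW, nW⟩ := exists_lp_of_norm_le (E := fun _ : ℤ => ℂ)
    (σ • (W1 + W2 + (W3 + W4))) (vertexLoad A z f) fun j => by
      simp only [lp.coeFn_smul, lp.coeFn_add, Pi.smul_apply, Pi.add_apply, smul_eq_mul, h1, h2, h3,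
        h4, add_zero, ← sub_eq_add_neg]
      rw [vertexLoad, norm_div, norm_neg, RCLike.norm_ofNat]
      have t1 := b1 (potential A (j, true)) (f (j, true))
      have t2 := b1 (potential A (j, false)) (f (j, false))
      have t3 := b2 (potential A (j - 1, true)) (f (j - 1, true))
      have t4 := b2 (potential A (j - 1, false)) (f (j - 1, false))
      have m := norm_add₄_le
        (a := startLoad (potential A (j, true)) z (f (j, true)))
        (b := startLoad (potential A (j, false)) z (f (j, false)))
        (c := gauge (-potential A (j - 1, true)) Real.pi *
          endLoad (potential A (j - 1, true)) z (f (j - 1, true)))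
        (d := gauge (-potential A (j - 1, false)) Real.pi *
          endLoad (potential A (j - 1, false)) z (f (j - 1, false)))
      rw [norm_mul, norm_mul, norm_gauge, norm_gauge, one_mul, one_mul] at m
      refine (half_le_self (norm_nonneg _)).trans (m.trans ?_)
      linarith
  refine ⟨W, hW, nW.trans ?_⟩
  rw [norm_smul, Real.norm_of_nonneg hσ0]
  have h1 : ‖W1 + W2 + (W3 + W4)‖ ≤ 4 * ‖f‖ := by
    have := norm_add_le (W1 + W2) (W3 + W4)
    have := norm_add_le W1 W2
    have := norm_add_le W3 W4
    linarith
  calc σ * ‖W1 + W2 + (W3 + W4)‖ ≤ σ * (4 * ‖f‖) := mul_le_mul_of_nonneg_left h1 hσ0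
    _ = _ := by ring

/-! ### The Jacobi operator -/

namespace VertexSpace

lemma add_apply (V W : VertexSpace) (j : ℤ) : (V + W) j = V j + W j := rfl

lemma sub_apply (V W : VertexSpace) (j : ℤ) : (V - W) j = V j - W j := rfl

lemma smul_apply (w : ℂ) (V : VertexSpace) (j : ℤ) : (w • V) j = w * V j := rfl

lemma eval_apply (V : VertexSpace) (j : ℤ) : lp.evalCLM ℂ (fun _ : ℤ => ℂ) 2 j V = V j := rfl

lemma single_apply (i : ℤ) (w : ℂ) (j : ℤ) :
    (lp.single 2 i w : VertexSpace) j = if j = i then w else 0 := by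
  rw [lp.single_apply, Pi.single_apply]

end VertexSpace

/-- The shift `V ↦ V (· + n)` of `ℓ²(ℤ)`. -/
def shift (n : ℤ) : VertexSpace →L[ℂ] VertexSpace :=
  LinearMap.mkContinuous
    { toFun := fun V => ⟨fun j => V (j + n), memℓp_two_of_summable
        ((summable_norm_sq V).comp_injective (add_left_injective n))⟩
      map_add' := fun _ _ => rfl
      map_smul' := fun _ _ => rfl } 1 fun V => by
    rw [one_mul]
    refine le_of_sq_le_sq ?_ (norm_nonneg _)
    rw [norm_sq_eq_tsum, norm_sq_eq_tsum]
    exact ((Equiv.addRight n).tsum_eq fun j => ‖V j‖ ^ 2).le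

@[simp] lemma shift_apply (n : ℤ) (V : VertexSpace) (j : ℤ) : shift n V j = V (j + n) := rfl

lemma norm_shift_le (n : ℤ) : ‖shift n‖ ≤ 1 := LinearMap.mkContinuous_norm_le _ zero_le_one _

lemma isUnit_one_sub_smul_shift {μ : ℂ} (h : ‖μ‖ < 1) (n : ℤ) :
    IsUnit (1 - μ • shift n : VertexSpace →L[ℂ] VertexSpace) := by
  refine isUnit_one_sub_of_norm_lt_one ?_
  rw [norm_smul]
  exact lt_of_le_of_lt (mul_le_of_le_one_right (norm_nonneg _) (norm_shift_le n)) h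

/-- The resolvent equation of the free Jacobi matrix off its spectrum. -/
lemma isUnit_free {c μ : ℂ} (hc : c ≠ 0) (hμ0 : μ ≠ 0) (hμ : ‖μ‖ < 1) :
    IsUnit (c • (shift 1 + shift (-1)) -
      (c * (μ + μ⁻¹)) • (1 : VertexSpace →L[ℂ] VertexSpace)) := by
  -- The symbol factors as `-(c / μ) (1 - μ S) (1 - μ S⁻¹)`, and both factors are inverted by
  -- Neumann series.
  have e : c • (shift 1 + shift (-1)) - (c * (μ + μ⁻¹)) • (1 : VertexSpace →L[ℂ] VertexSpace) =
      (-(c / μ)) • ((1 - μ • shift 1) * (1 - μ • shift (-1))) := by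
    refine ContinuousLinearMap.ext fun V => lp.ext (funext fun j => ?_)
    have h1 : j + 1 + -1 = j := by ring
    simp only [sub_apply, smul_apply, add_apply, mul_apply_eq_comp, one_apply_eq_self,
      VertexSpace.sub_apply, VertexSpace.smul_apply,
      VertexSpace.add_apply, shift_apply, h1]
    field_simp
    ring
  rw [e]
  have hu : IsUnit (-(c / μ)) := (neg_ne_zero.2 (div_ne_zero hc hμ0)).isUnit
  exact (hu.unit • ((isUnit_one_sub_smul_shift hμ 1).mul
    (isUnit_one_sub_smul_shift hμ (-1))).unit).isUnit

/-- The Fredholm alternative for finite rank: `1 + T` preserves the range of `T`, where injective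
means surjective. Solving `(1 + T) r = -T y` there gives `(1 + T) (y + r) = y`. -/
lemma surjective_one_add_of_finiteDimensional_range {X : Type*} [AddCommGroup X] [Module ℂ X]
    (T : X →ₗ[ℂ] X) [FiniteDimensional ℂ (LinearMap.range T)]
    (h : Function.Injective (1 + T : X →ₗ[ℂ] X)) :
    Function.Surjective (1 + T : X →ₗ[ℂ] X) := by
  have hm : ∀ x ∈ LinearMap.range T, (1 + T : X →ₗ[ℂ] X) x ∈ LinearMap.range T := by
    intro x hx
    exact Submodule.add_mem _ hx ⟨x, rfl⟩
  have hi : Function.Injective ((1 + T : X →ₗ[ℂ] X).restrict hm) := fun x y hxy =>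
    Subtype.ext (h (congrArg Subtype.val hxy))
  have hs := LinearMap.injective_iff_surjective.1 hi
  intro y
  obtain ⟨r, hr⟩ := hs ⟨-T y, Submodule.neg_mem _ ⟨y, rfl⟩⟩
  refine ⟨y + r, ?_⟩
  have hr' : (r : X) + T r = -T y := congrArg Subtype.val hr
  simp only [LinearMap.add_apply, Module.End.one_apply, map_add]
  rw [hr', add_neg_cancel_right]

/-- The perturbation of the free Jacobi matrix, of finite rank. -/
def jacobiPerturbation (b₁ b₂ : ℂ) : VertexSpace →L[ℂ] VertexSpace :=
  (lp.evalCLM ℂ (fun _ : ℤ => ℂ) 2 2).smulRight (lp.single 2 (1 : ℤ) b₁) +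
  (b₁ • lp.evalCLM ℂ (fun _ : ℤ => ℂ) 2 1 + b₂ • lp.evalCLM ℂ (fun _ : ℤ => ℂ) 2 3).smulRight
    (lp.single 2 (2 : ℤ) (1 : ℂ)) +
  (lp.evalCLM ℂ (fun _ : ℤ => ℂ) 2 2).smulRight (lp.single 2 (3 : ℤ) b₂)

/-- Changing the couplings of vertices 1, 2 and of vertices 2, 3 affects only the three rows at
these vertices. -/
lemma jacobiPerturbation_apply (b₁ b₂ : ℂ) (V : VertexSpace) (j : ℤ) :
    jacobiPerturbation b₁ b₂ V j = (if j = 1 then V 2 * b₁ else 0) +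
      (if j = 2 then b₁ * V 1 + b₂ * V 3 else 0) + (if j = 3 then V 2 * b₂ else 0) := by
  simp only [jacobiPerturbation, add_apply, smul_apply,
    ContinuousLinearMap.smulRight_apply, VertexSpace.add_apply, VertexSpace.smul_apply,
    VertexSpace.eval_apply, VertexSpace.single_apply, smul_eq_mul]
  simp

lemma finiteDimensional_range_jacobiPerturbation (b₁ b₂ : ℂ) :
    FiniteDimensional ℂ (LinearMap.range (jacobiPerturbation b₁ b₂).toLinearMap) := by
  have : FiniteDimensional ℂ (Submodule.span ℂ
    ({lp.single 2 (1 : ℤ) b₁, lp.single 2 (2 : ℤ) (1 : ℂ), lp.single 2 (3 : ℤ) b₂} :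
      Set VertexSpace)) := FiniteDimensional.span_of_finite ℂ (Set.toFinite _)
  refine Submodule.finiteDimensional_of_le (S₂ := Submodule.span ℂ
    ({lp.single 2 (1 : ℤ) b₁, lp.single 2 (2 : ℤ) (1 : ℂ), lp.single 2 (3 : ℤ) b₂} :
      Set VertexSpace)) ?_
  rintro _ ⟨V, rfl⟩
  refine Submodule.add_mem _ (Submodule.add_mem _ ?_ ?_) ?_ <;>
    exact Submodule.smul_mem _ _ (Submodule.subset_span (by simp))

/-- If the Jacobi matrix with coefficients `a`, constant away from `1` and `2`, has no eigenvector
for a point off the spectrum of the free Jacobi matrix, then this point is in its resolvent set. -/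
lemma exists_jacobi_solution {a : ℤ → ℂ} {c μ : ℂ} (ha : ∀ j, j ≠ 1 → j ≠ 2 → a j = c)
    (hc : c ≠ 0) (hμ0 : μ ≠ 0) (hμ : ‖μ‖ < 1)
    (hinj : ∀ V : VertexSpace,
      (∀ j, a j * V (j + 1) + a (j - 1) * V (j - 1) - c * (μ + μ⁻¹) * V j = 0) → V = 0) :
    ∃ K : ℝ, 0 ≤ K ∧ ∀ W : VertexSpace, ∃ V : VertexSpace,
      (∀ j, a j * V (j + 1) + a (j - 1) * V (j - 1) - c * (μ + μ⁻¹) * V j = W j) ∧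
      ‖V‖ ≤ K * ‖W‖ := by
  obtain ⟨P, hP⟩ := isUnit_free hc hμ0 hμ
  set Q := jacobiPerturbation (a 1 - c) (a 2 - c) with hQ
  set J : VertexSpace →L[ℂ] VertexSpace := (P : VertexSpace →L[ℂ] VertexSpace) + Q with hJ
  have hJa : ∀ V j, J V j = a j * V (j + 1) + a (j - 1) * V (j - 1) - c * (μ + μ⁻¹) * V j := by
    intro V j
    have h0 : J V j = c * (V (j + 1) + V (j - 1)) - c * (μ + μ⁻¹) * V j + Q V j := by
      rw [hJ, hP]; rfl
    rw [h0, hQ, jacobiPerturbation_apply]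
    by_cases h1 : j = 1
    · subst h1
      rw [ha (1 - 1) (by norm_num) (by norm_num)]
      rw [show V (1 + 1) = V 2 from rfl]
      norm_num
      ring
    by_cases h2 : j = 2
    · subst h2
      rw [show V (2 + 1) = V 3 from rfl, show V (2 - 1) = V 1 from rfl]
      norm_num
      ring
    by_cases h3 : j = 3
    · subst h3
      rw [ha 3 (by norm_num) (by norm_num)]
      rw [show V (3 - 1) = V 2 from rfl]
      norm_num
      ring
    · rw [ha j h1 h2, ha (j - 1) (by omega) (by omega)]
      simp only [h1, h2, h3, if_false]
      ring
  have hJi : Function.Injective J := by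
    refine (injective_iff_map_eq_zero J).2 fun V hV => hinj V fun j => ?_
    rw [← hJa, hV]; rfl
  -- The factorization `J = P (1 + P⁻¹ Q)`, in which `P⁻¹ Q` has finite rank, turns injectivity of
  -- `J` into bijectivity.
  set T : VertexSpace →ₗ[ℂ] VertexSpace :=
    ((P⁻¹ : (VertexSpace →L[ℂ] VertexSpace)ˣ) : VertexSpace →L[ℂ] VertexSpace).toLinearMap ∘ₗ
      Q.toLinearMap with hT
  have hPP : ∀ V, (P : VertexSpace →L[ℂ] VertexSpace)
      (((P⁻¹ : (VertexSpace →L[ℂ] VertexSpace)ˣ) : VertexSpace →L[ℂ] VertexSpace) V) = V := by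
    intro V
    have := DFunLike.congr_fun (P.mul_inv) V
    exact this
  have hfac : ∀ V, (P : VertexSpace →L[ℂ] VertexSpace) ((1 + T : VertexSpace →ₗ[ℂ] VertexSpace) V) =
      J V := by
    intro V
    have e : (1 + T : VertexSpace →ₗ[ℂ] VertexSpace) V = V +
      ((P⁻¹ : (VertexSpace →L[ℂ] VertexSpace)ˣ) : VertexSpace →L[ℂ] VertexSpace) (Q V) := rfl
    rw [e, map_add, hPP]
    rfl
  have hTf : FiniteDimensional ℂ (LinearMap.range T) := by
    have := finiteDimensional_range_jacobiPerturbation (a 1 - c) (a 2 - c)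
    rw [hT, LinearMap.range_comp]
    infer_instance
  have hTs := surjective_one_add_of_finiteDimensional_range T fun V W h => hJi (by
    rw [← hfac, ← hfac, h])
  have hJs : Function.Surjective J := by
    intro W
    obtain ⟨V, hV⟩ := hTs
      (((P⁻¹ : (VertexSpace →L[ℂ] VertexSpace)ˣ) : VertexSpace →L[ℂ] VertexSpace) W)
    exact ⟨V, by rw [← hfac, hV, hPP]⟩
  -- The open mapping theorem supplies the bound `K`.
  let e := ContinuousLinearEquiv.ofBijective J (LinearMap.ker_eq_bot.2 hJi)
    (LinearMap.range_eq_top.2 hJs)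
  refine ⟨‖(e.symm : VertexSpace →L[ℂ] VertexSpace)‖, norm_nonneg _,
    fun W => ⟨e.symm W, fun j => ?_,
    (e.symm : VertexSpace →L[ℂ] VertexSpace).le_opNorm W⟩⟩
  rw [← hJa]
  exact congrArg (fun U : VertexSpace => U j) (e.apply_symm_apply W)

/-! ### Solutions of the Jacobi equation -/

/-- The roots of `t² - (ξ / c) t + 1` have product one, so one of them lies in the closed unit disc.
-/
lemma exists_multiplier {c : ℂ} (hc : c ≠ 0) (ξ : ℂ) :
    ∃ μ : ℂ, μ ≠ 0 ∧ ‖μ‖ ≤ 1 ∧ ξ = c * (μ + μ⁻¹) := by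
  obtain ⟨s, hs⟩ := IsAlgClosed.exists_pow_nat_eq ((ξ / c) ^ 2 - 4) (n := 2) (by norm_num)
  set μ := (ξ / c + s) / 2 with hμ
  set ν := (ξ / c - s) / 2 with hν
  have h1 : μ * ν = 1 := by rw [hμ, hν]; linear_combination -hs / 4
  have h0 : μ ≠ 0 := left_ne_zero_of_mul_eq_one h1
  have h0' : ν ≠ 0 := right_ne_zero_of_mul_eq_one h1
  have h2 : μ⁻¹ = ν := (eq_inv_of_mul_eq_one_right h1).symm
  have h3 : ν⁻¹ = μ := by rw [← h2, inv_inv]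
  have h4 : ξ = c * (μ + ν) := by rw [hμ, hν]; field_simp; ring
  rcases le_total ‖μ‖ 1 with h | h
  · exact ⟨μ, h0, h, by rw [h2, h4]⟩
  · refine ⟨ν, h0', ?_, by rw [h3, h4, add_comm]⟩
    rw [← h2, norm_inv]
    exact inv_le_one_of_one_le₀ h

/-- The defect `d n = u (n + 1) - μ u n` satisfies `d n = μ d (n + 1)`; its modulus cannot decrease,
yet it tends to zero. The argument also covers `|μ| = 1`, including the double roots `μ = ±1`. -/
lemma halfline_solution {u : ℕ → ℂ} {μ : ℂ} (hμ0 : μ ≠ 0) (hμ : ‖μ‖ ≤ 1)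
    (h : ∀ n, u (n + 2) + u n = (μ + μ⁻¹) * u (n + 1)) (hu : Tendsto u atTop (𝓝 0)) (n : ℕ) :
    u (n + 1) = μ * u n := by
  set d : ℕ → ℂ := fun n => u (n + 1) - μ * u n with hd
  have hrec : ∀ n, d n = μ * d (n + 1) := by
    intro n
    have h1 : μ * μ⁻¹ = 1 := mul_inv_cancel₀ hμ0
    simp only [hd]
    linear_combination (-μ) * h n - u (n + 1) * h1
  have hmono : ∀ n k, ‖d n‖ ≤ ‖d (n + k)‖ := by
    intro n k
    induction k with
    | zero => exact le_rfl
    | succ k ih =>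
      refine ih.trans ?_
      rw [hrec (n + k), norm_mul]
      exact mul_le_of_le_one_left (norm_nonneg _) hμ
  have hd0 : Tendsto d atTop (𝓝 0) := by
    have := ((tendsto_add_atTop_iff_nat 1).2 hu).sub (hu.const_mul μ)
    simpa using this
  have h1 : Tendsto (fun k => ‖d (n + k)‖) atTop (𝓝 0) := by
    have := (tendsto_add_atTop_iff_nat n).2 hd0.norm
    simpa [add_comm] using this
  have h2 : ‖d n‖ ≤ 0 := ge_of_tendsto' h1 (hmono n)
  exact sub_eq_zero.1 (norm_le_zero_iff.1 h2)

lemma right_solution {v : ℤ → ℂ} {c μ : ℂ} (hc : c ≠ 0) (hμ0 : μ ≠ 0) (hμ : ‖μ‖ ≤ 1) {m : ℤ}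
    (h : ∀ j, m ≤ j → c * v (j + 1) + c * v (j - 1) - c * (μ + μ⁻¹) * v j = 0)
    (hv : Tendsto v cofinite (𝓝 0)) {j : ℤ} (hj : m - 1 ≤ j) : v (j + 1) = μ * v j := by
  -- The row at `m` already involves `v (m - 1)`, so the half-line begins there.
  have inj : Function.Injective fun n : ℕ => m - 1 + (n : ℤ) := fun a b hab => by simpa using hab
  have hu : Tendsto (fun n : ℕ => v (m - 1 + n)) atTop (𝓝 0) := by
    rw [← Nat.cofinite_eq_atTop]
    exact hv.comp inj.tendsto_cofinite
  have key := halfline_solution hμ0 hμ (u := fun n : ℕ => v (m - 1 + n)) (fun n => by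
    have := h (m + n) (by omega)
    apply mul_left_cancel₀ hc
    rw [show m - 1 + ((n + 2 : ℕ) : ℤ) = m + n + 1 by push_cast; ring,
      show m - 1 + ((n + 1 : ℕ) : ℤ) = m + n by push_cast; ring,
      show m - 1 + (n : ℤ) = m + n - 1 by ring]
    linear_combination this) hu (j - (m - 1)).toNat
  rw [show m - 1 + (((j - (m - 1)).toNat + 1 : ℕ) : ℤ) = j + 1 by omega,
    show m - 1 + (((j - (m - 1)).toNat : ℕ) : ℤ) = j by omega] at key
  exact key

lemma left_solution {v : ℤ → ℂ} {c μ : ℂ} (hc : c ≠ 0) (hμ0 : μ ≠ 0) (hμ : ‖μ‖ ≤ 1) {m : ℤ}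
    (h : ∀ j, j ≤ m → c * v (j + 1) + c * v (j - 1) - c * (μ + μ⁻¹) * v j = 0)
    (hv : Tendsto v cofinite (𝓝 0)) {j : ℤ} (hj : j ≤ m + 1) : v (j - 1) = μ * v j := by
  have := right_solution (v := fun j => v (-j)) (m := -m) (j := -j) hc hμ0 hμ (fun j hj => by
    have := h (-j) (by omega)
    rw [show -(j + 1) = -j - 1 by ring, show -(j - 1) = -j + 1 by ring]
    linear_combination this) (hv.comp neg_injective.tendsto_cofinite) (by omega)
  simpa [show -(-j + 1) = j - 1 by ring] using this

lemma eq_zero_of_unimodular_multiplier {u : ℕ → ℂ} {μ : ℂ} (hμ : ‖μ‖ = 1)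
    (h : ∀ n, u (n + 1) = μ * u n) (hu : Tendsto u atTop (𝓝 0)) : u 0 = 0 := by
  have hn : ∀ n, ‖u n‖ = ‖u 0‖ := by
    intro n
    induction n with
    | zero => rfl
    | succ n ih => rw [h, norm_mul, hμ, one_mul, ih]
  have h1 := hu.norm
  simp only [hn, norm_zero] at h1
  exact norm_eq_zero.1 (tendsto_nhds_unique tendsto_const_nhds h1)

lemma right_solution_eq_zero {v : ℤ → ℂ} {c μ : ℂ} (hc : c ≠ 0) (hμ : ‖μ‖ = 1) {m : ℤ}
    (h : ∀ j, m ≤ j → c * v (j + 1) + c * v (j - 1) - c * (μ + μ⁻¹) * v j = 0)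
    (hv : Tendsto v cofinite (𝓝 0)) {j : ℤ} (hj : m - 1 ≤ j) : v j = 0 := by
  have hμ0 : μ ≠ 0 := norm_ne_zero_iff.1 (by rw [hμ]; exact one_ne_zero)
  have inj : Function.Injective fun n : ℕ => j + (n : ℤ) := fun a b hab => by simpa using hab
  have := eq_zero_of_unimodular_multiplier (u := fun n : ℕ => v (j + n)) hμ (fun n => by
    have := right_solution hc hμ0 hμ.le h hv (j := j + n) (by omega)
    simpa [add_assoc] using this) (by
    rw [← Nat.cofinite_eq_atTop]
    exact hv.comp inj.tendsto_cofinite)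
  simpa using this

lemma left_solution_eq_zero {v : ℤ → ℂ} {c μ : ℂ} (hc : c ≠ 0) (hμ : ‖μ‖ = 1) {m : ℤ}
    (h : ∀ j, j ≤ m → c * v (j + 1) + c * v (j - 1) - c * (μ + μ⁻¹) * v j = 0)
    (hv : Tendsto v cofinite (𝓝 0)) {j : ℤ} (hj : j ≤ m + 1) : v j = 0 := by
  have := right_solution_eq_zero (v := fun j => v (-j)) (m := -m) (j := -j) hc hμ (fun j hj => by
    have := h (-j) (by omega)
    rw [show -(j + 1) = -j - 1 by ring, show -(j - 1) = -j + 1 by ring]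
    linear_combination this) (hv.comp neg_injective.tendsto_cofinite) (by omega)
  simpa using this

/-! ### Decaying solutions with two perturbed coefficients -/

section Kernel

variable {a v : ℤ → ℂ} {c μ : ℂ}

/-- A decaying solution of the homogeneous equation is determined near the perturbed rings. -/
lemma kernel_relations (ha : ∀ j, j ≠ 1 → j ≠ 2 → a j = c) (hc : c ≠ 0) (hμ0 : μ ≠ 0)
    (hμ : ‖μ‖ ≤ 1)
    (h : ∀ j, a j * v (j + 1) + a (j - 1) * v (j - 1) - c * (μ + μ⁻¹) * v j = 0)
    (hv : Tendsto v cofinite (𝓝 0)) :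
    (∀ j, 3 ≤ j → v (j + 1) = μ * v j) ∧ (∀ j, j ≤ 1 → v (j - 1) = μ * v j) ∧
      c * v 3 = μ * (a 2 * v 2) ∧ c * v 1 = μ * (a 1 * v 2) := by
  -- The rows at `j ≥ 4` and at `j ≤ 0` contain only the unperturbed coefficient `c`; the rows at 3
  -- and 1 then give the two relations with `v 2`.
  have hr : ∀ j, 3 ≤ j → v (j + 1) = μ * v j := fun j hj =>
    right_solution hc hμ0 hμ (m := 4) (fun j hj => by
      have := h j
      rwa [ha j (by omega) (by omega), ha (j - 1) (by omega) (by omega)] at this) hv (by omega)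
  have hl : ∀ j, j ≤ 1 → v (j - 1) = μ * v j := fun j hj =>
    left_solution hc hμ0 hμ (m := 0) (fun j hj => by
      have := h j
      rwa [ha j (by omega) (by omega), ha (j - 1) (by omega) (by omega)] at this) hv (by omega)
  have h1 : μ * μ⁻¹ = 1 := mul_inv_cancel₀ hμ0
  refine ⟨hr, hl, ?_, ?_⟩
  · have e := h 3
    have r := hr 3 le_rfl
    rw [ha 3 (by norm_num) (by norm_num), r] at e
    norm_num at e
    linear_combination -μ * e - c * v 3 * h1
  · have e := h 1
    have l := hl 1 le_rfl
    rw [ha (1 - 1) (by norm_num) (by norm_num), l] at e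
    norm_num at e
    linear_combination -μ * e - c * v 1 * h1

/-- The value at vertex 2 determines a decaying solution on both sides. This gives uniqueness here
and simplicity of the eigenvalue later. -/
lemma kernel_eq_zero (ha : ∀ j, j ≠ 1 → j ≠ 2 → a j = c) (hc : c ≠ 0) (hμ0 : μ ≠ 0)
    (hμ : ‖μ‖ ≤ 1)
    (h : ∀ j, a j * v (j + 1) + a (j - 1) * v (j - 1) - c * (μ + μ⁻¹) * v j = 0)
    (hv : Tendsto v cofinite (𝓝 0)) (h2 : v 2 = 0) (j : ℤ) : v j = 0 := by
  obtain ⟨hr, hl, h3, h1⟩ := kernel_relations ha hc hμ0 hμ h hv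
  rw [h2, mul_zero, mul_zero] at h3 h1
  have h3' : v 3 = 0 := (mul_eq_zero.1 h3).resolve_left hc
  have h1' : v 1 = 0 := (mul_eq_zero.1 h1).resolve_left hc
  rcases lt_trichotomy j 2 with hj | rfl | hj
  · have : ∀ n : ℕ, v (1 - n) = 0 := by
      intro n
      induction n with
      | zero => simpa using h1'
      | succ n ih =>
        have := hl (1 - n) (by omega)
        rw [ih, mul_zero] at this
        rw [← this]; congr 1; push_cast; ring
    have := this (1 - j).toNat
    rwa [show 1 - ((1 - j).toNat : ℤ) = j by omega] at this
  · exact h2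
  · have : ∀ n : ℕ, v (3 + n) = 0 := by
      intro n
      induction n with
      | zero => simpa using h3'
      | succ n ih =>
        have := hr (3 + n) (by omega)
        rw [ih, mul_zero] at this
        rw [← this]; congr 1
    have := this (j - 3).toNat
    rwa [show 3 + ((j - 3).toNat : ℤ) = j by omega] at this

/-- The row at vertex 2, the only one not yet used, after elimination of `v 1` and `v 3`. -/
lemma kernel_determinant (ha : ∀ j, j ≠ 1 → j ≠ 2 → a j = c) (hc : c ≠ 0) (hμ0 : μ ≠ 0)
    (hμ : ‖μ‖ ≤ 1)
    (h : ∀ j, a j * v (j + 1) + a (j - 1) * v (j - 1) - c * (μ + μ⁻¹) * v j = 0)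
    (hv : Tendsto v cofinite (𝓝 0)) (h2 : v 2 ≠ 0) :
    μ ^ 2 * (a 1 ^ 2 + a 2 ^ 2 - c ^ 2) = c ^ 2 := by
  obtain ⟨-, -, h3, h1⟩ := kernel_relations ha hc hμ0 hμ h hv
  have e := h 2
  norm_num at e
  have h0 : μ * μ⁻¹ = 1 := mul_inv_cancel₀ hμ0
  refine mul_right_cancel₀ h2 ?_
  linear_combination c * μ * e - a 2 * μ * h3 - a 1 * μ * h1 + c ^ 2 * v 2 * h0

/-- Since `v 1 = v 3 = 0`, a nonzero coefficient next to vertex 2 forces `v 2 = 0`. If both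
vanished, vertex 2 would decouple and carry a null vector for `μ + μ⁻¹ = 0`. -/
lemma kernel_eq_zero_of_unimodular (ha : ∀ j, j ≠ 1 → j ≠ 2 → a j = c) (hc : c ≠ 0)
    (hμ : ‖μ‖ = 1) (h12 : a 1 ≠ 0 ∨ a 2 ≠ 0)
    (h : ∀ j, a j * v (j + 1) + a (j - 1) * v (j - 1) - c * (μ + μ⁻¹) * v j = 0)
    (hv : Tendsto v cofinite (𝓝 0)) (j : ℤ) : v j = 0 := by
  have hμ0 : μ ≠ 0 := norm_ne_zero_iff.1 (by rw [hμ]; exact one_ne_zero)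
  obtain ⟨-, -, h3, h1⟩ := kernel_relations ha hc hμ0 hμ.le h hv
  refine kernel_eq_zero ha hc hμ0 hμ.le h hv ?_ j
  have e3 : v 3 = 0 := right_solution_eq_zero hc hμ (m := 4) (fun j hj => by
      have := h j
      rwa [ha j (by omega) (by omega), ha (j - 1) (by omega) (by omega)] at this) hv (by omega)
  have e1 : v 1 = 0 := left_solution_eq_zero hc hμ (m := 0) (fun j hj => by
      have := h j
      rwa [ha j (by omega) (by omega), ha (j - 1) (by omega) (by omega)] at this) hv (by omega)
  rw [e3, mul_zero, eq_comm] at h3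
  rw [e1, mul_zero, eq_comm] at h1
  rcases h12 with h' | h'
  · simpa [hμ0, h'] using h1
  · simpa [hμ0, h'] using h3

/-- For points of the spectrum of the free Jacobi matrix, suitable finitely supported
inhomogeneities admit no decaying solution. -/
lemma exists_unsolvable_load (ha : ∀ j, j ≠ 1 → j ≠ 2 → a j = c) (hc : c ≠ 0) (hμ : ‖μ‖ = 1) :
    ∃ w₃ w₄ : ℂ, ∀ v : ℤ → ℂ, Tendsto v cofinite (𝓝 0) →
      ¬ ∀ j, a j * v (j + 1) + a (j - 1) * v (j - 1) - c * (μ + μ⁻¹) * v j =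
        if j = 3 then w₃ else if j = 4 then w₄ else 0 := by
  set ξ := c * (μ + μ⁻¹) with hξ
  -- The rows at 3 and 2 will become these two equations for `x = v 2`; `Y` is chosen to make them
  -- incompatible. For `ξ ≠ 0` they would force `Y = a 2 ^ 2 / ξ`.
  obtain ⟨Y, hY⟩ : ∃ Y : ℂ, ∀ x : ℂ, a 2 * x = Y → a 2 = ξ * x → False := by
    by_cases h0 : ξ = 0
    · refine ⟨1, fun x hx hx' => ?_⟩
      rw [h0, zero_mul] at hx'
      rw [hx', zero_mul] at hx
      exact zero_ne_one hx
    · refine ⟨(a 2 ^ 2 + 1) / ξ, fun x hx hx' => ?_⟩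
      rw [eq_div_iff h0] at hx
      have : (1 : ℂ) = 0 := by linear_combination -hx - a 2 * hx'
      exact one_ne_zero this
  -- The load `c` at vertex 4 forces `v 3 = 1`, because everything from vertex 4 on vanishes.
  refine ⟨Y - ξ, c, fun v hv h => ?_⟩
  have hr : ∀ j, 4 ≤ j → v j = 0 := fun j hj =>
    right_solution_eq_zero hc hμ (m := 5) (fun j hj => by
      have := h j
      rwa [ha j (by omega) (by omega), ha (j - 1) (by omega) (by omega), if_neg (by omega),
        if_neg (by omega)] at this) hv (by omega)
  have hl : v 1 = 0 := left_solution_eq_zero hc hμ (m := 0) (fun j hj => by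
      have := h j
      rwa [ha j (by omega) (by omega), ha (j - 1) (by omega) (by omega), if_neg (by omega),
        if_neg (by omega)] at this) hv (by omega)
  have e4 := h 4
  rw [hr (4 + 1) (by norm_num), hr 4 le_rfl, ha (4 - 1) (by norm_num) (by norm_num)] at e4
  norm_num at e4
  have v3 : v 3 = 1 := mul_left_cancel₀ hc (by rw [e4, mul_one])
  have e3 := h 3
  rw [hr (3 + 1) (by norm_num)] at e3
  norm_num at e3
  rw [v3] at e3
  have e2 := h 2
  norm_num at e2
  rw [v3, hl] at e2
  exact hY (v 2) (by linear_combination e3) (by linear_combination e2)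

/-- The exponentially decaying solution of the homogeneous equation. -/
lemma exists_kernel (ha : ∀ j, j ≠ 1 → j ≠ 2 → a j = c) (hμ0 : μ ≠ 0) (hμ : ‖μ‖ < 1)
    (hdet : μ ^ 2 * (a 1 ^ 2 + a 2 ^ 2 - c ^ 2) = c ^ 2) :
    ∃ V : VertexSpace, V 2 = c ∧
      ∀ j, a j * V (j + 1) + a (j - 1) * V (j - 1) - c * (μ + μ⁻¹) * V j = 0 := by
  -- The amplitudes come from `c * v 3 = μ * a 2 * v 2` and `c * v 1 = μ * a 1 * v 2` with the
  -- normalization `v 2 = c`.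
  set C : ℤ → ℂ := fun j => if j = 2 then c else if 2 < j then a 2 else a 1 with hC
  set v : ℤ → ℂ := fun j => C j * μ ^ (j - 2).natAbs with hv
  have h0 : μ * μ⁻¹ = 1 := mul_inv_cancel₀ hμ0
  have hs : Summable fun j : ℤ => (‖μ‖ ^ 2) ^ j.natAbs := by
    have h1 : Summable fun n : ℕ => (‖μ‖ ^ 2) ^ n :=
      summable_geometric_of_lt_one (by positivity) (by nlinarith [norm_nonneg μ])
    refine Summable.of_nat_of_neg ?_ ?_
    · simpa using h1
    · simpa using h1
  have hm : Memℓp (E := fun _ : ℤ => ℂ) v 2 := by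
    refine memℓp_two_of_summable ?_
    have hs' := ((Equiv.subRight (2 : ℤ)).summable_iff.2 hs).mul_left
      ((‖c‖ + ‖a 1‖ + ‖a 2‖) ^ 2)
    refine hs'.of_nonneg_of_le (fun _ => sq_nonneg _) fun j => ?_
    simp only [hv, norm_mul, norm_pow, mul_pow, Function.comp_apply, Equiv.subRight_apply]
    rw [← pow_mul, ← pow_mul, mul_comm 2]
    refine mul_le_mul_of_nonneg_right ?_ (by positivity)
    refine pow_le_pow_left₀ (norm_nonneg _) ?_ 2
    have := norm_nonneg c
    have := norm_nonneg (a 1)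
    have := norm_nonneg (a 2)
    simp only [hC]
    split_ifs <;> linarith
  refine ⟨⟨v, hm⟩, ?_, fun j => ?_⟩
  · show v 2 = c
    simp [hv, hC]
  · show a j * v (j + 1) + a (j - 1) * v (j - 1) - c * (μ + μ⁻¹) * v j = 0
    have hR : ∀ n : ℕ, v (3 + n) = a 2 * μ ^ (n + 1) := fun n => by
      simp only [hv, hC]
      rw [if_neg (by omega), if_pos (by omega)]
      congr 2; omega
    have hL : ∀ n : ℕ, v (1 - n) = a 1 * μ ^ (n + 1) := fun n => by
      simp only [hv, hC]
      rw [if_neg (by omega), if_neg (by omega)]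
      congr 2; omega
    have h2 : v 2 = c := by simp [hv, hC]
    have h3 : v 3 = a 2 * μ := by simpa using hR 0
    have h1 : v 1 = a 1 * μ := by simpa using hL 0
    by_cases j2 : j = 2
    · subst j2
      norm_num
      rw [h3, h1, h2]
      linear_combination (μ⁻¹) * hdet - (a 1 ^ 2 * μ + a 2 ^ 2 * μ - c ^ 2 * μ) * h0
    by_cases j3 : j = 3
    · subst j3
      norm_num
      rw [ha 3 (by norm_num) (by norm_num), h3, h2, show v 4 = a 2 * μ ^ 2 from hR 1]
      linear_combination -c * a 2 * h0
    by_cases j1 : j = 1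
    · subst j1
      norm_num
      rw [ha 0 (by norm_num) (by norm_num), h1, h2, show v 0 = a 1 * μ ^ 2 from hL 1]
      linear_combination -c * a 1 * h0
    rw [ha j j1 j2, ha (j - 1) (by omega) (by omega)]
    rcases lt_or_gt_of_ne j2 with hj | hj
    · obtain ⟨n, rfl⟩ : ∃ n : ℕ, j = 1 - ((n + 1 : ℕ) : ℤ) := ⟨(-j).toNat, by omega⟩
      rw [hL, show (1 - ((n + 1 : ℕ) : ℤ)) + 1 = 1 - (n : ℕ) by push_cast; ring,
        show (1 - ((n + 1 : ℕ) : ℤ)) - 1 = 1 - ((n + 2 : ℕ) : ℤ) by push_cast; ring, hL, hL]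
      linear_combination -c * a 1 * μ ^ (n + 1) * h0
    · obtain ⟨n, rfl⟩ : ∃ n : ℕ, j = 3 + ((n + 1 : ℕ) : ℤ) := ⟨(j - 4).toNat, by omega⟩
      rw [hR, show (3 + ((n + 1 : ℕ) : ℤ)) + 1 = 3 + ((n + 2 : ℕ) : ℤ) by push_cast; ring,
        show (3 + ((n + 1 : ℕ) : ℤ)) - 1 = 3 + (n : ℕ) by push_cast; ring, hR, hR]
      linear_combination -c * a 2 * μ ^ (n + 1) * h0

end Kernel

/-! ### Resolvent set and eigenvalues of the chain Hamiltonian -/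

section Operator

variable {α : ℝ} {A : ℤ → ℝ} {z : ℂ}

lemma isImage_apply (u : (hamiltonian α A).domain) : IsImage α A u (hamiltonian α A u) :=
  (mem_graph_hamiltonian_iff α A _ _).1 (LinearPMap.mem_graph _ u)

lemma exists_of_isImage {u k : L2Chain} (h : IsImage α A u k) :
    ∃ hu : u ∈ (hamiltonian α A).domain, hamiltonian α A ⟨u, hu⟩ = k := by
  obtain ⟨y, hy, hk⟩ := (LinearPMap.mem_graph_iff _).1 ((mem_graph_hamiltonian_iff α A u k).2 h)
  simp only at hy hk
  subst hy
  exact ⟨y.2, hk⟩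

lemma mem_eigenspace_iff (u : (hamiltonian α A).domain) :
    u ∈ eigenspace (hamiltonian α A) z ↔ IsImage α A u (z • (u : L2Chain)) := by
  have h1 : u ∈ eigenspace (hamiltonian α A) z ↔ hamiltonian α A u = z • (u : L2Chain) := by
    rw [eigenspace, LinearMap.mem_ker, LinearMap.sub_apply, sub_eq_zero]
    rfl
  rw [h1]
  constructor
  · intro h
    rw [← h]
    exact isImage_apply u
  · intro h
    obtain ⟨_, hk⟩ := exists_of_isImage h
    exact hk

lemma isEigenvalue_iff : IsEigenvalue (hamiltonian α A) z ↔
    ∃ u : L2Chain, u ≠ 0 ∧ IsImage α A u (z • u) := by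
  rw [IsEigenvalue, Submodule.ne_bot_iff]
  constructor
  · rintro ⟨u, hu, hu0⟩
    exact ⟨u, fun h => hu0 (Subtype.ext h), (mem_eigenspace_iff u).1 hu⟩
  · rintro ⟨u, hu0, hu⟩
    obtain ⟨hd, -⟩ := exists_of_isImage hu
    exact ⟨⟨u, hd⟩, (mem_eigenspace_iff _).2 hu, fun h => hu0 (congrArg Subtype.val h)⟩

lemma exists_isImage_of_mem_resolventSet (h : z ∈ resolventSet (hamiltonian α A)) (f : L2Chain) :
    ∃ u, IsImage α A u (f + z • u) := by
  obtain ⟨R, h1, -⟩ := h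
  obtain ⟨hd, he⟩ := h1 f
  refine ⟨R f, ?_⟩
  have := isImage_apply ⟨R f, hd⟩
  rwa [sub_eq_iff_eq_add.1 he] at this

lemma mem_spectrum_of_isEigenvalue (h : IsEigenvalue (hamiltonian α A) z) :
    z ∈ spectrum (hamiltonian α A) := by
  rintro ⟨R, -, h2⟩
  obtain ⟨u, hu0, hu⟩ := isEigenvalue_iff.1 h
  obtain ⟨hd, he⟩ := exists_of_isImage hu
  have := h2 ⟨u, hd⟩
  rw [he, sub_self, map_zero] at this
  exact hu0 this.symm

/-- Absence of eigenvectors makes the solution unique; the graph being a subspace, the solution map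
is then linear, and the bound makes it a resolvent. -/
lemma mem_resolventSet_of_bounded {K : ℝ}
    (hs : ∀ f, ∃ u, IsImage α A u (f + z • u) ∧ ‖u‖ ≤ K * ‖f‖)
    (hi : ¬ IsEigenvalue (hamiltonian α A) z) : z ∈ resolventSet (hamiltonian α A) := by
  choose R hR hn using hs
  have huniq : ∀ f u, IsImage α A u (f + z • u) → u = R f := by
    intro f u hu
    by_contra hne
    refine hi (isEigenvalue_iff.2 ⟨u - R f, sub_ne_zero.2 hne, ?_⟩)
    have : (u - R f, z • (u - R f)) ∈ hamiltonianGraph α A := by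
      have h1 : (u, f + z • u) ∈ hamiltonianGraph α A := hu
      have h2 : (R f, f + z • R f) ∈ hamiltonianGraph α A := hR f
      have := Submodule.sub_mem _ h1 h2
      rw [Prod.mk_sub_mk] at this
      convert this using 2
      rw [smul_sub]; abel
    exact this
  have hadd : ∀ f k, R (f + k) = R f + R k := fun f k => (huniq _ _ (by
    have h1 : (R f, f + z • R f) ∈ hamiltonianGraph α A := hR f
    have h2 : (R k, k + z • R k) ∈ hamiltonianGraph α A := hR k
    have h3 : (R f + R k, f + k + z • (R f + R k)) ∈ hamiltonianGraph α A := by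
      have := Submodule.add_mem _ h1 h2
      rw [Prod.mk_add_mk] at this
      convert this using 2
      rw [smul_add]; abel
    exact h3)).symm
  have hsmul : ∀ (w : ℂ) f, R (w • f) = w • R f := fun w f => (huniq _ _ (by
    have h1 : (R f, f + z • R f) ∈ hamiltonianGraph α A := hR f
    have h3 : (w • R f, w • f + z • (w • R f)) ∈ hamiltonianGraph α A := by
      have := Submodule.smul_mem _ w h1
      rw [Prod.smul_mk] at this
      convert this using 2
      rw [smul_add, smul_comm]
    exact h3)).symm
  let L : L2Chain →ₗ[ℂ] L2Chain := { toFun := R, map_add' := hadd, map_smul' := hsmul }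
  refine ⟨L.mkContinuous K hn, fun f => ?_, fun u => ?_⟩
  · obtain ⟨hd, he⟩ := exists_of_isImage (hR f)
    refine ⟨hd, ?_⟩
    show hamiltonian α A ⟨R f, hd⟩ - z • R f = f
    rw [he, add_sub_cancel_right]
  · refine (huniq _ _ ?_).symm
    rw [sub_add_cancel]
    exact isImage_apply u

end Operator

/-! ### The homogeneous equation -/

lemma integral_zero_mul {ψ : ℝ → ℂ} (h : Continuous ψ) {x : ℝ} (hx : x ∈ Icc 0 Real.pi) :
    ∫ t in (0 : ℝ)..x, (0 : Lp ℂ 2 edgeMeasure) t * ψ t = 0 := by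
  obtain ⟨M, -, hM⟩ := exists_bound_Icc h
  have := norm_integral_mul_le 0 hM hx
  rw [norm_zero, mul_zero] at this
  exact norm_le_zero_iff.1 this

lemma startLoad_zero (a : ℝ) (z : ℂ) : startLoad a z (0 : Lp ℂ 2 edgeMeasure) = 0 := by
  have := continuous_gauge a
  have := continuous_sinSol z
  exact integral_zero_mul (by fun_prop) (right_mem_Icc.2 Real.pi_pos.le)

lemma endLoad_zero (a : ℝ) (z : ℂ) : endLoad a z (0 : Lp ℂ 2 edgeMeasure) = 0 := by
  have := continuous_gauge a
  have := continuous_sinSol z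
  exact integral_zero_mul (by fun_prop) (right_mem_Icc.2 Real.pi_pos.le)

lemma vertexLoad_zero (A : ℤ → ℝ) (z : ℂ) (j : ℤ) : vertexLoad A z 0 j = 0 := by
  have h : ∀ e : Edge, (0 : L2Chain) e = (0 : Lp ℂ 2 edgeMeasure) := fun _ => rfl
  rw [vertexLoad, h, h, h, h, startLoad_zero, startLoad_zero, endLoad_zero, endLoad_zero]
  simp

section Homogeneous

variable {α : ℝ} {A : ℤ → ℝ} {z : ℂ} {u : L2Chain} {g g' g'' : Edge → ℝ → ℂ}

lemma isImage_smul_iff : IsImage α A u (z • u) ↔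
    ∃ g g' g'', IsSolution α A z 0 g g' g'' ∧ ∀ e, u e =ᵐ[edgeMeasure] g e := by
  rw [← isImage_add_smul_iff, zero_add]

lemma IsSolution.gauge_mul_eq (h : IsSolution α A z 0 g g' g'') (e : Edge) {x : ℝ}
    (hx : x ∈ Icc 0 Real.pi) : gauge (potential A e) x * g e x = g e 0 * cosSol z x +
      quasiDeriv (potential A e) (g e) (g' e) 0 * sinSol z x := by
  have := (h.sobolev e).eq_representation (h.eq e) hx
  have c1 := continuous_gauge (potential A e)
  have c2 := continuous_sinSol z
  rw [this]
  have : ∫ t in (0 : ℝ)..x, (0 : L2Chain) e t * (gauge (potential A e) t * sinSol z (x - t)) = 0 :=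
    integral_zero_mul (by fun_prop) hx
  rw [this, sub_zero]

/-- With both end values zero and `sinPi z ≠ 0` the initial slope vanishes too, so nothing is left
on any semicircle. -/
lemma IsSolution.eq_zero (h : IsSolution α A z 0 g g' g'') (hu : ∀ e, u e =ᵐ[edgeMeasure] g e)
    (hz : sinPi z ≠ 0) (h0 : ∀ j, g (j, true) 0 = 0) : u = 0 := by
  ext1
  funext e
  apply Lp.ext
  refine (hu e).trans (EventuallyEq.trans ?_ (Lp.coeFn_zero ℂ 2 edgeMeasure).symm)
  obtain ⟨j, b⟩ := e
  have hs : g (j, b) 0 = 0 := by rw [h.start_eq, h0]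
  have hd : quasiDeriv (potential A (j, b)) (g (j, b)) (g' (j, b)) 0 = 0 := by
    have e1 := h.gauge_mul_eq (j, b) (right_mem_Icc.2 Real.pi_pos.le)
    rw [h.end_eq, h0, hs, mul_zero, zero_mul, zero_add, eq_comm] at e1
    exact (mul_eq_zero.1 e1).resolve_right hz
  filter_upwards [ae_restrict_mem measurableSet_Ioo] with x hx
  have e2 := h.gauge_mul_eq (j, b) (Ioo_subset_Icc_self hx)
  rw [hs, hd, zero_mul, zero_mul, zero_add] at e2
  exact (mul_eq_zero.1 e2).resolve_left (gauge_ne_zero _ _)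

lemma IsSolution.homogeneous (h : IsSolution α A z 0 g g' g'') (j : ℤ) :
    coeff A j * g (j + 1, true) 0 + coeff A (j - 1) * g (j - 1, true) 0 -
      discr α z * g (j, true) 0 = 0 := by
  rw [h.recursion, vertexLoad_zero]

end Homogeneous

/-! ### Perturbation of two rings: points off the Dirichlet spectrum -/

section Perturbed

variable {α : ℝ} {A : ℤ → ℝ} {z c μ : ℂ}

/-- A point whose discriminant is off the spectrum of the Jacobi matrix is in the resolvent set. -/
lemma mem_resolventSet_or_determinant (ha : ∀ j, j ≠ 1 → j ≠ 2 → coeff A j = c) (hc : c ≠ 0)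
    (hz : sinPi z ≠ 0) (hμ0 : μ ≠ 0) (hμ : ‖μ‖ < 1) (hd : discr α z = c * (μ + μ⁻¹)) :
    z ∈ resolventSet (hamiltonian α A) ∨
      μ ^ 2 * (coeff A 1 ^ 2 + coeff A 2 ^ 2 - c ^ 2) = c ^ 2 := by
  by_contra! hcon
  obtain ⟨hcon1, hcon2⟩ := hcon
  obtain ⟨K1, hK1, hsolve⟩ := exists_isSolution (α := α) (A := A) hz
  obtain ⟨K2, hK2, hload⟩ := exists_vertexLoad A z
  -- A null vector nonzero at vertex 2 would yield the determinant condition, which is excluded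
  -- here.
  obtain ⟨K3, hK3, hjac⟩ := exists_jacobi_solution ha hc hμ0 hμ fun V hV => by
    have hVt : Tendsto (fun j => V j) cofinite (𝓝 0) := by
      have := (summable_norm_sq V).tendsto_cofinite_zero
      have h2 := (Real.continuous_sqrt.tendsto 0).comp this
      rw [tendsto_zero_iff_norm_tendsto_zero]
      simpa [Function.comp_def, Real.sqrt_sq] using h2
    refine lp.ext (funext fun j => ?_)
    refine kernel_eq_zero ha hc hμ0 hμ.le hV hVt ?_ j
    by_contra h2
    exact hcon2 (kernel_determinant ha hc hμ0 hμ.le hV hVt h2)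
  refine hcon1 (mem_resolventSet_of_bounded (K := K1 * (K3 * K2 + 1)) (fun f => ?_) fun hev => ?_)
  · obtain ⟨W, hW, nW⟩ := hload f
    obtain ⟨V, hV, nV⟩ := hjac W
    obtain ⟨g, g', g'', u, hg, hu, -, nu⟩ := hsolve f V fun j => by rw [hd, hV, hW]
    refine ⟨u, isImage_add_smul_iff.2 ⟨g, g', g'', hg, hu⟩, nu.trans ?_⟩
    have : ‖V‖ ≤ K3 * (K2 * ‖f‖) := nV.trans (mul_le_mul_of_nonneg_left nW hK3)
    calc K1 * (‖V‖ + ‖f‖) ≤ K1 * (K3 * (K2 * ‖f‖) + ‖f‖) :=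
          mul_le_mul_of_nonneg_left (by linarith) hK1
      _ = _ := by ring
  · obtain ⟨u, hu0, hu⟩ := isEigenvalue_iff.1 hev
    obtain ⟨g, g', g'', hg, hu⟩ := isImage_smul_iff.1 hu
    have hv := hg.tendsto_start hu
    have hr := hg.homogeneous
    rw [hd] at hr
    refine hu0 (hg.eq_zero hu hz fun j => ?_)
    refine kernel_eq_zero (v := fun j => g (j, true) 0) ha hc hμ0 hμ.le hr hv ?_ j
    by_contra h2
    exact hcon2 (kernel_determinant (v := fun j => g (j, true) 0) ha hc hμ0 hμ.le hr hv h2)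

lemma determinant_of_isEigenvalue (ha : ∀ j, j ≠ 1 → j ≠ 2 → coeff A j = c) (hc : c ≠ 0)
    (hz : sinPi z ≠ 0) (hμ0 : μ ≠ 0) (hμ : ‖μ‖ ≤ 1) (hd : discr α z = c * (μ + μ⁻¹))
    (h : IsEigenvalue (hamiltonian α A) z) :
    μ ^ 2 * (coeff A 1 ^ 2 + coeff A 2 ^ 2 - c ^ 2) = c ^ 2 := by
  obtain ⟨u, hu0, hu⟩ := isEigenvalue_iff.1 h
  obtain ⟨g, g', g'', hg, hu⟩ := isImage_smul_iff.1 hu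
  have hv := hg.tendsto_start hu
  have hr := hg.homogeneous
  rw [hd] at hr
  refine kernel_determinant (v := fun j => g (j, true) 0) ha hc hμ0 hμ hr hv fun h2 => ?_
  exact hu0 (hg.eq_zero hu hz fun j =>
    kernel_eq_zero (v := fun j => g (j, true) 0) ha hc hμ0 hμ hr hv h2 j)

/-- No eigenvalue lies in a band away from the Dirichlet eigenvalues; this keeps the bands out of
the discrete spectrum. -/
lemma not_isEigenvalue_of_unimodular (ha : ∀ j, j ≠ 1 → j ≠ 2 → coeff A j = c) (hc : c ≠ 0)
    (h12 : coeff A 1 ≠ 0 ∨ coeff A 2 ≠ 0)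
    (hz : sinPi z ≠ 0) (hμ : ‖μ‖ = 1) (hd : discr α z = c * (μ + μ⁻¹)) :
    ¬ IsEigenvalue (hamiltonian α A) z := by
  intro h
  obtain ⟨u, hu0, hu⟩ := isEigenvalue_iff.1 h
  obtain ⟨g, g', g'', hg, hu⟩ := isImage_smul_iff.1 hu
  have hr := hg.homogeneous
  rw [hd] at hr
  exact hu0 (hg.eq_zero hu hz fun j => kernel_eq_zero_of_unimodular
    (v := fun j => g (j, true) 0) ha hc hμ h12 hr (hg.tendsto_start hu) j)

/-- The geometric null vector extends to an eigenfunction with value `c` at vertex 2. Subtracting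
the right multiple of it from any other eigenfunction removes the value at vertex 2, and then
nothing remains. -/
lemma isSimpleEigenvalue_of_determinant (ha : ∀ j, j ≠ 1 → j ≠ 2 → coeff A j = c) (hc : c ≠ 0)
    (hz : sinPi z ≠ 0) (hμ0 : μ ≠ 0) (hμ : ‖μ‖ < 1) (hd : discr α z = c * (μ + μ⁻¹))
    (hdet : μ ^ 2 * (coeff A 1 ^ 2 + coeff A 2 ^ 2 - c ^ 2) = c ^ 2) :
    IsSimpleEigenvalue (hamiltonian α A) z := by
  obtain ⟨V, hV2, hV⟩ := exists_kernel ha hμ0 hμ hdet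
  obtain ⟨K, -, hK⟩ := exists_isSolution (α := α) (A := A) hz
  obtain ⟨g, g', g'', u, hg, hu, hgV, -⟩ := hK 0 V fun j => by rw [hd, hV, vertexLoad_zero]
  have hsol : IsImage α A u (z • u) := isImage_smul_iff.2 ⟨g, g', g'', hg, hu⟩
  obtain ⟨hdom, -⟩ := exists_of_isImage hsol
  have zmem : (0 : ℝ) ∈ Icc 0 Real.pi := left_mem_Icc.2 Real.pi_pos.le
  set U : eigenspace (hamiltonian α A) z := ⟨⟨u, hdom⟩, (mem_eigenspace_iff _).2 hsol⟩ with hU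
  have hu0 : u ≠ 0 := by
    rintro rfl
    have h1 : g (2, true) =ᵐ[edgeMeasure] 0 :=
      (hu (2, true)).symm.trans (Lp.coeFn_zero ℂ 2 edgeMeasure)
    have h2 := eqOn_zero_of_ae_eq_zero (hg.sobolev _).continuousOn h1 0 zmem
    rw [hgV, hV2] at h2
    exact hc h2
  have hU0 : U ≠ 0 := fun h => hu0 (congrArg (fun y => ((y : eigenspace _ z).1 : L2Chain)) h)
  refine (finrank_eq_one_iff_of_nonzero' U hU0).2 fun X => ?_
  obtain ⟨k, k', k'', hk, hX⟩ := isImage_smul_iff.1 ((mem_eigenspace_iff X.1).1 X.2)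
  set t := k (2, true) 0 / c with ht
  refine ⟨t, ?_⟩
  rw [eq_comm, ← sub_eq_zero]
  set D := X - t • U with hD
  obtain ⟨l, l', l'', hl, hDl⟩ := isImage_smul_iff.1 ((mem_eigenspace_iff D.1).1 D.2)
  -- The representative `l` of the difference agrees almost everywhere with the difference of the
  -- representatives; continuity transfers this to the endpoint.
  have hl2 : l (2, true) 0 = 0 := by
    have h1 : (fun x => l (2, true) x - (k (2, true) x - t * g (2, true) x)) =ᵐ[edgeMeasure] 0 := by
      have e1 : (((D.1 : (hamiltonian α A).domain) : L2Chain) (2, true) : ℝ → ℂ) =ᵐ[edgeMeasure]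
          fun x => ((X.1 : (hamiltonian α A).domain) : L2Chain) (2, true) x -
            t * u (2, true) x := by
        have e2 : ((D.1 : (hamiltonian α A).domain) : L2Chain) (2, true) =
            ((X.1 : (hamiltonian α A).domain) : L2Chain) (2, true) - t • u (2, true) := rfl
        rw [e2]
        filter_upwards [Lp.coeFn_sub (((X.1 : (hamiltonian α A).domain) : L2Chain) (2, true))
          (t • u (2, true)), Lp.coeFn_smul t (u (2, true))] with x h1 h2
        rw [h1, Pi.sub_apply, h2, Pi.smul_apply, smul_eq_mul]
      filter_upwards [e1, hDl (2, true), hX (2, true), hu (2, true)] with x h1 h2 h3 h4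
      rw [← h2, h1, h3, h4, sub_self]
      rfl
    have h2 := eqOn_zero_of_ae_eq_zero (by
      have := (hl.sobolev (2, true)).continuousOn
      have := (hk.sobolev (2, true)).continuousOn
      have := (hg.sobolev (2, true)).continuousOn
      fun_prop) h1 0 zmem
    rw [hgV, hV2, ht, div_mul_cancel₀ _ hc, sub_self, sub_zero] at h2
    exact h2
  have hr := hl.homogeneous
  rw [hd] at hr
  have := hl.eq_zero hDl hz fun j => kernel_eq_zero (v := fun j => l (j, true) 0) ha hc hμ0 hμ.le hr
    (hl.tendsto_start hDl) hl2 j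
  exact Subtype.ext (Subtype.ext this)

/-! ### Prescribed vertex loads -/

/-- The load is the image under the expression minus `z` of a cubic vanishing at both ends with
slopes `P` and `Q`; the identities for the end quasiderivatives then read off the two pairings. -/
lemma exists_edge_load (hz : sinPi z ≠ 0) (a : ℝ) (p q : ℂ) : ∃ F : Lp ℂ 2 edgeMeasure,
    startLoad a z F = p ∧ gauge (-a) Real.pi * endLoad a z F = q := by
  set P := p / sinPi z with hP
  set Q := -q / sinPi z with hQ
  have hpi : (Real.pi : ℂ) ≠ 0 := Complex.ofReal_ne_zero.2 Real.pi_pos.ne'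
  set π' : ℂ := (Real.pi : ℂ) with hπ'
  set G : ℂ → ℂ := fun x => (P * (x * (π' - x) ^ 2) + Q * (x ^ 2 * (x - π'))) / π' ^ 2 with hG
  set G' : ℂ → ℂ := fun x => (P * ((π' - x) * (π' - 3 * x)) + Q * (3 * x ^ 2 - 2 * π' * x)) / π' ^ 2
    with hG'
  set G'' : ℂ → ℂ := fun x => (P * (6 * x - 4 * π') + Q * (6 * x - 2 * π')) / π' ^ 2 with hG''
  have d1 : ∀ x, HasDerivAt G (G' x) x := fun x => by
    have h1 := ((hasDerivAt_id x).mul (((hasDerivAt_id x).const_sub π').pow 2)).const_mul P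
    have h2 := (((hasDerivAt_id x).pow 2).mul ((hasDerivAt_id x).sub_const π')).const_mul Q
    refine ((h1.add h2).div_const (π' ^ 2)).congr_deriv ?_
    simp [hG']
    ring
  have d2 : ∀ x, HasDerivAt G' (G'' x) x := fun x => by
    have h1 := (((hasDerivAt_id x).const_sub π').mul
      (((hasDerivAt_id x).const_mul 3).const_sub π')).const_mul P
    have h2 := ((((hasDerivAt_id x).pow 2).const_mul 3).sub
      ((hasDerivAt_id x).const_mul (2 * π'))).const_mul Q
    refine ((h1.add h2).div_const (π' ^ 2)).congr_deriv ?_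
    simp [hG'']
    ring
  have c0 : Continuous fun x : ℝ => G x := by fun_prop
  have c1 : Continuous fun x : ℝ => G' x := by fun_prop
  have c2 : Continuous fun x : ℝ => G'' x := by fun_prop
  have hs : IsSobolev2 (fun x => G x) (fun x => G' x) (fun x => G'' x) :=
    ⟨memLp_of_continuousOn c2.continuousOn,
      (IsPrimitive.of_hasDerivAt (fun x => (d2 x).comp_ofReal) c2).eq_integral,
      (IsPrimitive.of_hasDerivAt (fun x => (d1 x).comp_ofReal) c1).eq_integral⟩
  have hm : MemLp (fun x => magneticExpr a (fun x => G x) (fun x => G' x) (fun x => G'' x) x -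
      z * G x) 2 edgeMeasure := by
    refine memLp_of_continuousOn (Continuous.continuousOn ?_)
    unfold magneticExpr
    fun_prop
  have e0 : G ((0 : ℝ) : ℂ) = 0 := by simp [hG]
  have e1 : G (Real.pi : ℂ) = 0 := by simp [hG, hπ']
  have e2 : G' ((0 : ℝ) : ℂ) = P := by simp [hG']; field_simp
  have e3 : G' (Real.pi : ℂ) = Q := by simp [hG', ← hπ']; field_simp; ring
  refine ⟨hm.toLp _, ?_, ?_⟩
  · have := hs.quasiDeriv_start (a := a) (z := z) hm.coeFn_toLp
    simp only [quasiDeriv, e0, e1, e2] at this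
    rw [hP] at this
    linear_combination -this + div_mul_cancel₀ p hz
  · have := hs.quasiDeriv_end (a := a) (z := z) hm.coeFn_toLp
    simp only [quasiDeriv, e0, e1, e3] at this
    rw [hQ] at this
    linear_combination this - div_mul_cancel₀ (-q) hz

/-- A function living on one semicircle loads only the two vertices at its ends. The factors `-2`
undo the `-1 / 2` in `vertexLoad`. -/
lemma exists_vertexLoad_eq (hz : sinPi z ≠ 0) (A : ℤ → ℝ) (n : ℤ) (p q : ℂ) :
    ∃ f : L2Chain, ∀ j, vertexLoad A z f j = if j = n then p else if j = n + 1 then q else 0 := by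
  obtain ⟨F, h1, h2⟩ := exists_edge_load hz (potential A (n, true)) (-2 * p) (-2 * q)
  refine ⟨lp.single 2 ((n, true) : Edge) F, fun j => ?_⟩
  set f : L2Chain := lp.single 2 ((n, true) : Edge) F with hf
  have hself : f (n, true) = F := lp.single_apply_self _ _ _
  have hne : ∀ e, e ≠ (n, true) → f e = 0 := fun e he => lp.single_apply_ne _ _ _ he
  have hfalse : ∀ j, f (j, false) = 0 := fun j => hne _ (by simp)
  rw [vertexLoad, hfalse, hfalse, startLoad_zero, endLoad_zero]
  by_cases hj : j = n
  · subst hj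
    rw [hself, h1, hne (j - 1, true) (by simp), endLoad_zero, if_pos rfl]
    ring
  rw [if_neg hj, hne (j, true) (by simpa using hj), startLoad_zero]
  by_cases hj' : j = n + 1
  · subst hj'
    rw [if_pos rfl, add_sub_cancel_right, hself, h2]
    ring
  · rw [if_neg hj', hne (j - 1, true) (by simp; omega), endLoad_zero]
    ring

/-- The operator minus `z` is not onto: a load at vertices 3 and 4, produced on ring 3, would need
decaying vertex values that cannot exist. -/
lemma mem_spectrum_of_unimodular (ha : ∀ j, j ≠ 1 → j ≠ 2 → coeff A j = c) (hc : c ≠ 0)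
    (hz : sinPi z ≠ 0) (hμ : ‖μ‖ = 1) (hd : discr α z = c * (μ + μ⁻¹)) :
    z ∈ spectrum (hamiltonian α A) := by
  intro hres
  obtain ⟨w₃, w₄, hw⟩ := exists_unsolvable_load ha hc hμ
  obtain ⟨f, hf⟩ := exists_vertexLoad_eq hz A 3 w₃ w₄
  obtain ⟨u, hu⟩ := exists_isImage_of_mem_resolventSet hres f
  obtain ⟨g, g', g'', hg, hug⟩ := isImage_add_smul_iff.1 hu
  refine hw (fun j => g (j, true) 0) (hg.tendsto_start hug) fun j => ?_
  rw [← hd, hg.recursion, hf]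
  norm_num

end Perturbed

/-! ### Dirichlet eigenvalues of the semicircles -/

section Dirichlet

variable {α : ℝ} {A : ℤ → ℝ} {z : ℂ}

/-- Vanishing on the interval would make the derivative `cosSol` vanish too, against `cosSol² + z
sinSol² = 1`. -/
lemma exists_sinSol_ne_zero (z : ℂ) : ∃ x ∈ Icc 0 Real.pi, sinSol z x ≠ 0 := by
  by_contra! h
  have hx : Real.pi / 2 ∈ Ioo 0 Real.pi := ⟨by linarith [Real.pi_pos], by linarith [Real.pi_pos]⟩
  have e : sinSol z =ᶠ[𝓝 (Real.pi / 2)] fun _ => 0 := by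
    filter_upwards [Ioo_mem_nhds hx.1 hx.2] with y hy
    exact h y (Ioo_subset_Icc_self hy)
  have h1 := (hasDerivAt_sinSol z (Real.pi / 2)).unique
    ((hasDerivAt_const _ (0 : ℂ)).congr_of_eventuallyEq e)
  have h2 := cosSol_sq_add z (Real.pi / 2)
  rw [h1, h _ (Ioo_subset_Icc_self hx)] at h2
  norm_num at h2

/-- On two neighbouring rings with the same flux there is an eigenfunction vanishing at all
vertices. -/
lemma exists_loop_state (hz : sinPi z = 0) {n : ℤ} (hA : A (n + 1) = A n) :
    ∃ u : L2Chain, IsImage α A u (z • u) ∧ u (n, true) ≠ 0 ∧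
      ∀ e : Edge, e.1 ≠ n → e.1 ≠ n + 1 → u e = 0 := by
  have hpi : Real.pi ∈ Icc 0 Real.pi := right_mem_Icc.2 Real.pi_pos.le
  set G₁ := gauge (-potential A (n, true)) Real.pi with hG₁
  set G₂ := gauge (-potential A (n, false)) Real.pi with hG₂
  have hG : G₁ * G₂ = 1 := by
    have := gauge_mul_gauge_neg (A n) Real.pi
    simpa [hG₁, hG₂, potential] using this
  have hG₁' : gauge (-potential A (n + 1, true)) Real.pi = G₁ := by simp [hG₁, potential, hA]
  have hG₂' : gauge (-potential A (n + 1, false)) Real.pi = G₂ := by simp [hG₂, potential, hA]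
  have hC : cosPi z ^ 2 = 1 := by simpa [hz] using cosPi_sq_add z
  -- Initial slopes: `1` and `-1` balance at vertex `n`, and those on ring `n + 1` cancel the
  -- outflow at vertex `n + 1`. Balance at `n + 2` then follows from the equality of the two fluxes.
  set p : Edge → ℂ := fun e => if e.1 = n then (if e.2 then 1 else -1) else
    if e.1 = n + 1 then (if e.2 then -cosPi z * G₂ else cosPi z * G₁) else 0 with hp
  choose g g' g'' hg hF h0 hd using fun e : Edge =>
    exists_initial_value_solution (potential A e) z 0 0 (p e)
  have hrep : ∀ e, ∀ x ∈ Icc 0 Real.pi, gauge (potential A e) x * g e x = p e * sinSol z x := by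
    intro e x hx
    have := (hg e).eq_representation (hF e) hx
    have c1 := continuous_gauge (potential A e)
    have c2 := continuous_sinSol z
    rw [integral_zero_mul (by fun_prop) hx, h0, hd] at this
    rw [this]; ring
  have hπ : ∀ e, g e Real.pi = 0 := fun e => by
    have := hrep e _ hpi
    rw [show sinSol z Real.pi = 0 from hz, mul_zero] at this
    exact (mul_eq_zero.1 this).resolve_left (gauge_ne_zero _ _)
  have hdπ : ∀ e, quasiDeriv (potential A e) (g e) (g' e) Real.pi =
      gauge (-potential A e) Real.pi * (cosPi z * p e) := fun e => by
    have c1 := continuous_gauge (potential A e)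
    have c2 := continuous_cosSol z
    have := (hg e).integral_mul_solution (hF e) (hasDerivAt_cosSol z)
      (fun x => ((hasDerivAt_sinSol z x).const_mul (-z))) hpi
    rw [integral_zero_mul (by fun_prop) hpi, hπ, h0, hd, show cosSol z Real.pi = cosPi z from rfl,
      cosSol_zero_right] at this
    linear_combination (gauge (-potential A e) Real.pi * cosPi z) * this -
      quasiDeriv (potential A e) (g e) (g' e) Real.pi *
        (gauge (potential A e) Real.pi * gauge (-potential A e) Real.pi * hC +
          gauge_mul_gauge_neg (potential A e) Real.pi)
  have hm : ∀ e, MemLp (g e) 2 edgeMeasure := fun e => memLp_of_continuousOn (hg e).continuousOn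
  have hzero : ∀ e : Edge, e.1 ≠ n → e.1 ≠ n + 1 → (hm e).toLp (g e) = 0 := by
    intro e h1 h2
    apply Lp.ext
    refine (hm e).coeFn_toLp.trans (EventuallyEq.trans ?_ (Lp.coeFn_zero ℂ 2 edgeMeasure).symm)
    filter_upwards [ae_restrict_mem measurableSet_Ioo] with x hx
    have := hrep e x (Ioo_subset_Icc_self hx)
    rw [show p e = 0 by simp [hp, h1, h2], zero_mul] at this
    exact (mul_eq_zero.1 this).resolve_left (gauge_ne_zero _ _)
  have hmem : Memℓp (E := fun _ : Edge => Lp ℂ 2 edgeMeasure) (fun e => (hm e).toLp (g e)) 2 := by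
    refine Memℓp.of_exponent_ge (memℓp_zero ?_) bot_le
    refine (Set.toFinite (({n, n + 1} : Set ℤ) ×ˢ (Set.univ : Set Bool))).subset fun e he => ?_
    by_contra hcon
    exact he (hzero e (fun h => hcon (by simp [h])) fun h => hcon (by simp [h]))
  refine ⟨⟨_, hmem⟩, isImage_smul_iff.2 ⟨g, g', g'', ⟨hg, fun j => ⟨?_, ?_, ?_, ?_⟩, hF⟩,
    fun e => (hm e).coeFn_toLp⟩, fun hcon => ?_, hzero⟩
  · rw [h0, h0]
  · rw [h0, hπ]
  · rw [h0, hπ]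
  · rw [hd, hd, hdπ, hdπ, h0, mul_zero]
    by_cases j0 : j = n
    · subst j0
      have e1 : j - 1 ≠ j + 1 := by omega
      simp [hp, e1]
    by_cases j1 : j = n + 1
    · subst j1
      rw [add_sub_cancel_right, ← hG₁, ← hG₂]
      simp [hp]
      ring
    by_cases j2 : j = n + 2
    · subst j2
      rw [show n + 2 - 1 = n + 1 by ring, hG₁', hG₂']
      simp [hp]
      ring
    · have e1 : j - 1 ≠ n := by omega
      have e2 : j - 1 ≠ n + 1 := by omega
      simp [hp, j0, j1, e1, e2]
  · have h1 : g (n, true) =ᵐ[edgeMeasure] 0 := by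
      have h2 : (hm (n, true)).toLp (g (n, true)) = 0 := hcon
      exact (hm (n, true)).coeFn_toLp.symm.trans
        (by rw [h2]; exact Lp.coeFn_zero ℂ 2 edgeMeasure)
    have h2 := eqOn_zero_of_ae_eq_zero (hg _).continuousOn h1
    obtain ⟨x, hx, hx'⟩ := exists_sinSol_ne_zero z
    have := hrep (n, true) x hx
    rw [h2 x hx, mul_zero, show p (n, true) = 1 by simp [hp], one_mul] at this
    exact hx' this.symm

lemma isEigenvalue_of_sinPi_eq_zero (hz : sinPi z = 0) {n : ℤ} (hA : A (n + 1) = A n) :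
    IsEigenvalue (hamiltonian α A) z := by
  obtain ⟨u, hu, hu0, -⟩ := exists_loop_state (α := α) hz hA
  exact isEigenvalue_iff.2 ⟨u, fun h => hu0 (by rw [h]; rfl), hu⟩

/-- Dirichlet eigenvalues of the semicircles are eigenvalues of infinite multiplicity. -/
lemma not_finiteDimensional_of_sinPi_eq_zero (hz : sinPi z = 0) (hA : ∀ j, 3 ≤ j → A j = A 3) :
    ¬ FiniteDimensional ℂ (eigenspace (hamiltonian α A) z) := by
  intro hfin
  -- The pairs of rings `2m + 4`, `2m + 5` are disjoint and lie where the field is constant, so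
  -- evaluation on the semicircle `(2m + 4, true)` separates the states.
  choose u hu hu0 hus using fun m : ℕ => exists_loop_state (α := α) (A := A) hz
    (n := 2 * m + 4) (by rw [hA _ (by omega), hA (2 * m + 4) (by omega)])
  have hdom := fun m => (exists_of_isImage (hu m)).1
  let U : ℕ → eigenspace (hamiltonian α A) z := fun m =>
    ⟨⟨u m, hdom m⟩, (mem_eigenspace_iff _).2 (hu m)⟩
  let ev : ℕ → eigenspace (hamiltonian α A) z →ₗ[ℂ] Lp ℂ 2 edgeMeasure := fun m =>
    (lp.evalCLM ℂ (fun _ : Edge => Lp ℂ 2 edgeMeasure) 2 (2 * m + 4, true)).toLinearMap ∘ₗ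
      (hamiltonian α A).domain.subtype ∘ₗ (eigenspace (hamiltonian α A) z).subtype
  have hev : ∀ m k, ev m (U k) = u k (2 * m + 4, true) := fun m k => rfl
  have hli : LinearIndependent ℂ U := by
    rw [linearIndependent_iff']
    intro s w hw i hi
    have h1 := congrArg (ev i) hw
    rw [map_sum, map_zero, Finset.sum_eq_single_of_mem i hi] at h1
    · rw [map_smul, hev] at h1
      exact (smul_eq_zero.1 h1).resolve_right (hu0 i)
    · intro k _ hk
      rw [map_smul, hev, hus k _ (by simpa using (Ne.symm hk)) (by simp only; omega), smul_zero]
  have := hli.finite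
  exact not_finite ℕ

end Dirichlet

/-! ### Level sets of the discriminant -/

lemma discr_one (α : ℝ) : discr α 1 = -2 := by
  have h1 := cosPi_sq 1
  have h2 := mul_sinPi_sq 1
  simp only [one_pow, one_mul, Complex.cos_pi, Complex.sin_pi] at h1 h2
  rw [discr, h1, h2]; ring

lemma discr_four (α : ℝ) : discr α 4 = 2 := by
  have h1 := cosPi_sq 2
  have h2 := mul_sinPi_sq 2
  rw [Complex.cos_two_pi] at h1
  rw [Complex.sin_two_pi] at h2
  norm_num at h1 h2
  rw [discr, h1, h2]; ring

/-- The identity theorem: the entire function `discr α` is not constant, as its values at 1 and 4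
differ. -/
lemma eventually_discr_ne (α : ℝ) (t z : ℂ) : ∀ᶠ w in 𝓝[≠] z, discr α w ≠ t := by
  have hd : Differentiable ℂ fun w => discr α w - t := (differentiable_discr α).sub_const t
  have ha : AnalyticOnNhd ℂ (fun w => discr α w - t) univ := fun w _ => hd.analyticAt w
  rcases (ha z (mem_univ z)).eventually_eq_zero_or_eventually_ne_zero with h | h
  · have h1 := ha.eqOn_zero_of_preconnected_of_eventuallyEq_zero isPreconnected_univ (mem_univ z) h
    have e1 := h1 (mem_univ 1)
    have e2 := h1 (mem_univ 4)
    simp only [discr_one, discr_four, Pi.zero_apply] at e1 e2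
    have : (4 : ℂ) = 0 := by linear_combination e2 - e1
    norm_num at this
  · filter_upwards [h] with w hw hw'
    exact hw (sub_eq_zero.2 hw')

/-- The spectrum of the free Jacobi matrix with coefficient `c`. -/
def band (c : ℂ) : Set ℂ := (fun μ => c * (μ + μ⁻¹)) '' Metric.sphere (0 : ℂ) 1

lemma isClosed_band (c : ℂ) : IsClosed (band c) := by
  refine IsCompact.isClosed ((isCompact_sphere _ _).image_of_continuousOn ?_)
  refine continuousOn_const.mul (continuousOn_id.add (continuousOn_id.inv₀ fun μ hμ h => ?_))
  rw [mem_sphere_zero_iff_norm] at hμ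
  simp only [id_eq] at h
  rw [h, norm_zero] at hμ
  exact zero_ne_one hμ

lemma band_ofReal (c x : ℝ) (hc : c ≠ 0) : (x : ℂ) ∈ band c ↔ |x| ≤ 2 * |c| := by
  have hc' : (c : ℂ) ≠ 0 := Complex.ofReal_ne_zero.2 hc
  constructor
  · rintro ⟨μ, hμ, h⟩
    rw [mem_sphere_zero_iff_norm] at hμ
    have h1 := congrArg norm h
    simp only at h1
    rw [Complex.norm_real, Real.norm_eq_abs, norm_mul, Complex.norm_real, Real.norm_eq_abs] at h1
    rw [← h1, mul_comm]
    refine mul_le_mul_of_nonneg_right ?_ (abs_nonneg c)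
    refine (norm_add_le _ _).trans ?_
    rw [norm_inv, hμ]; norm_num
  · intro h
    set s := x / (2 * c) with hs
    have hs1 : s ^ 2 ≤ 1 := by
      rw [sq_le_one_iff_abs_le_one, hs, abs_div, abs_mul, abs_two]
      exact div_le_one_of_le₀ h (by positivity)
    -- On the unit circle `μ + μ⁻¹ = 2 Re μ`, so the real part has to be `x / (2 c)`.
    set μ : ℂ := ⟨s, Real.sqrt (1 - s ^ 2)⟩ with hμ
    have hn : ‖μ‖ = 1 := by
      rw [Complex.norm_def, Complex.normSq_mk, Real.mul_self_sqrt (by linarith)]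
      simp [← sq]
    refine ⟨μ, mem_sphere_zero_iff_norm.2 hn, ?_⟩
    have h1 : μ⁻¹ = (starRingEnd ℂ) μ := by
      rw [Complex.inv_def, Complex.normSq_eq_norm_sq, hn]; simp
    simp only
    rw [h1, Complex.add_conj]
    have : (c : ℂ) * ((2 * s : ℝ) : ℂ) = ((c * (2 * s) : ℝ) : ℂ) := by push_cast; ring
    rw [this, hs]
    congr 1
    field_simp

/-! ### The spectrum of the perturbed chain -/

section Perturbed

variable {α : ℝ} {A : ℤ → ℝ} {z c : ℂ}

lemma exists_small_multiplier (hc : c ≠ 0) {ξ : ℂ} (h : ξ ∉ band c) :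
    ∃ μ : ℂ, μ ≠ 0 ∧ ‖μ‖ < 1 ∧ ξ = c * (μ + μ⁻¹) := by
  obtain ⟨μ, h0, h1, h2⟩ := exists_multiplier hc ξ
  refine ⟨μ, h0, lt_of_le_of_ne h1 fun h3 => h ⟨μ, mem_sphere_zero_iff_norm.2 h3, h2.symm⟩, h2⟩

lemma mem_spectrum_of_band (ha : ∀ j, j ≠ 1 → j ≠ 2 → coeff A j = c) (hc : c ≠ 0)
    (hA : ∀ j, 3 ≤ j → A j = A 3) (h : sinPi z = 0 ∨ discr α z ∈ band c) :
    z ∈ spectrum (hamiltonian α A) := by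
  by_cases hz : sinPi z = 0
  · exact mem_spectrum_of_isEigenvalue
      (isEigenvalue_of_sinPi_eq_zero hz (n := 3) (hA _ (by norm_num)))
  · obtain ⟨μ, hμ, hd⟩ := h.resolve_left hz
    exact mem_spectrum_of_unimodular ha hc hz (mem_sphere_zero_iff_norm.1 hμ) hd.symm

lemma not_mem_discreteSpectrum_of_band (ha : ∀ j, j ≠ 1 → j ≠ 2 → coeff A j = c) (hc : c ≠ 0)
    (hA : ∀ j, 3 ≤ j → A j = A 3) (h12 : coeff A 1 ≠ 0 ∨ coeff A 2 ≠ 0)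
    (h : sinPi z = 0 ∨ discr α z ∈ band c) :
    z ∉ discreteSpectrum (hamiltonian α A) := by
  rintro ⟨h1, h2, -⟩
  by_cases hz : sinPi z = 0
  · exact not_finiteDimensional_of_sinPi_eq_zero hz hA h2
  · obtain ⟨μ, hμ, hd⟩ := h.resolve_left hz
    exact not_isEigenvalue_of_unimodular ha hc h12 hz (mem_sphere_zero_iff_norm.1 hμ) hd.symm h1

/-- Off the essential spectrum, the determinant condition fixes the square of the discriminant. -/
lemma discr_sq_of_determinant {μ ξ s : ℂ} (hμ0 : μ ≠ 0) (hξ : ξ = c * (μ + μ⁻¹))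
    (hdet : μ ^ 2 * (s - c ^ 2) = c ^ 2) : ξ ^ 2 * (s - c ^ 2) = s ^ 2 := by
  have h0 : μ * μ⁻¹ = 1 := mul_inv_cancel₀ hμ0
  have h1 : (s - c ^ 2) = c ^ 2 * μ⁻¹ ^ 2 := by
    linear_combination μ⁻¹ ^ 2 * hdet - (s - c ^ 2) * (μ * μ⁻¹ + 1) * h0
  have h2 : s = c ^ 2 * (1 + μ⁻¹ ^ 2) := by linear_combination h1
  rw [hξ, h2]
  linear_combination c ^ 4 * (μ * μ⁻¹ + 1 + 2 * μ⁻¹ ^ 2) * h0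

lemma determinant_of_mem_spectrum (ha : ∀ j, j ≠ 1 → j ≠ 2 → coeff A j = c) (hc : c ≠ 0)
    (hz : sinPi z ≠ 0) (hb : discr α z ∉ band c) (h : z ∈ spectrum (hamiltonian α A)) :
    ∃ μ : ℂ, μ ≠ 0 ∧ ‖μ‖ < 1 ∧ discr α z = c * (μ + μ⁻¹) ∧
      μ ^ 2 * (coeff A 1 ^ 2 + coeff A 2 ^ 2 - c ^ 2) = c ^ 2 := by
  obtain ⟨μ, h0, h1, h2⟩ := exists_small_multiplier hc hb
  exact ⟨μ, h0, h1, h2, (mem_resolventSet_or_determinant ha hc hz h0 h1 h2).resolve_left h⟩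

/-- Spectral points near `z` must have the same value of `discr²` as `z`, and the nonconstant
discriminant takes the two possible values only at isolated points. -/
lemma mem_discreteSpectrum (ha : ∀ j, j ≠ 1 → j ≠ 2 → coeff A j = c) (hc : c ≠ 0)
    (hz : sinPi z ≠ 0) (hb : discr α z ∉ band c) (h : z ∈ spectrum (hamiltonian α A)) :
    z ∈ discreteSpectrum (hamiltonian α A) := by
  obtain ⟨μ, h0, h1, h2, h3⟩ := determinant_of_mem_spectrum ha hc hz hb h
  have hs := isSimpleEigenvalue_of_determinant ha hc hz h0 h1 h2 h3
  have hs' : Module.finrank ℂ (eigenspace (hamiltonian α A) z) = 1 := hs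
  refine ⟨fun hbot => ?_, Module.finite_of_finrank_pos (by rw [hs']; exact one_pos), ?_⟩
  · rw [hbot, finrank_bot] at hs'
    exact zero_ne_one hs'
  · have hcd := (differentiable_discr α).continuous
    have e1 : ∀ᶠ w in 𝓝[≠] z, sinPi w ≠ 0 :=
      (differentiable_sinPi.continuous.continuousAt.eventually_ne hz).filter_mono nhdsWithin_le_nhds
    have e2 : ∀ᶠ w in 𝓝[≠] z, discr α w ∉ band c :=
      (hcd.continuousAt.eventually ((isClosed_band c).isOpen_compl.mem_nhds hb)).filter_mono
        nhdsWithin_le_nhds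
    filter_upwards [e1, e2, eventually_discr_ne α (discr α z) z,
      eventually_discr_ne α (-discr α z) z] with w w1 w2 w3 w4 hw
    obtain ⟨ν, k0, -, k2, k3⟩ := determinant_of_mem_spectrum ha hc w1 w2 hw
    have q1 := discr_sq_of_determinant h0 h2 h3
    have q2 := discr_sq_of_determinant k0 k2 k3
    have hne : coeff A 1 ^ 2 + coeff A 2 ^ 2 - c ^ 2 ≠ 0 := by
      intro hcon
      rw [hcon, mul_zero] at h3
      exact hc (pow_eq_zero_iff two_ne_zero |>.1 h3.symm)
    have q3 : discr α w ^ 2 = discr α z ^ 2 := mul_right_cancel₀ hne (q2.trans q1.symm)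
    rcases sq_eq_sq_iff_eq_or_eq_neg.1 q3 with h | h
    · exact w3 h
    · exact w4 h

end Perturbed

/-! ### The discriminant on the real line -/

/-- The function `cos (π √x)` of a real variable. -/
def realCosPi (x : ℝ) : ℝ := (cosPi x).re

/-- The function `sin (π √x) / √x` of a real variable. -/
def realSinPi (x : ℝ) : ℝ := (sinPi x).re

/-- The discriminant as a function of a real variable. -/
def realDiscr (α x : ℝ) : ℝ := 2 * realCosPi x + α / 2 * realSinPi x

lemma cosPi_sinPi_ofReal_sq (k : ℝ) : cosPi ((k ^ 2 : ℝ) : ℂ) = (Real.cos (k * Real.pi) : ℝ) ∧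
    (k : ℂ) * sinPi ((k ^ 2 : ℝ) : ℂ) = (Real.sin (k * Real.pi) : ℝ) := by
  have h1 := cosPi_sq k
  have h2 := mul_sinPi_sq k
  push_cast
  exact ⟨h1, h2⟩

lemma cosPi_sinPi_neg_ofReal_sq (k : ℝ) :
    cosPi ((-k ^ 2 : ℝ) : ℂ) = (Real.cosh (k * Real.pi) : ℝ) ∧
    (k : ℂ) * sinPi ((-k ^ 2 : ℝ) : ℂ) = (Real.sinh (k * Real.pi) : ℝ) := by
  have h1 := cosPi_sq (k * Complex.I)
  have h2 := mul_sinPi_sq (k * Complex.I)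
  have e : (k * Complex.I : ℂ) ^ 2 = ((-k ^ 2 : ℝ) : ℂ) := by
    rw [mul_pow, Complex.I_sq]; push_cast; ring
  have e' : (k * Complex.I : ℂ) * Real.pi = (k * Real.pi) * Complex.I := by ring
  rw [e, e'] at h1 h2
  rw [Complex.cos_mul_I] at h1
  rw [Complex.sin_mul_I] at h2
  refine ⟨by rw [h1]; push_cast; rfl, mul_right_cancel₀ Complex.I_ne_zero ?_⟩
  push_cast
  push_cast at h2
  linear_combination h2

lemma ofReal_realCosPi_realSinPi (x : ℝ) :
    (realCosPi x : ℂ) = cosPi x ∧ (realSinPi x : ℂ) = sinPi x := by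
  suffices h : (cosPi x).im = 0 ∧ (sinPi x).im = 0 from
    ⟨Complex.ext (by simp [realCosPi]) (by simp [h.1]),
      Complex.ext (by simp [realSinPi]) (by simp [h.2])⟩
  have aux : ∀ (k r : ℝ) (w : ℂ), k ≠ 0 → (k : ℂ) * w = r → w.im = 0 := by
    intro k r w hk h
    have := congrArg Complex.im h
    rw [Complex.im_ofReal_mul, Complex.ofReal_im] at this
    exact (mul_eq_zero.1 this).resolve_left hk
  rcases lt_trichotomy x 0 with hx | rfl | hx
  · have hk : Real.sqrt (-x) ≠ 0 := (Real.sqrt_pos.2 (by linarith)).ne'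
    have e : x = -Real.sqrt (-x) ^ 2 := by rw [Real.sq_sqrt (by linarith)]; ring
    obtain ⟨h1, h2⟩ := cosPi_sinPi_neg_ofReal_sq (Real.sqrt (-x))
    rw [← e] at h1 h2
    exact ⟨by rw [h1, Complex.ofReal_im], aux _ _ _ hk h2⟩
  · rw [Complex.ofReal_zero, sinPi_zero]
    have := (cosPi_sinPi_ofReal_sq 0).1
    norm_num at this
    rw [this]
    simp
  · have hk : Real.sqrt x ≠ 0 := (Real.sqrt_pos.2 hx).ne'
    have e : x = Real.sqrt x ^ 2 := by rw [Real.sq_sqrt hx.le]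
    obtain ⟨h1, h2⟩ := cosPi_sinPi_ofReal_sq (Real.sqrt x)
    rw [← e] at h1 h2
    exact ⟨by rw [h1, Complex.ofReal_im], aux _ _ _ hk h2⟩

lemma ofReal_realDiscr (α x : ℝ) : (realDiscr α x : ℂ) = discr α x := by
  rw [realDiscr, discr]
  push_cast
  rw [(ofReal_realCosPi_realSinPi x).1, (ofReal_realCosPi_realSinPi x).2]

lemma realCosPi_sq (k : ℝ) : realCosPi (k ^ 2) = Real.cos (k * Real.pi) := by
  rw [realCosPi, (cosPi_sinPi_ofReal_sq k).1, Complex.ofReal_re]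

lemma mul_realSinPi_sq (k : ℝ) : k * realSinPi (k ^ 2) = Real.sin (k * Real.pi) := by
  have := (cosPi_sinPi_ofReal_sq k).2
  rw [← (ofReal_realCosPi_realSinPi _).2] at this
  exact_mod_cast this

lemma realCosPi_neg_sq (k : ℝ) : realCosPi (-k ^ 2) = Real.cosh (k * Real.pi) := by
  rw [realCosPi, (cosPi_sinPi_neg_ofReal_sq k).1, Complex.ofReal_re]

lemma mul_realSinPi_neg_sq (k : ℝ) : k * realSinPi (-k ^ 2) = Real.sinh (k * Real.pi) := by
  have := (cosPi_sinPi_neg_ofReal_sq k).2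
  rw [← (ofReal_realCosPi_realSinPi _).2] at this
  exact_mod_cast this

lemma realCosPi_sq_add (x : ℝ) : realCosPi x ^ 2 + x * realSinPi x ^ 2 = 1 := by
  have := cosPi_sq_add x
  rw [← (ofReal_realCosPi_realSinPi x).1, ← (ofReal_realCosPi_realSinPi x).2] at this
  exact_mod_cast this

lemma continuous_realCosPi : Continuous realCosPi :=
  Complex.continuous_re.comp (differentiable_cosPi.continuous.comp Complex.continuous_ofReal)

lemma continuous_realSinPi : Continuous realSinPi :=
  Complex.continuous_re.comp (differentiable_sinPi.continuous.comp Complex.continuous_ofReal)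

lemma continuous_realDiscr (α : ℝ) : Continuous (realDiscr α) :=
  (continuous_realCosPi.const_mul 2).add (continuous_realSinPi.const_mul _)

/-- Differentiate `cosPi (k ^ 2) = cos (k π)` in `k` and cancel `2 k`, which requires `z ≠ 0`. -/
lemma hasDerivAt_cosPi {z : ℂ} (hz : z ≠ 0) : HasDerivAt cosPi (-(Real.pi / 2) * sinPi z) z := by
  set k := csqrt z with hk
  have hk2 : k ^ 2 = z := csqrt_sq z
  have hk0 : k ≠ 0 := fun h => hz (by rw [← hk2, h]; ring)
  have h1 := (differentiable_cosPi (k ^ 2)).hasDerivAt.comp k (hasDerivAt_pow 2 k)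
  have h2 : HasDerivAt (fun k : ℂ => Complex.cos (k * Real.pi))
      (-Complex.sin (k * Real.pi) * Real.pi) k := by
    simpa using ((hasDerivAt_id k).mul_const (Real.pi : ℂ)).ccos
  have e : (cosPi ∘ fun k : ℂ => k ^ 2) = fun k : ℂ => Complex.cos (k * Real.pi) := by
    funext k; exact cosPi_sq k
  rw [e] at h1
  have h3 := h1.unique h2
  rw [← mul_sinPi_sq, hk2] at h3
  have h4 : deriv cosPi z = -(Real.pi / 2) * sinPi z := by
    refine mul_right_cancel₀ hk0 ?_
    norm_num at h3
    linear_combination h3 / 2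
  rw [← h4]
  exact (differentiable_cosPi z).hasDerivAt

lemma hasDerivAt_sinPi {z : ℂ} (hz : z ≠ 0) :
    HasDerivAt sinPi ((Real.pi * cosPi z - sinPi z) / (2 * z)) z := by
  set k := csqrt z with hk
  have hk2 : k ^ 2 = z := csqrt_sq z
  have h1 := (hasDerivAt_id k).mul
    ((differentiable_sinPi (k ^ 2)).hasDerivAt.comp k (hasDerivAt_pow 2 k))
  have h2 : HasDerivAt (fun k : ℂ => Complex.sin (k * Real.pi))
      (Complex.cos (k * Real.pi) * Real.pi) k := by
    simpa using ((hasDerivAt_id k).mul_const (Real.pi : ℂ)).csin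
  have e : (id * (sinPi ∘ fun k : ℂ => k ^ 2)) = fun k : ℂ => Complex.sin (k * Real.pi) := by
    funext k; exact mul_sinPi_sq k
  rw [e] at h1
  have h3 := h1.unique h2
  rw [← cosPi_sq, hk2] at h3
  simp only [id_eq, Function.comp_apply, hk2] at h3
  have h4 : deriv sinPi z = (Real.pi * cosPi z - sinPi z) / (2 * z) := by
    rw [eq_div_iff (mul_ne_zero two_ne_zero hz)]
    norm_num at h3
    linear_combination h3 - 2 * deriv sinPi z * hk2
  rw [← h4]
  exact (differentiable_sinPi z).hasDerivAt

lemma hasDerivAt_realCosPi {x : ℝ} (hx : x ≠ 0) :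
    HasDerivAt realCosPi (-(Real.pi / 2) * realSinPi x) x := by
  have := (hasDerivAt_cosPi (Complex.ofReal_ne_zero.2 hx)).real_of_complex
  rw [← (ofReal_realCosPi_realSinPi x).2] at this
  refine HasDerivAt.congr_deriv (f := realCosPi) this ?_
  rw [show -((Real.pi : ℂ) / 2) * (realSinPi x : ℂ) = ((-(Real.pi / 2) * realSinPi x : ℝ) : ℂ) by
    push_cast; ring, Complex.ofReal_re]

lemma hasDerivAt_realSinPi {x : ℝ} (hx : x ≠ 0) :
    HasDerivAt realSinPi ((Real.pi * realCosPi x - realSinPi x) / (2 * x)) x := by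
  have := (hasDerivAt_sinPi (Complex.ofReal_ne_zero.2 hx)).real_of_complex
  rw [← (ofReal_realCosPi_realSinPi x).2, ← (ofReal_realCosPi_realSinPi x).1] at this
  refine HasDerivAt.congr_deriv (f := realSinPi) this ?_
  rw [show ((Real.pi : ℂ) * (realCosPi x : ℂ) - (realSinPi x : ℂ)) / (2 * (x : ℂ)) =
    (((Real.pi * realCosPi x - realSinPi x) / (2 * x) : ℝ) : ℂ) by push_cast; ring,
    Complex.ofReal_re]

lemma abs_realSinPi_lt {x : ℝ} (hx : 0 < x) : |realSinPi x| < Real.pi := by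
  have hk : 0 < Real.sqrt x := Real.sqrt_pos.2 hx
  have h := mul_realSinPi_sq (Real.sqrt x)
  rw [Real.sq_sqrt hx.le] at h
  have h1 : |Real.sin (Real.sqrt x * Real.pi)| < Real.sqrt x * Real.pi := by
    have hp : 0 < Real.sqrt x * Real.pi := mul_pos hk Real.pi_pos
    rw [abs_lt]
    refine ⟨?_, Real.sin_lt hp⟩
    rcases lt_or_ge (Real.sqrt x * Real.pi) Real.pi with h2 | h2
    · linarith [Real.sin_pos_of_pos_of_lt_pi hp h2]
    · linarith [Real.neg_one_le_sin (Real.sqrt x * Real.pi), Real.pi_gt_three]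
  rw [← h, abs_mul, abs_of_pos hk] at h1
  exact lt_of_mul_lt_mul_left h1 hk.le

lemma lt_realSinPi_and_le_realCosPi {x : ℝ} (hx : x < 0) :
    Real.pi < realSinPi x ∧ 1 ≤ realCosPi x := by
  have hk : 0 < Real.sqrt (-x) := Real.sqrt_pos.2 (by linarith)
  have e : -Real.sqrt (-x) ^ 2 = x := by rw [Real.sq_sqrt (by linarith)]; ring
  have h := mul_realSinPi_neg_sq (Real.sqrt (-x))
  have h' := realCosPi_neg_sq (Real.sqrt (-x))
  rw [e] at h h'
  refine ⟨?_, by rw [h']; exact Real.one_le_cosh _⟩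
  have h1 := Real.self_lt_sinh_iff.2 (mul_pos hk Real.pi_pos)
  rw [← h] at h1
  exact lt_of_mul_lt_mul_left h1 hk.le

/-- The key positivity for the monotonicity of the discriminant inside `[-2, 2]`. -/
lemma derivative_numerator_pos {x t : ℝ} (hx : x ≠ 0) (ht : |t| ≤ 2) (hS : realSinPi x ≠ 0) :
    0 < Real.pi * realSinPi x ^ 2 -
      (t - 2 * realCosPi x) * ((Real.pi * realCosPi x - realSinPi x) / (2 * x)) := by
  set C := realCosPi x
  set S := realSinPi x
  have hCS : C ^ 2 + x * S ^ 2 = 1 := realCosPi_sq_add x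
  have hS2 : 0 < S ^ 2 := by positivity
  have ht2 : t ^ 2 ≤ 4 := by nlinarith [abs_le.1 ht, sq_abs t]
  have hpi := Real.pi_pos
  -- The relation `C² + x S² = 1` removes `S²`. For `x > 0` one has `|S| < π` and `|2 C - t| ≤ 2 - t
  -- C`; for `x < 0` one has `S > π` and `2 - t C ≤ 2 C - t`. The bracket thus has the sign of `x`.
  have key : Real.pi * S ^ 2 - (t - 2 * C) * ((Real.pi * C - S) / (2 * x)) =
      (Real.pi * (2 - t * C) + S * (t - 2 * C)) / (2 * x) := by
    rw [eq_div_iff (by positivity), sub_mul, mul_assoc (t - 2 * C),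
      div_mul_cancel₀ _ (by positivity)]
    linear_combination 2 * Real.pi * hCS
  have hdiff : (2 - t * C) ^ 2 - (2 * C - t) ^ 2 = (4 - t ^ 2) * (1 - C ^ 2) := by ring
  rw [key]
  obtain ⟨t1, t2⟩ := abs_le.1 ht
  rcases lt_or_gt_of_ne hx with hneg | hpos
  · obtain ⟨h1, h2⟩ := lt_realSinPi_and_le_realCosPi hneg
    have hC1 : 1 < C ^ 2 := by nlinarith
    have hC : 1 < C := by nlinarith
    have hp : 0 < 2 * C - t := by linarith
    have hle : 2 - t * C ≤ 2 * C - t := by nlinarith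
    refine div_pos_of_neg_of_neg ?_ (by linarith)
    nlinarith [mul_le_mul_of_nonneg_left hle hpi.le, mul_lt_mul_of_pos_right h1 hp]
  · have h1 := abs_lt.1 (abs_realSinPi_lt hpos)
    have hC1 : C ^ 2 < 1 := by nlinarith [mul_pos hpos hS2]
    obtain ⟨c1, c2⟩ := abs_lt.1 ((sq_lt_one_iff_abs_lt_one C).1 hC1)
    have hp : 0 < 2 - t * C := by nlinarith
    have hle1 : 2 * C - t ≤ 2 - t * C := by nlinarith
    have hle2 : -(2 * C - t) ≤ 2 - t * C := by nlinarith
    refine div_pos ?_ (by linarith)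
    rcases le_total 0 (2 * C - t) with h | h
    · nlinarith [mul_le_mul_of_nonneg_left hle1 hpi.le, mul_pos hpi hp,
        mul_le_mul_of_nonneg_right h1.2.le h]
    · nlinarith [mul_le_mul_of_nonneg_left hle2 hpi.le, mul_pos hpi hp]

/-- Solving `discr = t` for the coupling gives `α / 2 = (t - 2 C) / S`; the right side is strictly
increasing and no longer contains `α`. -/
lemma quotient_lt {a b t : ℝ} (hab : a < b) (ht : |t| ≤ 2)
    (hS : ∀ x ∈ Icc a b, realSinPi x ≠ 0) (h0 : (0 : ℝ) ∉ Ioo a b) :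
    (t - 2 * realCosPi a) / realSinPi a < (t - 2 * realCosPi b) / realSinPi b := by
  have hmono : StrictMonoOn (fun x => (t - 2 * realCosPi x) / realSinPi x) (Icc a b) := by
    refine strictMonoOn_of_deriv_pos (convex_Icc a b) ?_ fun x hx => ?_
    · exact ((continuous_const.sub (continuous_realCosPi.const_mul 2)).continuousOn).div
        continuous_realSinPi.continuousOn hS
    · rw [interior_Icc] at hx
      have hx0 : x ≠ 0 := fun h => h0 (h ▸ hx)
      have hSx := hS x (Ioo_subset_Icc_self hx)
      have hd := (((hasDerivAt_realCosPi hx0).const_mul 2).const_sub t).div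
        (hasDerivAt_realSinPi hx0) hSx
      have hd' : deriv (fun x => (t - 2 * realCosPi x) / realSinPi x) x = _ := hd.deriv
      rw [hd']
      refine div_pos ?_ (by positivity)
      have := derivative_numerator_pos hx0 ht hSx
      refine this.trans_eq ?_
      ring
  exact hmono (left_mem_Icc.2 hab.le) (right_mem_Icc.2 hab.le) hab

lemma realDiscr_injective_of_lt {α a b : ℝ} (hab : a < b)
    (hS : ∀ x ∈ Icc a b, realSinPi x ≠ 0) (h : realDiscr α a = realDiscr α b)
    (ht : |realDiscr α a| ≤ 2) : False := by
  set t := realDiscr α a with htd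
  have hq : ∀ x, realSinPi x ≠ 0 → realDiscr α x = t →
      (t - 2 * realCosPi x) / realSinPi x = α / 2 := by
    intro x hx hxt
    rw [div_eq_iff hx, ← hxt, realDiscr]; ring
  have ha := hq a (hS a (left_mem_Icc.2 hab.le)) rfl
  have hb := hq b (hS b (right_mem_Icc.2 hab.le)) h.symm
  have hlt : (t - 2 * realCosPi a) / realSinPi a < (t - 2 * realCosPi b) / realSinPi b := by
    -- The derivative formulas are singular at `0`, so an interval around `0` is split there.
    by_cases h0 : (0 : ℝ) ∈ Ioo a b
    · exact (quotient_lt h0.1 ht (fun x hx => hS x ⟨hx.1, hx.2.trans h0.2.le⟩) (by simp)).trans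
        (quotient_lt h0.2 ht (fun x hx => hS x ⟨h0.1.le.trans hx.1, hx.2⟩) (by simp))
    · exact quotient_lt hab ht hS h0
  rw [ha, hb] at hlt
  exact lt_irrefl _ hlt

/-- Between consecutive Dirichlet eigenvalues the discriminant takes each value in `[-2, 2]` at most
once. -/
lemma realDiscr_injective {α p q : ℝ} (hS : ∀ x ∈ uIcc p q, realSinPi x ≠ 0)
    (h : realDiscr α p = realDiscr α q) (ht : |realDiscr α p| ≤ 2) : p = q := by
  rcases lt_trichotomy p q with hlt | heq | hlt
  · rw [uIcc_of_le hlt.le] at hS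
    exact (realDiscr_injective_of_lt hlt hS h ht).elim
  · exact heq
  · rw [uIcc_of_ge hlt.le] at hS
    exact (realDiscr_injective_of_lt hlt hS h.symm (h ▸ ht)).elim

/-! ### Dirichlet eigenvalues and the range of the discriminant between them -/

lemma realSinPi_ne_zero_of_lt_one {x : ℝ} (hx : x < 1) : realSinPi x ≠ 0 := by
  rcases lt_trichotomy x 0 with h | rfl | h
  · exact (Real.pi_pos.trans (lt_realSinPi_and_le_realCosPi h).1).ne'
  · rw [realSinPi, Complex.ofReal_zero, sinPi_zero, Complex.ofReal_re]
    exact Real.pi_pos.ne'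
  · intro h0
    have h1 := mul_realSinPi_sq (Real.sqrt x)
    have hk : 0 < Real.sqrt x := Real.sqrt_pos.2 h
    have hk1 : Real.sqrt x < 1 := by rw [Real.sqrt_lt' one_pos]; linarith
    rw [Real.sq_sqrt h.le, h0, mul_zero] at h1
    have := Real.sin_pos_of_pos_of_lt_pi (mul_pos hk Real.pi_pos)
      (by nlinarith [Real.pi_pos])
    linarith

lemma realSinPi_ne_zero_of_between {n : ℕ} {x : ℝ} (h1 : (n : ℝ) ^ 2 < x)
    (h2 : x < ((n : ℝ) + 1) ^ 2) : realSinPi x ≠ 0 := by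
  intro h0
  have hx : 0 < x := lt_of_le_of_lt (sq_nonneg _) h1
  have e := mul_realSinPi_sq (Real.sqrt x)
  rw [Real.sq_sqrt hx.le, h0, mul_zero, eq_comm, Real.sin_eq_zero_iff] at e
  obtain ⟨m, hm⟩ := e
  have hm' : (m : ℝ) = Real.sqrt x := mul_right_cancel₀ Real.pi_pos.ne' hm
  have k1 : (n : ℝ) < m := by rw [hm']; exact Real.lt_sqrt_of_sq_lt h1
  have k2 : (m : ℝ) < n + 1 := by rw [hm', Real.sqrt_lt' (by positivity)]; exact h2
  have k1' : (n : ℤ) < m := by exact_mod_cast k1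
  have k2' : m < (n : ℤ) + 1 := by exact_mod_cast k2
  omega

lemma realSinPi_natCast_sq {n : ℕ} (hn : n ≠ 0) : realSinPi ((n : ℝ) ^ 2) = 0 := by
  have := mul_realSinPi_sq n
  rw [Real.sin_nat_mul_pi] at this
  exact (mul_eq_zero.1 this).resolve_left (Nat.cast_ne_zero.2 hn)

lemma realDiscr_natCast_sq (α : ℝ) {n : ℕ} (hn : n ≠ 0) :
    realDiscr α ((n : ℝ) ^ 2) = 2 * (-1) ^ n := by
  rw [realDiscr, realSinPi_natCast_sq hn, realCosPi_sq, Real.cos_nat_mul_pi]; ring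

/-- The lowest interval has no left Dirichlet endpoint; far to the left `cosh` dominates. At `x =
-k²` with `k = 1 + |α|` the coupling term is at most `cosh / 2` in modulus. -/
lemma exists_two_le_realDiscr (α : ℝ) : ∃ y < 1, 2 ≤ realDiscr α y := by
  set k := 1 + |α| with hk
  have hα := abs_nonneg α
  have hk1 : 1 ≤ k := by linarith
  have hk0 : 0 < k := by linarith
  refine ⟨-k ^ 2, by nlinarith, ?_⟩
  set S := realSinPi (-k ^ 2) with hS
  have hsinh : k * S = Real.sinh (k * Real.pi) := mul_realSinPi_neg_sq k
  have hlt : Real.sinh (k * Real.pi) < Real.cosh (k * Real.pi) := Real.sinh_lt_cosh _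
  have hS0 : 0 < S := Real.pi_pos.trans (lt_realSinPi_and_le_realCosPi (by nlinarith)).1
  have h1 : |α| * S ≤ Real.cosh (k * Real.pi) := by
    have : |α| * S ≤ k * S := mul_le_mul_of_nonneg_right (by linarith) hS0.le
    linarith
  have h2 : 2 ≤ Real.cosh (k * Real.pi) := by
    have e := Real.add_one_le_exp (k * Real.pi)
    have e' := Real.exp_pos (-(k * Real.pi))
    have : 3 ≤ k * Real.pi := by nlinarith [Real.pi_gt_three]
    rw [Real.cosh_eq]
    linarith
  have h3 : -(|α| * S) ≤ α * S := by
    have := mul_le_mul_of_nonneg_right (neg_abs_le α) hS0.le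
    linarith
  rw [realDiscr, realCosPi_neg_sq, ← hS]
  linarith

/-- Between consecutive Dirichlet eigenvalues the discriminant takes each value in `(-2, 2)`. -/
lemma exists_realDiscr_eq (α : ℝ) {x₀ t : ℝ} (hx₀ : realSinPi x₀ ≠ 0) (ht : |t| < 2) :
    ∃ E, realDiscr α E = t ∧ ∀ x ∈ uIcc x₀ E, realSinPi x ≠ 0 := by
  obtain ⟨t1, t2⟩ := abs_lt.1 ht
  rcases lt_or_ge x₀ 1 with h | h
  · obtain ⟨y, hy1, hy2⟩ := exists_two_le_realDiscr α
    have e1 : realDiscr α 1 = -2 := by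
      have := realDiscr_natCast_sq α one_ne_zero
      norm_num at this
      exact this
    obtain ⟨E, hE, hEt⟩ := intermediate_value_Icc' hy1.le (continuous_realDiscr α).continuousOn
      (show t ∈ Icc (realDiscr α 1) (realDiscr α y) from ⟨by linarith, by linarith⟩)
    have hE1 : E < 1 := lt_of_le_of_ne hE.2 (by rintro rfl; linarith)
    refine ⟨E, hEt, fun x hx => realSinPi_ne_zero_of_lt_one ?_⟩
    exact lt_of_le_of_lt hx.2 (max_lt h hE1)
  · set n := ⌊Real.sqrt x₀⌋₊ with hn
    have hx0 : 0 ≤ x₀ := by linarith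
    have hs1 : 1 ≤ Real.sqrt x₀ := Real.one_le_sqrt.2 h
    have hn1 : n ≠ 0 := by
      have : 1 ≤ n := Nat.le_floor (by exact_mod_cast hs1)
      omega
    have l1 : (n : ℝ) ≤ Real.sqrt x₀ := Nat.floor_le (Real.sqrt_nonneg _)
    have l2 : Real.sqrt x₀ < n + 1 := Nat.lt_floor_add_one _
    have a1 : (n : ℝ) ^ 2 < x₀ := by
      refine lt_of_le_of_ne ?_ fun he => hx₀ (by rw [← he]; exact realSinPi_natCast_sq hn1)
      calc (n : ℝ) ^ 2 ≤ Real.sqrt x₀ ^ 2 := pow_le_pow_left₀ (Nat.cast_nonneg _) l1 2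
        _ = x₀ := Real.sq_sqrt hx0
    have a2 : x₀ < ((n : ℝ) + 1) ^ 2 := (Real.sqrt_lt' (by positivity)).1 l2
    have v1 := realDiscr_natCast_sq α hn1
    -- The discriminant is `2` at one of two consecutive Dirichlet eigenvalues and `-2` at the
    -- other, whatever `α` is.
    have v2 : realDiscr α (((n : ℝ) + 1) ^ 2) = 2 * ((-1) ^ n * -1) := by
      have := realDiscr_natCast_sq α (n.succ_ne_zero)
      rw [Nat.cast_succ] at this
      rw [this, pow_succ]
    have hc := (continuous_realDiscr α).continuousOn (s := Icc ((n : ℝ) ^ 2) (((n : ℝ) + 1) ^ 2))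
    have hle : (n : ℝ) ^ 2 ≤ ((n : ℝ) + 1) ^ 2 := by linarith
    obtain ⟨E, hE, hEt⟩ : t ∈ realDiscr α '' Icc ((n : ℝ) ^ 2) (((n : ℝ) + 1) ^ 2) := by
      rcases neg_one_pow_eq_or ℝ n with hs | hs
      · refine intermediate_value_Icc' hle hc ?_
        rw [v1, v2, hs]; exact ⟨by linarith, by linarith⟩
      · refine intermediate_value_Icc hle hc ?_
        rw [v1, v2, hs]; exact ⟨by linarith, by linarith⟩
    have hne : ∀ y : ℝ, realDiscr α y = 2 ∨ realDiscr α y = -2 → E ≠ y := by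
      rintro y (hy | hy) rfl <;> linarith
    have hE1 : (n : ℝ) ^ 2 < E := lt_of_le_of_ne hE.1 (Ne.symm (hne _ (by
      rw [v1]; rcases neg_one_pow_eq_or ℝ n with hs | hs <;> rw [hs] <;> norm_num)))
    have hE2 : E < ((n : ℝ) + 1) ^ 2 := lt_of_le_of_ne hE.2 (hne _ (by
      rw [v2]; rcases neg_one_pow_eq_or ℝ n with hs | hs <;> rw [hs] <;> norm_num))
    refine ⟨E, hEt, fun x hx => realSinPi_ne_zero_of_between (n := n) ?_ ?_⟩
    · exact lt_of_lt_of_le (lt_min a1 hE1) hx.1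
    · exact lt_of_le_of_lt hx.2 (max_lt a2 hE2)

/-! ### Gaps -/

/-- The complement of the essential spectrum in the real line, in terms of the discriminant. -/
def gapSet (α τ : ℝ) : Set ℝ := {y | realSinPi y ≠ 0 ∧ τ < |realDiscr α y|}

/-- Take `E` at the level `m` between the same Dirichlet eigenvalues as `x₀`. If `σ * discr` dropped
to `τ` somewhere between `x₀` and `E`, a level just above `τ` would be taken on both sides of that
point, against injectivity. -/
lemma exists_mem_gap {α τ m x₀ σ : ℝ} (hσ : |σ| = 1) (hτ : 0 ≤ τ) (hm : τ < m) (hm2 : m < 2)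
    (hx₀ : realSinPi x₀ ≠ 0) (h : τ < σ * realDiscr α x₀) :
    ∃ E ∈ connectedComponentIn (gapSet α τ) x₀, σ * realDiscr α E = m := by
  have hσ2 : σ * σ = 1 := by rw [← abs_mul_abs_self, hσ, one_mul]
  obtain ⟨E, hE, hS⟩ := exists_realDiscr_eq α (t := σ * m) hx₀ (by
    rw [abs_mul, hσ, one_mul, abs_of_pos (by linarith)]; exact hm2)
  have hEm : σ * realDiscr α E = m := by rw [hE, ← mul_assoc, hσ2, one_mul]
  have hcont : Continuous fun x => σ * realDiscr α x := (continuous_realDiscr α).const_mul σ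
  have hsub : uIcc x₀ E ⊆ gapSet α τ := by
    intro y hy
    refine ⟨hS y hy, ?_⟩
    suffices hy' : τ < σ * realDiscr α y by
      refine hy'.trans_le ((le_abs_self _).trans ?_)
      rw [abs_mul, hσ, one_mul]
    by_contra! hcon
    obtain ⟨t, ht1, ht2⟩ := exists_between (lt_min hm h)
    obtain ⟨ht2, ht3⟩ := lt_min_iff.1 ht2
    obtain ⟨p, hp, hpt⟩ := intermediate_value_uIcc (a := x₀) (b := y) hcont.continuousOn
      (show t ∈ uIcc _ _ from mem_uIcc.2 (Or.inr ⟨by linarith, ht3.le⟩))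
    obtain ⟨q, hq, hqt⟩ := intermediate_value_uIcc (a := y) (b := E) hcont.continuousOn
      (show t ∈ uIcc _ _ from mem_uIcc.2 (Or.inl ⟨by linarith, by linarith⟩))
    simp only at hpt hqt
    have hpq : realDiscr α p = realDiscr α q := by
      have : σ * (σ * realDiscr α p) = σ * (σ * realDiscr α q) := by rw [hpt, hqt]
      rwa [← mul_assoc, ← mul_assoc, hσ2, one_mul, one_mul] at this
    have hpE : p ∈ uIcc x₀ E := uIcc_subset_uIcc left_mem_uIcc hy hp
    have hqE : q ∈ uIcc x₀ E := uIcc_subset_uIcc hy right_mem_uIcc hq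
    have hpt2 : |realDiscr α p| ≤ 2 := by
      have e : |realDiscr α p| = |t| := by rw [← hpt, abs_mul, hσ, one_mul]
      rw [e, abs_of_pos (by linarith)]
      linarith
    have := realDiscr_injective (fun x hx => hS x (uIcc_subset_uIcc hpE hqE hx)) hpq hpt2
    subst this
    have hpy : p ≠ y := by rintro rfl; linarith
    rcases mem_uIcc.1 hy with h' | h' <;> rcases mem_uIcc.1 hp with h1 | h1 <;>
      rcases mem_uIcc.1 hq with h2 | h2 <;>
      exact hpy (by linarith [h'.1, h'.2, h1.1, h1.2, h2.1, h2.2])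
  exact ⟨E, (isPreconnected_uIcc.subset_connectedComponentIn left_mem_uIcc hsub)
    right_mem_uIcc, hEm⟩

/-- In every gap the square of the discriminant takes a given intermediate value exactly once. -/
lemma existsUnique_mem_gap {α τ m x₀ : ℝ} (hτ : 0 ≤ τ) (hm : τ < m) (hm2 : m < 2)
    (hx₀ : x₀ ∈ gapSet α τ) :
    ∃ E ∈ connectedComponentIn (gapSet α τ) x₀, realDiscr α E ^ 2 = m ^ 2 ∧
      ∀ E' ∈ connectedComponentIn (gapSet α τ) x₀, realDiscr α E' ^ 2 = m ^ 2 → E' = E := by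
  have hex : ∃ E ∈ connectedComponentIn (gapSet α τ) x₀, realDiscr α E ^ 2 = m ^ 2 := by
    rcases lt_abs.1 hx₀.2 with h | h
    · obtain ⟨E, hE, hEm⟩ := exists_mem_gap (σ := 1) (by simp) hτ hm hm2 hx₀.1 (by linarith)
      exact ⟨E, hE, by rw [← hEm]; ring⟩
    · obtain ⟨E, hE, hEm⟩ := exists_mem_gap (σ := -1) (by simp) hτ hm hm2 hx₀.1 (by linarith)
      exact ⟨E, hE, by rw [← hEm]; ring⟩
  obtain ⟨E, hE, hEm⟩ := hex
  refine ⟨E, hE, hEm, fun E' hE' hEm' => ?_⟩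
  have hoc : OrdConnected (connectedComponentIn (gapSet α τ) x₀) :=
    isPreconnected_connectedComponentIn.ordConnected
  have hsub : uIcc E' E ⊆ gapSet α τ :=
    (hoc.uIcc_subset hE' hE).trans (connectedComponentIn_subset _ _)
  have habs : |realDiscr α E'| ≤ 2 := by
    have : |realDiscr α E'| = |m| := (sq_eq_sq_iff_abs_eq_abs _ _).1 hEm'
    rw [this, abs_of_pos (by linarith)]
    exact hm2.le
  refine realDiscr_injective (fun x hx => (hsub hx).1) ?_ habs
  rcases sq_eq_sq_iff_eq_or_eq_neg.1 (hEm'.trans hEm.symm) with h | h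
  · exact h
  -- Opposite signs would produce a zero of the discriminant inside the gap.
  · exfalso
    obtain ⟨y, hy, hy0⟩ := intermediate_value_uIcc (a := E') (b := E)
      (continuous_realDiscr α).continuousOn (show (0 : ℝ) ∈ uIcc _ _ by
        rw [h, mem_uIcc]
        rcases le_total 0 (realDiscr α E) with h' | h'
        · exact Or.inl ⟨by linarith, h'⟩
        · exact Or.inr ⟨h', by linarith⟩)
    have := (hsub hy).2
    rw [hy0, abs_zero] at this
    linarith

/-! ### The perturbed chain -/

section Main

variable {α A A₁ A₂ : ℝ}

lemma cos_mul_pi_ne_zero (hA : ∀ n : ℤ, A - 1 / 2 ≠ n) : Real.cos (A * Real.pi) ≠ 0 := by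
  intro h
  obtain ⟨n, hn⟩ := Real.cos_eq_zero_iff.1 h
  refine hA n (mul_right_cancel₀ Real.pi_pos.ne' ?_)
  linear_combination hn

lemma perturbedField_self (A : ℝ) : perturbedField A A A = fun _ => A := by
  funext j
  simp [perturbedField]

lemma coeff_perturbedField {j : ℤ} (h1 : j ≠ 1) (h2 : j ≠ 2) :
    coeff (perturbedField A A₁ A₂) j = (Real.cos (A * Real.pi) : ℝ) := by
  simp [coeff, perturbedField, h1, h2]

lemma coeff_perturbedField_sq_add :
    coeff (perturbedField A A₁ A₂) 1 ^ 2 + coeff (perturbedField A A₁ A₂) 2 ^ 2 =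
      ((Real.cos (A₁ * Real.pi) ^ 2 + Real.cos (A₂ * Real.pi) ^ 2 : ℝ) : ℂ) := by
  simp [coeff, perturbedField]

lemma perturbedField_eq_three {j : ℤ} (h : 3 ≤ j) :
    perturbedField A A₁ A₂ j = perturbedField A A₁ A₂ 3 := by
  have h1 : j ≠ 1 := by omega
  have h2 : j ≠ 2 := by omega
  simp [perturbedField, h1, h2]

lemma fluxCondition_iff (hA : Real.cos (A * Real.pi) ≠ 0) : FluxCondition A A₁ A₂ ↔
    2 * Real.cos (A * Real.pi) ^ 2 < Real.cos (A₁ * Real.pi) ^ 2 + Real.cos (A₂ * Real.pi) ^ 2 := by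
  rw [FluxCondition, gt_iff_lt, one_lt_div (by positivity)]

/-- The points where the unperturbed Jacobi equation has a bounded solution, together with the
Dirichlet eigenvalues of the semicircles. -/
def bandSpectrum (α A : ℝ) : Set ℂ :=
  {z | sinPi z = 0 ∨ discr α z ∈ band (Real.cos (A * Real.pi) : ℝ)}

lemma bandSpectrum_subset (hA : Real.cos (A * Real.pi) ≠ 0) :
    bandSpectrum α A ⊆ spectrum (perturbedHamiltonian α A A₁ A₂) := fun _ hz =>
  mem_spectrum_of_band (fun _ => coeff_perturbedField) (Complex.ofReal_ne_zero.2 hA)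
    (fun _ => perturbedField_eq_three) hz

/-- With `|μ| < 1` the determinant condition needs `|s - c²| > c²`, but `0 ≤ s ≤ 2 c²` gives the
opposite. -/
lemma spectrum_of_not_fluxCondition (hA : Real.cos (A * Real.pi) ≠ 0)
    (h : ¬ FluxCondition A A₁ A₂) :
    spectrum (perturbedHamiltonian α A A₁ A₂) = bandSpectrum α A := by
  refine Subset.antisymm (fun z hz => ?_) (bandSpectrum_subset hA)
  by_contra hcon
  obtain ⟨h1, h2⟩ := not_or.1 hcon
  obtain ⟨μ, -, hμ, -, hdet⟩ := determinant_of_mem_spectrum (fun _ => coeff_perturbedField)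
    (Complex.ofReal_ne_zero.2 hA) h1 h2 hz
  rw [fluxCondition_iff hA, not_lt] at h
  rw [coeff_perturbedField_sq_add] at hdet
  set c := Real.cos (A * Real.pi)
  set s := Real.cos (A₁ * Real.pi) ^ 2 + Real.cos (A₂ * Real.pi) ^ 2 with hs
  have hs0 : 0 ≤ s := by positivity
  have hc2 : 0 < c ^ 2 := by positivity
  have hn := congrArg norm hdet
  rw [← Complex.ofReal_pow, ← Complex.ofReal_sub, norm_mul, norm_pow, Complex.norm_real,
    Complex.norm_real, Real.norm_eq_abs, Real.norm_eq_abs, abs_of_pos hc2] at hn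
  have hle : |s - c ^ 2| ≤ c ^ 2 := abs_le.2 ⟨by linarith, by linarith⟩
  have hμ2 : ‖μ‖ ^ 2 < 1 := by nlinarith [norm_nonneg μ]
  nlinarith [mul_le_mul_of_nonneg_left hle (sq_nonneg ‖μ‖)]

/-- The periodic chain is the case `A₁ = A₂ = A`, where the flux condition would read `1 > 1`. -/
lemma spectrum_periodicHamiltonian (hA : Real.cos (A * Real.pi) ≠ 0) :
    spectrum (periodicHamiltonian α A) = bandSpectrum α A := by
  rw [periodicHamiltonian, ← perturbedField_self]
  refine spectrum_of_not_fluxCondition hA ?_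
  rw [fluxCondition_iff hA]
  linarith

lemma essentialSpectrum_of_fluxCondition (hA : Real.cos (A * Real.pi) ≠ 0)
    (h : FluxCondition A A₁ A₂) :
    essentialSpectrum (perturbedHamiltonian α A A₁ A₂) = bandSpectrum α A := by
  have h12 : coeff (perturbedField A A₁ A₂) 1 ≠ 0 ∨ coeff (perturbedField A A₁ A₂) 2 ≠ 0 := by
    by_contra! hcon
    have := coeff_perturbedField_sq_add (A := A) (A₁ := A₁) (A₂ := A₂)
    rw [hcon.1, hcon.2, zero_pow two_ne_zero, add_zero, eq_comm, Complex.ofReal_eq_zero] at this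
    rw [fluxCondition_iff hA, this] at h
    exact absurd h (not_lt.2 (by positivity))
  refine Subset.antisymm (fun z hz => ?_) fun z hz => ⟨bandSpectrum_subset hA hz, ?_⟩
  · by_contra hcon
    obtain ⟨h1, h2⟩ := not_or.1 hcon
    exact hz.2 (mem_discreteSpectrum (fun _ => coeff_perturbedField)
      (Complex.ofReal_ne_zero.2 hA) h1 h2 hz.1)
  · exact not_mem_discreteSpectrum_of_band (fun _ => coeff_perturbedField)
      (Complex.ofReal_ne_zero.2 hA) (fun _ => perturbedField_eq_three) h12 hz

lemma ofReal_not_mem_bandSpectrum_iff (hA : Real.cos (A * Real.pi) ≠ 0) (y : ℝ) :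
    (y : ℂ) ∉ bandSpectrum α A ↔ y ∈ gapSet α (2 * |Real.cos (A * Real.pi)|) := by
  rw [bandSpectrum, mem_ofPred_eq, not_or, ← (ofReal_realCosPi_realSinPi y).2,
    ← ofReal_realDiscr, band_ofReal _ _ hA, not_le, Complex.ofReal_eq_zero]
  rfl

lemma isSimpleEigenvalue_of_discr_sq (hA : Real.cos (A * Real.pi) ≠ 0)
    (h : FluxCondition A A₁ A₂) {z : ℂ} (hz : z ∉ bandSpectrum α A)
    (hsq : discr α z ^ 2 *
      (coeff (perturbedField A A₁ A₂) 1 ^ 2 + coeff (perturbedField A A₁ A₂) 2 ^ 2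
        - (Real.cos (A * Real.pi) : ℝ) ^ 2) =
      (coeff (perturbedField A A₁ A₂) 1 ^ 2 + coeff (perturbedField A A₁ A₂) 2 ^ 2) ^ 2) :
    IsSimpleEigenvalue (perturbedHamiltonian α A A₁ A₂) z := by
  obtain ⟨h1, h2⟩ := not_or.1 hz
  have hc := Complex.ofReal_ne_zero.2 hA
  obtain ⟨ν, ν0, ν1, hν⟩ := exists_small_multiplier hc h2
  refine isSimpleEigenvalue_of_determinant (fun _ => coeff_perturbedField) hc h1 ν0 ν1 hν ?_
  rw [coeff_perturbedField_sq_add] at hsq ⊢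
  rw [fluxCondition_iff hA] at h
  set c := Real.cos (A * Real.pi)
  set s := Real.cos (A₁ * Real.pi) ^ 2 + Real.cos (A₂ * Real.pi) ^ 2
  have hc2 : 0 < c ^ 2 := by positivity
  -- Squaring loses the distinction between `ν` and `ν⁻¹`: the second factor is the determinant
  -- condition for `ν⁻¹`, excluded by `s - c² > c²` and `|ν| < 1`.
  have key : (ν ^ 2 * ((s : ℂ) - (c : ℂ) ^ 2) - (c : ℂ) ^ 2) *
      ((c : ℂ) ^ 2 * ν ^ 2 - ((s : ℂ) - (c : ℂ) ^ 2)) = 0 := by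
    have e : discr α z * ν = c * (ν ^ 2 + 1) := by
      rw [hν]; field_simp
    linear_combination ν ^ 2 * hsq - ((s : ℂ) - (c : ℂ) ^ 2) * (discr α z * ν + c * (ν ^ 2 + 1)) * e
  refine sub_eq_zero.1 ((mul_eq_zero.1 key).resolve_right fun h0 => ?_)
  have hn := congrArg norm (sub_eq_zero.1 h0)
  rw [← Complex.ofReal_pow, ← Complex.ofReal_sub, norm_mul, norm_pow, Complex.norm_real,
    Complex.norm_real, Real.norm_eq_abs, Real.norm_eq_abs, abs_of_pos hc2,
    abs_of_pos (by linarith)] at hn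
  have hν2 : ‖ν‖ ^ 2 < 1 := by nlinarith [norm_nonneg ν]
  nlinarith

lemma discr_sq_of_isEigenvalue (hA : Real.cos (A * Real.pi) ≠ 0) {z : ℂ}
    (hz : z ∉ bandSpectrum α A) (h : IsEigenvalue (perturbedHamiltonian α A A₁ A₂) z) :
    discr α z ^ 2 *
      (coeff (perturbedField A A₁ A₂) 1 ^ 2 + coeff (perturbedField A A₁ A₂) 2 ^ 2
        - (Real.cos (A * Real.pi) : ℝ) ^ 2) =
      (coeff (perturbedField A A₁ A₂) 1 ^ 2 + coeff (perturbedField A A₁ A₂) 2 ^ 2) ^ 2 := by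
  obtain ⟨h1, h2⟩ := not_or.1 hz
  have hc := Complex.ofReal_ne_zero.2 hA
  obtain ⟨ν, ν0, ν1, hν⟩ := exists_small_multiplier hc h2
  exact discr_sq_of_determinant ν0 hν
    (determinant_of_isEigenvalue (fun _ => coeff_perturbedField) hc h1 ν0 ν1.le hν h)

lemma existsUnique_eigenvalue_in_gap (hA : Real.cos (A * Real.pi) ≠ 0)
    (h : FluxCondition A A₁ A₂) {G : Set ℝ} (hG : IsGap (bandSpectrum α A) G) :
    ∃ E ∈ G, IsSimpleEigenvalue (perturbedHamiltonian α A A₁ A₂) (E : ℂ) ∧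
      ∀ E' ∈ G, IsEigenvalue (perturbedHamiltonian α A A₁ A₂) (E' : ℂ) → E' = E := by
  obtain ⟨x, hx, rfl⟩ := hG
  have hset : {y : ℝ | (y : ℂ) ∉ bandSpectrum α A} = gapSet α (2 * |Real.cos (A * Real.pi)|) :=
    Set.ext (ofReal_not_mem_bandSpectrum_iff hA)
  have hflux := (fluxCondition_iff hA).1 h
  set c := Real.cos (A * Real.pi) with hcdef
  set s := Real.cos (A₁ * Real.pi) ^ 2 + Real.cos (A₂ * Real.pi) ^ 2 with hsdef
  have hc2 : 0 < c ^ 2 := by positivity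
  have hs2 : s ≤ 2 := by
    linarith [Real.cos_sq_le_one (A₁ * Real.pi), Real.cos_sq_le_one (A₂ * Real.pi)]
  have hd : 0 < s - c ^ 2 := by linarith
  -- The modulus of the discriminant forced by the determinant condition.
  set m := s / Real.sqrt (s - c ^ 2)
  have hm0 : 0 < m := div_pos (by linarith) (Real.sqrt_pos.2 hd)
  have hm : m ^ 2 * (s - c ^ 2) = s ^ 2 := by
    rw [div_pow, Real.sq_sqrt hd.le, div_mul_cancel₀ _ hd.ne']
  -- This amounts to `s² - 4 c² (s - c²) = (s - 2 c²)² > 0`.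
  have hm1 : 2 * |c| < m := by
    refine lt_of_pow_lt_pow_left₀ 2 hm0.le ?_
    rw [mul_pow, sq_abs]
    refine lt_of_mul_lt_mul_right ?_ hd.le
    rw [hm]
    nlinarith [sq_pos_of_pos (sub_pos.2 hflux)]
  -- By `2 c² < s ≤ 2`, `4 (s - c²) - s² > s (2 - s) ≥ 0`.
  have hm2 : m < 2 := by
    refine lt_of_pow_lt_pow_left₀ 2 zero_le_two (lt_of_mul_lt_mul_right ?_ hd.le)
    rw [hm]
    nlinarith
  have hiff : ∀ y : ℝ, realDiscr α y ^ 2 = m ^ 2 ↔ discr α y ^ 2 *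
      (coeff (perturbedField A A₁ A₂) 1 ^ 2 + coeff (perturbedField A A₁ A₂) 2 ^ 2
        - (c : ℂ) ^ 2) =
      (coeff (perturbedField A A₁ A₂) 1 ^ 2 + coeff (perturbedField A A₁ A₂) 2 ^ 2) ^ 2 := by
    intro y
    rw [coeff_perturbedField_sq_add, ← ofReal_realDiscr, ← mul_left_inj' hd.ne', hm]
    norm_cast
  rw [hset]
  have hx' : x ∈ gapSet α (2 * |c|) := (ofReal_not_mem_bandSpectrum_iff hA x).1 hx
  have hout : ∀ y ∈ connectedComponentIn (gapSet α (2 * |c|)) x, (y : ℂ) ∉ bandSpectrum α A :=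
    fun y hy => (ofReal_not_mem_bandSpectrum_iff hA y).2 (connectedComponentIn_subset _ _ hy)
  obtain ⟨E, hE, hEm, huniq⟩ := existsUnique_mem_gap (by positivity) hm1 hm2 hx'
  exact ⟨E, hE, isSimpleEigenvalue_of_discr_sq hA h (hout E hE) ((hiff E).1 hEm),
    fun E' hE' hev => huniq E' hE' ((hiff E').2 (discr_sq_of_isEigenvalue hA (hout E' hE') hev))⟩

end Main

end MagneticChain
end

theorem mainTheorem3 (α A A₁ A₂ : ℝ) (hA : ∀ n : ℤ, A - 1 / 2 ≠ n) :
    (¬ MagneticChain.FluxCondition A A₁ A₂ →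
      MagneticChain.spectrum (MagneticChain.perturbedHamiltonian α A A₁ A₂) =
        MagneticChain.spectrum (MagneticChain.periodicHamiltonian α A)) ∧
    (MagneticChain.FluxCondition A A₁ A₂ →
      MagneticChain.essentialSpectrum (MagneticChain.perturbedHamiltonian α A A₁ A₂) =
        MagneticChain.spectrum (MagneticChain.periodicHamiltonian α A) ∧
      ∀ G : Set ℝ,
        MagneticChain.IsGap
          (MagneticChain.essentialSpectrum (MagneticChain.perturbedHamiltonian α A A₁ A₂)) G →
        ∃ E ∈ G,
          MagneticChain.IsSimpleEigenvalue
            (MagneticChain.perturbedHamiltonian α A A₁ A₂) (E : ℂ) ∧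
          ∀ E' ∈ G,
            MagneticChain.IsEigenvalue
              (MagneticChain.perturbedHamiltonian α A A₁ A₂) (E' : ℂ) → E' = E) := by
  have hc := MagneticChain.cos_mul_pi_ne_zero hA
  rw [MagneticChain.spectrum_periodicHamiltonian hc]
  refine ⟨MagneticChain.spectrum_of_not_fluxCondition hc, fun h => ?_⟩
  rw [MagneticChain.essentialSpectrum_of_fluxCondition hc h]
  exact ⟨rfl, fun G hG => MagneticChain.existsUnique_eigenvalue_in_gap hc h hG⟩
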